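/- Let $z_1=3^{-1/4}\omega^{7}$, $z_2=3^{-1/4}\omega^{17}$, $z_3=3^{-1/4}\omega^{19}$, $z_4=3^{-1/4}\omega^{5}$ with $\omega=e^{2\pi i/24}$ (the branch points of the inverse of $z(w)=\frac{w^2-1/3}{w(w^2-1)}$). Let $\Gamma_P$ be a simple analytic arc from $z_1$ to $z_2$ in the left half-plane and $\Gamma_R$ a simple analytic arc from $z_3$ to $z_4$ in the right half-plane. Let $\psi_P,\psi_Q,\psi_R$ be analytic in $\mathbb C\setminus\Gamma_P$, $\mathbb C\setminus(\Gamma_P\cup\Gamma_R\cup\{0\})$, $\mathbb C\setminus\Gamma_R$, respectively, such that $\psi_P(z),\psi_Q(z),\psi_R(z)$ are the three solutions $w$ of $zw^3-w^2-zw+\frac13=0$ and $\psi_P(\infty)=-1$, $\psi_Q(\infty)=0$, $\psi_R(\infty)=1$ (so $\psi_Q(0)=\infty$). They are the restrictions of the inverse $\psi$ of $z(w)$ to the sheets $\mathcal R_P=\overline{\mathbb C}\setminus\Gamma_P$, $\mathcal R_Q=\overline{\mathbb C}\setminus(\Gamma_P\cup\Gamma_R)$, $\mathcal R_R=\overline{\mathbb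 C}\setminus\Gamma_R$ of its Riemann surface. A subscript $+$ denotes the boundary value from the left of the oriented arc. The arcs are such that $$\frac{3}{2\pi i}\int_{z_1}^z(\psi_Q-\psi_P)_+(s)\,ds\in\mathbb R\ \ (z\in\Gamma_P),\qquad \frac{3}{2\pi i}\int_{z_3}^z(\psi_Q-\psi_R)_+(s)\,ds\in\mathbb R\ \ (z\in\Gamma_R).$$ Let $d\mu_P(s)=\frac{3}{2\pi i}(\psi_Q-\psi_P)_+(s)\,ds$ on $\Gamma_P$, $d\mu_R(s)=\frac{3}{2\pi i}(\psi_Q-\psi_R)_+(s)\,ds$ on $\Gamma_R$, $\mu_A=\mu_P+\mu_R$, and for $S\in\{P,R,A\}$ let $g_S(z)=\int\log(z-s)\,d\mu_S(s)$, where $s\mapsto\log(z-s)$ is any continuous branch on the support of $\mu_S$. Let $\sqrt{3w^4+1}$ be analytic off the cuts $\psi_{P+}(\Gamma_P)\cup\psi_{R+}(\Gamma_R)$ and positive for large positive $w$. Put $$\widetilde G(w)=\begin{cases}\frac1w\,e^{\frac{(w+1)(2w-1)}{w(w-1)}}, & w\in\psi(\mathcal R_P),\\[4pt] \frac{w^2-1}{w^2-1/3}\,e^{\frac{2w^2}{w^2-1}},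 & w\in\psi(\mathcal R_Q),\\[4pt] \frac1w\,e^{\frac{(w-1)(2w+1)}{w(w+1)}}, & w\in\psi(\mathcal R_R),\end{cases}$$ $$\widetilde F_1(w)=\frac{-w(w-1)\widetilde G(w)}{\sqrt{3w^4+1}},\qquad \widetilde F_2(w)=\frac{(w^2-1)\widetilde G(w)}{3\sqrt{3w^4+1}},\qquad \widetilde F_3(w)=\frac{w(w+1)\widetilde G(w)}{\sqrt{3w^4+1}},$$ and let $\widetilde N(z)$ be the $3\times3$ matrix whose $j$-th row is $\big(\widetilde F_j(\psi_P(z)),\widetilde F_j(\psi_Q(z)),\widetilde F_j(\psi_R(z))\big)$, where $\widetilde F_j(\psi_Q(0))=\widetilde F_j(\infty)$ is understood as a limit. Then for every $z\in\mathbb C\setminus(\Gamma_P\cup\Gamma_R)$ the values $g_P(z),g_A(z),g_R(z)$ exist, and, whichever branches of the logarithm are used, $$\widetilde N_{21}(z)=\frac{(\psi_P^2(z)-1)^2e^{g_P(z)}}{2\sqrt{3\psi_P^4(z)+1}},\qquad \widetilde N_{22}(z)=-\frac{z^2(\psi_Q^2(z)-1)^2e^{-g_A(z)}}{\sqrt{3\psi_Q^4(z)+1}},\qquad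 \widetilde N_{23}(z)=\frac{(\psi_R^2(z)-1)^2e^{g_R(z)}}{2\sqrt{3\psi_R^4(z)+1}},$$ where at $z=0$ the right-hand side of the second formula is understood as its limit as $z\to0$. -/

import Mathlib

open Set Filter Topology Complex

noncomputable section

namespace HermitePade

/-- The branch point `3^(-1/4) * ω₂₄^k` with `ω₂₄ = exp (2πi/24)`. -/
def branchPt (k : ℕ) : ℂ :=
  (((3 : ℝ) ^ (-(1 / 4) : ℝ) : ℝ) : ℂ) * exp (2 * Real.pi * I / 24) ^ k

/-- `z₁`, in the second quadrant. -/
def z1 : ℂ := branchPt 7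
/-- `z₂`, in the third quadrant. -/
def z2 : ℂ := branchPt 17
/-- `z₃`, in the fourth quadrant. -/
def z3 : ℂ := branchPt 19
/-- `z₄`, in the first quadrant. -/
def z4 : ℂ := branchPt 5

/-- `γ` parametrizes on `[0,1]` a simple regular real-analytic arc from `a` to `b`
(end points included). -/
structure IsAnalyticArc (γ : ℝ → ℂ) (a b : ℂ) : Prop where
  analytic : AnalyticOnNhd ℝ γ (Icc 0 1)
  regular : ∀ t ∈ Icc (0 : ℝ) 1, deriv γ t ≠ 0
  injOn : InjOn γ (Icc 0 1)
  source : γ 0 = a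
  target : γ 1 = b

/-- The boundary value `f₊(γ t)` from the left-hand side (the `+` side) of the oriented arc `γ`. -/
def plusValue (f : ℂ → ℂ) (γ : ℝ → ℂ) (t : ℝ) : ℂ :=
  limUnder (𝓝[>] (0 : ℝ)) fun ε : ℝ => f (γ t + (ε : ℂ) * I * deriv γ t)

/-- The density `(3 / (2πi)) (f - h)₊` at the point `γ t` of the arc `γ`. -/
def arcDensity (f h : ℂ → ℂ) (γ : ℝ → ℂ) (t : ℝ) : ℂ :=
  3 / (2 * Real.pi * I) * plusValue (fun z => f z - h z) γ t

/-- The three-sheeted Riemann surface of `z(w) = (w² - 1/3) / (w (w² - 1))`: the cuts `Γ_P`, `Γ_R`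
(given by parametrizations) and the three branches `ψ_P`, `ψ_Q`, `ψ_R` of the inverse function,
i.e. the restrictions of `ψ` to the sheets. On the sheet `Q` the point `z = 0` is the pole of
`ψ_Q`. The values of the branches on the cuts (and of `ψ_Q` at `0`) carry no information. -/
structure SheetStructure where
  /-- parametrization of the cut `Γ_P` -/
  γP : ℝ → ℂ
  /-- parametrization of the cut `Γ_R` -/
  γR : ℝ → ℂ
  ψP : ℂ → ℂ
  ψQ : ℂ → ℂ
  ψR : ℂ → ℂ
  arcP : IsAnalyticArc γP z1 z2
  arcR : IsAnalyticArc γR z3 z4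
  leftP : ∀ t ∈ Icc (0 : ℝ) 1, (γP t).re < 0
  rightR : ∀ t ∈ Icc (0 : ℝ) 1, 0 < (γR t).re
  holoP : DifferentiableOn ℂ ψP (γP '' Icc 0 1)ᶜ
  holoQ : DifferentiableOn ℂ ψQ (γP '' Icc 0 1 ∪ γR '' Icc 0 1 ∪ {0})ᶜ
  holoR : DifferentiableOn ℂ ψR (γR '' Icc 0 1)ᶜ
  /-- `ψ_P(z)`, `ψ_Q(z)`, `ψ_R(z)` are the three solutions of `z w³ - w² - z w + 1/3 = 0`. -/
  cubic : ∀ z ∈ (γP '' Icc 0 1 ∪ γR '' Icc 0 1 ∪ {0})ᶜ, ∀ w : ℂ,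
    z * w ^ 3 - w ^ 2 - z * w + 1 / 3 = z * (w - ψP z) * (w - ψQ z) * (w - ψR z)
  inftyP : Tendsto ψP (Bornology.cobounded ℂ) (𝓝 (-1))
  inftyQ : Tendsto ψQ (Bornology.cobounded ℂ) (𝓝 0)
  inftyR : Tendsto ψR (Bornology.cobounded ℂ) (𝓝 1)
  /-- `(3 / (2πi)) ∫_{z₁}^z (ψ_Q - ψ_P)₊(s) ds` is real for `z` on `Γ_P`. -/
  trajP : ∀ t ∈ Icc (0 : ℝ) 1, (∫ u in (0 : ℝ)..t, arcDensity ψQ ψP γP u * deriv γP u).im = 0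
  /-- `(3 / (2πi)) ∫_{z₃}^z (ψ_Q - ψ_R)₊(s) ds` is real for `z` on `Γ_R`. -/
  trajR : ∀ t ∈ Icc (0 : ℝ) 1, (∫ u in (0 : ℝ)..t, arcDensity ψQ ψR γR u * deriv γR u).im = 0

/-- `g` is a value of `∫ log (z - s) dμ(s)`, where `dμ(s) = ρ ds` on the arc `γ` and
`s ↦ log (z - s)` is a continuous branch of the logarithm along the arc. -/
def IsLogPotential (γ ρ : ℝ → ℂ) (z g : ℂ) : Prop :=
  ∃ l : ℝ → ℂ, ContinuousOn l (Icc 0 1) ∧ (∀ t ∈ Icc (0 : ℝ) 1, exp (l t) = z - γ t) ∧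
    g = ∫ t in (0 : ℝ)..1, l t * (ρ t * deriv γ t)

namespace SheetStructure

variable (S : SheetStructure)

/-- The cut `Γ_P`. -/
def ΓP : Set ℂ := S.γP '' Icc 0 1

/-- The cut `Γ_R`. -/
def ΓR : Set ℂ := S.γR '' Icc 0 1

/-- `g` is a value of `g_P(z) = ∫ log (z - s) dμ_P(s)`,
`dμ_P(s) = (3 / (2πi)) (ψ_Q - ψ_P)₊(s) ds` on `Γ_P`. -/
def IsGP (z g : ℂ) : Prop := IsLogPotential S.γP (arcDensity S.ψQ S.ψP S.γP) z g

/-- `g` is a value of `g_R(z) = ∫ log (z - s) dμ_R(s)`,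
`dμ_R(s) = (3 / (2πi)) (ψ_Q - ψ_R)₊(s) ds` on `Γ_R`. -/
def IsGR (z g : ℂ) : Prop := IsLogPotential S.γR (arcDensity S.ψQ S.ψR S.γR) z g

/-- `g` is a value of `g_A(z) = ∫ log (z - s) dμ_A(s)`, `μ_A = μ_P + μ_R` on `Γ_P ∪ Γ_R`. As the
two arcs are disjoint, a continuous branch of the logarithm on the union consists of independent
continuous branches on the two arcs. -/
def IsGA (z g : ℂ) : Prop := ∃ a b : ℂ, S.IsGP z a ∧ S.IsGR z b ∧ g = a + b

/-- `r` is the branch of `√(3w⁴+1)` that is analytic off the cuts `ψ_{P+}(Γ_P)` and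
`ψ_{R+}(Γ_R)` and positive for large positive `w`. -/
structure IsSqrtBranch (r : ℂ → ℂ) : Prop where
  holo : DifferentiableOn ℂ r
    (plusValue S.ψP S.γP '' Icc 0 1 ∪ plusValue S.ψR S.γR '' Icc 0 1)ᶜ
  sq : ∀ w ∈ (plusValue S.ψP S.γP '' Icc 0 1 ∪ plusValue S.ψR S.γR '' Icc 0 1)ᶜ,
    r w ^ 2 = 3 * w ^ 4 + 1
  pos : ∀ᶠ x : ℝ in atTop, r x = (Real.sqrt (3 * x ^ 4 + 1) : ℂ)

/-- The image `ψ(𝓡_P)` of the sheet `P`, which contains `ψ_P(∞) = -1`. -/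
def imageP : Set ℂ := insert (-1) (S.ψP '' S.ΓPᶜ)

/-- The finite part of the image `ψ(𝓡_Q)` of the sheet `Q`, which contains `ψ_Q(∞) = 0`
(the point at infinity `ψ_Q(0)` is left out). -/
def imageQ : Set ℂ := insert 0 (S.ψQ '' (S.ΓP ∪ S.ΓR ∪ {0})ᶜ)

/-- The image `ψ(𝓡_R)` of the sheet `R`, which contains `ψ_R(∞) = 1`. -/
def imageR : Set ℂ := insert 1 (S.ψR '' S.ΓRᶜ)

open Classical in
/-- The function `G̃` (given the value `0` on the curves that bound the three images). -/
def G (w : ℂ) : ℂ :=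
  if w ∈ S.imageP then 1 / w * exp ((w + 1) * (2 * w - 1) / (w * (w - 1)))
  else if w ∈ S.imageQ then
    (w ^ 2 - 1) / (w ^ 2 - 1 / 3) * exp (2 * w ^ 2 / (w ^ 2 - 1))
  else if w ∈ S.imageR then 1 / w * exp ((w - 1) * (2 * w + 1) / (w * (w + 1)))
  else 0

/-- The functions `F̃₁`, `F̃₂`, `F̃₃` (with indices `0`, `1`, `2`). -/
def F (r : ℂ → ℂ) : Fin 3 → ℂ → ℂ :=
  ![fun w => -w * (w - 1) * S.G w / r w,
    fun w => (w ^ 2 - 1) * S.G w / (3 * r w),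
    fun w => w * (w + 1) * S.G w / r w]

/-- The value `F̃ᵢ(ψ_Q(z))`; at `z = 0`, where `ψ_Q(0) = ∞`, it is the limit as `z → 0`. -/
def FQ (r : ℂ → ℂ) (i : Fin 3) (z : ℂ) : ℂ :=
  if z = 0 then limUnder (𝓝[≠] (0 : ℂ)) fun x => S.F r i (S.ψQ x) else S.F r i (S.ψQ z)

/-- The `3 × 3` matrix `Ñ(z)`. -/
def Ntilde (r : ℂ → ℂ) (z : ℂ) : Matrix (Fin 3) (Fin 3) ℂ :=
  Matrix.of fun i => ![S.F r i (S.ψP z), S.FQ r i z, S.F r i (S.ψR z)]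

end SheetStructure

end HermitePade

end

/-!
Everything follows from a closed form of the exponentials of the potentials. On one cut, with
`w = ψ_P(z)` or `w = ψ_R(z)` and `c = w(∞) = ∓1`,

  `exp (g(z)) = (2/3) / (w³ - w) · exp (3 (w - c) z - 1)`   (`SingleCut.exp_potential`).

The density of the measure is, up to the factor `3 / (2πi)`, the jump of `ψ_Q - ψ_P` over the cut.
Crossing `Γ_P` interchanges `ψ_P` and `ψ_Q` (`SingleCut.exists_sides_neg`: the cubic has distinct
roots in the interior of the arc, so the only alternative is that `ψ_P` continues analytically to
the whole plane, which Liouville's theorem excludes). Hence the density is the jump of `ψ_P`, and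
since `ψ_P` is bounded near the arc, it is recovered from this jump by a Cauchy type integral
(`IsAnalyticArc.eq_add_cauchyTransform`), which says that the derivative of `g` is `3 (w - c)`. As
`3z` is the logarithmic derivative of `w³ - w` with respect to `w`, the right-hand side above has
the same logarithmic derivative. The total mass is `1`, so both sides are asymptotic to `z` at
infinity; an arc does not separate the plane (`IsAnalyticArc.eq_of_deriv_eq_zero`), and the two
sides are equal everywhere. Only `exp g` enters, and it is independent of the branch of the
logarithm because the mass is an integer.

The formulas for the first and the last column are then algebra modulo the cubic equation. For the
middle column, the relations between roots and coefficients express the potential of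
`μ_P + μ_R` by `ψ_Q` (`SheetStructure.exp_neg_gA`). At `z = 0`, where `ψ_Q` has its pole, the entry
has a limit because `√(3w⁴ + 1)` is `√3 w²` to leading order.

No theory of boundary values is presupposed. An analytic arc is straightened locally by the
holomorphic extension of its parametrization (`IsAnalyticArc.exists_straightening`), the jump of a
Cauchy type integral is read off by moving a piece of the contour to a half circle in the
parameter plane, and the end points of the arc are removable singularities since the functions
involved do not grow as fast as a pole there.
-/

noncomputable section

namespace HermitePade

open Metric MeasureTheory

/-! ### Straightening an analytic arc -/

/-- A real-analytic function on a neighbourhood of `t₀` in `ℝ` is the restriction of a function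
which is analytic at `t₀` in the complex sense: its Taylor series also converges at complex points
close to `t₀`. -/
theorem exists_analyticAt_extension {γ : ℝ → ℂ} {t₀ : ℝ} (h : AnalyticAt ℝ γ t₀) :
    ∃ f : ℂ → ℂ, AnalyticAt ℂ f t₀ ∧ ∀ᶠ t : ℝ in 𝓝 t₀, f t = γ t := by
  obtain ⟨p, hp⟩ := h
  let q : FormalMultilinearSeries ℂ ℂ ℂ := FormalMultilinearSeries.ofScalars ℂ p.coeff
  have hr : 0 < q.radius := by
    refine hp.radius_pos.trans_le (FormalMultilinearSeries.radius_le_of_le fun n => ?_)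
    simp only [q]
    rw [FormalMultilinearSeries.ofScalars_norm, FormalMultilinearSeries.norm_apply_eq_norm_coef]
  have hq : HasFPowerSeriesAt (fun ζ => q.sum (ζ - t₀)) q (t₀ : ℂ) := by
    have := (q.hasFPowerSeriesOnBall hr).hasFPowerSeriesAt
    have h2 := this.comp_sub (t₀ : ℂ)
    simpa using h2
  refine ⟨_, hq.analyticAt, ?_⟩
  rw [hasFPowerSeriesAt_iff'] at hp hq
  have hq' := (continuous_ofReal.tendsto t₀).eventually hq
  filter_upwards [hp, hq'] with t h1 h2
  refine h2.unique ?_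
  convert h1 using 2 with n
  simp only [q, FormalMultilinearSeries.coeff_ofScalars, smul_eq_mul, real_smul]
  push_cast
  rfl

/-- A holomorphic chart `φ` on the disc of radius `δ` about `t₀` which extends `γ`, so that near
`γ t₀` the arc becomes a piece of the real axis. The points with positive imaginary part correspond
to the left-hand side of the arc. -/
structure IsStraightening (γ : ℝ → ℂ) (t₀ δ : ℝ) (φ : OpenPartialHomeomorph ℂ ℂ) : Prop where
  pos : 0 < δ
  source_eq : φ.source = ball (t₀ : ℂ) δ
  diff : DifferentiableOn ℂ φ φ.source
  diff_symm : DifferentiableOn ℂ φ.symm φ.target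
  apply_ofReal : ∀ t : ℝ, |t - t₀| < δ → φ t = γ t
  mem_image_iff : ∀ ζ ∈ φ.source, φ ζ ∈ γ '' Icc 0 1 ↔ ∃ t ∈ Icc (0 : ℝ) 1, ζ = t

theorem ofReal_mem_ball {t t₀ δ : ℝ} : (t : ℂ) ∈ ball (t₀ : ℂ) δ ↔ |t - t₀| < δ := by
  rw [mem_ball, dist_eq_norm, ← ofReal_sub, norm_real, Real.norm_eq_abs]

namespace IsStraightening

variable {γ : ℝ → ℂ} {t₀ δ : ℝ} {φ : OpenPartialHomeomorph ℂ ℂ}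

theorem center_mem (h : IsStraightening γ t₀ δ φ) : (t₀ : ℂ) ∈ φ.source := by
  rw [h.source_eq]; exact mem_ball_self h.pos

theorem apply_center (h : IsStraightening γ t₀ δ φ) : φ t₀ = γ t₀ :=
  h.apply_ofReal t₀ (by simpa using h.pos)

theorem target_mem_nhds (h : IsStraightening γ t₀ δ φ) : φ.target ∈ 𝓝 (γ t₀) :=
  φ.open_target.mem_nhds (h.apply_center ▸ φ.map_source h.center_mem)

theorem mono (h : IsStraightening γ t₀ δ φ) {δ' : ℝ} (h0 : 0 < δ') (h1 : δ' ≤ δ) :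
    IsStraightening γ t₀ δ' (φ.restrOpen (ball (t₀ : ℂ) δ') isOpen_ball) where
  pos := h0
  source_eq := by
    rw [OpenPartialHomeomorph.restrOpen_source, h.source_eq]
    exact inter_eq_self_of_subset_right (ball_subset_ball h1)
  diff := h.diff.mono inter_subset_left
  diff_symm := h.diff_symm.mono inter_subset_left
  apply_ofReal t ht := h.apply_ofReal t (ht.trans_le h1)
  mem_image_iff ζ hζ := h.mem_image_iff ζ hζ.1

theorem differentiableAt (h : IsStraightening γ t₀ δ φ) {ζ : ℂ} (hζ : ζ ∈ φ.source) :
    DifferentiableAt ℂ φ ζ := h.diff.differentiableAt (φ.open_source.mem_nhds hζ)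

theorem deriv_ne_zero (h : IsStraightening γ t₀ δ φ) {ζ : ℂ} (hζ : ζ ∈ φ.source) :
    deriv φ ζ ≠ 0 := by
  intro h0
  have h1 : DifferentiableAt ℂ φ.symm (φ ζ) :=
    h.diff_symm.differentiableAt (φ.open_target.mem_nhds (φ.map_source hζ))
  have h2 := h1.hasDerivAt.comp ζ (h.differentiableAt hζ).hasDerivAt
  rw [h0, mul_zero] at h2
  have h3 : HasDerivAt (φ.symm ∘ φ) 1 ζ := by
    refine (hasDerivAt_id ζ).congr_of_eventuallyEq ?_
    filter_upwards [φ.open_source.mem_nhds hζ] with x hx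
    simpa using φ.left_inv hx
  exact one_ne_zero (h3.unique h2)

theorem hasDerivAt_ofReal (h : IsStraightening γ t₀ δ φ) {t : ℝ} (ht : |t - t₀| < δ) :
    HasDerivAt γ (deriv φ t) t := by
  have hm : (t : ℂ) ∈ φ.source := by rw [h.source_eq]; exact ofReal_mem_ball.2 ht
  have h1 := (h.differentiableAt hm).hasDerivAt.comp_ofReal
  refine h1.congr_of_eventuallyEq ?_
  have : ∀ᶠ s : ℝ in 𝓝 t, |s - t₀| < δ :=
    (continuous_abs.comp (continuous_id.sub continuous_const)).continuousAt.eventually_lt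
      continuousAt_const ht
  filter_upwards [this] with s hs
  exact (h.apply_ofReal s hs).symm

theorem deriv_ofReal (h : IsStraightening γ t₀ δ φ) {t : ℝ} (ht : |t - t₀| < δ) :
    deriv γ t = deriv φ t := (h.hasDerivAt_ofReal ht).deriv

theorem map_notMem (h : IsStraightening γ t₀ δ φ) {ζ : ℂ} (hζ : ζ ∈ φ.source)
    (him : ζ.im ≠ 0) : φ ζ ∉ γ '' Icc 0 1 := by
  rw [h.mem_image_iff ζ hζ]
  rintro ⟨t, -, rfl⟩
  exact him (ofReal_im t)

end IsStraightening

namespace IsAnalyticArc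

variable {γ : ℝ → ℂ} {a b : ℂ}

theorem continuousOn (h : IsAnalyticArc γ a b) : ContinuousOn γ (Icc 0 1) :=
  h.analytic.continuousOn

theorem isCompact_image (h : IsAnalyticArc γ a b) : IsCompact (γ '' Icc 0 1) :=
  isCompact_Icc.image_of_continuousOn h.continuousOn

theorem isClosed_image (h : IsAnalyticArc γ a b) : IsClosed (γ '' Icc 0 1) :=
  h.isCompact_image.isClosed

theorem continuousOn_deriv (h : IsAnalyticArc γ a b) : ContinuousOn (deriv γ) (Icc 0 1) :=
  h.analytic.deriv.continuousOn

/-- The complement of an arc is dense, because a smooth curve has Hausdorff dimension one. -/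
theorem dense_compl (h : IsAnalyticArc γ a b) : Dense (γ '' Icc 0 1)ᶜ := by
  refine ContDiffOn.dense_compl_image_of_dimH_lt_finrank
    (h.analytic.contDiffOn (uniqueDiffOn_Icc one_pos)) (convex_Icc 0 1) subset_rfl ?_
  refine (dimH_mono (subset_univ _)).trans_lt ?_
  rw [Real.dimH_univ, Complex.finrank_real_complex]
  norm_num

/-- Every point of an analytic arc, end points included, has a straightening chart. Regularity makes
the holomorphic extension of the parametrization locally invertible, and injectivity keeps the rest
of the arc away. -/
theorem exists_straightening (h : IsAnalyticArc γ a b) {t₀ : ℝ} (ht₀ : t₀ ∈ Icc (0 : ℝ) 1)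
    {V : Set ℂ} (hV : V ∈ 𝓝 (γ t₀)) {ε : ℝ} (hε : 0 < ε) :
    ∃ δ φ, IsStraightening γ t₀ δ φ ∧ δ ≤ ε ∧ φ.target ⊆ V := by
  obtain ⟨f, hf, hfγ⟩ := exists_analyticAt_extension (h.analytic t₀ ht₀)
  have hf0 : f t₀ = γ t₀ := hfγ.self_of_nhds
  have hderiv : deriv f t₀ ≠ 0 := by
    have h1 := hf.differentiableAt.hasDerivAt.comp_ofReal
    have h2 : HasDerivAt γ (deriv f t₀) t₀ := h1.congr_of_eventuallyEq
      (hfγ.mono fun _ hs => hs.symm)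
    rw [← h2.deriv]
    exact h.regular t₀ ht₀
  let i : ℂ ≃L[ℂ] ℂ := .unitsEquivAut ℂ (.mk0 _ hderiv)
  have hfd : HasStrictFDerivAt f i.toContinuousLinearMap (t₀ : ℂ) := hf.hasStrictDerivAt
  let R : OpenPartialHomeomorph ℂ ℂ := hfd.toOpenPartialHomeomorph _
  have hR : ⇑R = f := hfd.toOpenPartialHomeomorph_coe
  have hx : (t₀ : ℂ) ∈ R.source := hfd.mem_toOpenPartialHomeomorph_source
  -- the points of the arc close to `γ t₀` have parameters close to `t₀`
  have hsep : ∀ η > 0, ∃ κ > 0, ∀ t ∈ Icc (0 : ℝ) 1, dist (γ t) (γ t₀) < κ → |t - t₀| < η := by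
    intro η hη
    have hK : IsCompact (γ '' (Icc 0 1 \ ball t₀ η)) :=
      (isCompact_Icc.diff isOpen_ball).image_of_continuousOn
        (h.continuousOn.mono sdiff_subset)
    have hnot : γ t₀ ∈ (γ '' (Icc 0 1 \ ball t₀ η))ᶜ := by
      rintro ⟨t, ht, hteq⟩
      exact ht.2 (h.injOn ht.1 ht₀ hteq ▸ mem_ball_self hη)
    obtain ⟨κ, hκ, hsub⟩ := Metric.isOpen_iff.1 hK.isClosed.isOpen_compl _ hnot
    refine ⟨κ, hκ, fun t ht hd => ?_⟩
    by_contra hcon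
    exact hsub hd ⟨t, ⟨ht, by simpa [Real.dist_eq] using hcon⟩, rfl⟩
  have hev : ∀ᶠ ζ in 𝓝 (t₀ : ℂ), ζ ∈ R.source ∧ AnalyticAt ℂ f ζ ∧ deriv f ζ ≠ 0 :=
    (R.open_source.eventually_mem hx).and
      (hf.eventually_analyticAt.and (hf.deriv.continuousAt.eventually_ne hderiv))
  obtain ⟨δ₁, hδ₁, hb₁⟩ := Metric.eventually_nhds_iff_ball.1 hev
  obtain ⟨δ₂, hδ₂, hb₂⟩ := Metric.eventually_nhds_iff.1 hfγ
  obtain ⟨κ, hκ, hsep'⟩ := hsep (min δ₁ δ₂) (lt_min hδ₁ hδ₂)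
  have hcont : ∀ᶠ ζ in 𝓝 (t₀ : ℂ), f ζ ∈ V ∩ ball (γ t₀) κ :=
    hf.continuousAt.eventually (by rw [hf0]; exact inter_mem hV (ball_mem_nhds _ hκ))
  obtain ⟨δ₃, hδ₃, hb₃⟩ := Metric.eventually_nhds_iff_ball.1 hcont
  let δ := min (min δ₁ δ₂) (min δ₃ ε)
  have hδ0 : 0 < δ := lt_min (lt_min hδ₁ hδ₂) (lt_min hδ₃ hε)
  have hδ1 : δ ≤ δ₁ := (min_le_left _ _).trans (min_le_left _ _)
  have hδ2 : δ ≤ δ₂ := (min_le_left _ _).trans (min_le_right _ _)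
  have hδ3 : δ ≤ δ₃ := (min_le_right _ _).trans (min_le_left _ _)
  have hsource : (R.restrOpen (ball (t₀ : ℂ) δ) isOpen_ball).source = ball (t₀ : ℂ) δ := by
    rw [OpenPartialHomeomorph.restrOpen_source]
    exact inter_eq_self_of_subset_right fun ζ hζ => (hb₁ ζ (ball_subset_ball hδ1 hζ)).1
  refine ⟨δ, R.restrOpen (ball (t₀ : ℂ) δ) isOpen_ball, ⟨hδ0, hsource, ?_, ?_, ?_, ?_⟩,
    (min_le_right _ _).trans (min_le_right _ _), ?_⟩
  · rw [hsource, OpenPartialHomeomorph.coe_restrOpen, hR]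
    exact fun ζ hζ =>
      (hb₁ ζ (ball_subset_ball hδ1 hζ)).2.1.differentiableAt.differentiableWithinAt
  · intro z hz
    have hs := (R.restrOpen (ball (t₀ : ℂ) δ) isOpen_ball).map_target hz
    rw [hsource] at hs
    have hζ := hb₁ _ (ball_subset_ball hδ1 hs)
    refine (OpenPartialHomeomorph.hasDerivAt_symm _ hz hζ.2.2 ?_).differentiableAt
      |>.differentiableWithinAt
    rw [OpenPartialHomeomorph.coe_restrOpen, hR]
    exact hζ.2.1.differentiableAt.hasDerivAt
  · intro t ht
    rw [OpenPartialHomeomorph.coe_restrOpen, hR]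
    exact hb₂ (by rw [Real.dist_eq]; exact ht.trans_le hδ2)
  · intro ζ hζ
    rw [hsource] at hζ
    rw [OpenPartialHomeomorph.coe_restrOpen, hR]
    constructor
    · rintro ⟨t, ht, hteq⟩
      refine ⟨t, ht, ?_⟩
      have hd := (hb₃ ζ (ball_subset_ball hδ3 hζ)).2
      rw [← hteq] at hd
      have habs := hsep' t ht hd
      have ht1 : f t = γ t := hb₂ (by
        rw [Real.dist_eq]; exact habs.trans_le (min_le_right _ _))
      refine R.injOn (hb₁ ζ (ball_subset_ball hδ1 hζ)).1
        (hb₁ t (ofReal_mem_ball.2 (habs.trans_le (min_le_left _ _)))).1 ?_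
      rw [hR, ht1, hteq]
    · rintro ⟨t, ht, rfl⟩
      exact ⟨t, ht, (hb₂ (by
        rw [Real.dist_eq]; exact (ofReal_mem_ball.1 hζ).trans_le hδ2)).symm⟩
  · rintro z hz
    have hs := (R.restrOpen (ball (t₀ : ℂ) δ) isOpen_ball).map_target hz
    have hz' := (R.restrOpen (ball (t₀ : ℂ) δ) isOpen_ball).right_inv hz
    rw [hsource] at hs
    rw [OpenPartialHomeomorph.coe_restrOpen, hR] at hz'
    exact hz' ▸ (hb₃ _ (ball_subset_ball hδ3 hs)).1

end IsAnalyticArc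

/-! ### Extending holomorphic functions across the arc -/

/-- `E`, a function of interest off the set `K` only, extends holomorphically to a neighbourhood of
`p`. -/
def ExtendsAt (E : ℂ → ℂ) (K : Set ℂ) (p : ℂ) : Prop :=
  ∃ V ∈ 𝓝 p, ∃ F : ℂ → ℂ, DifferentiableOn ℂ F V ∧ EqOn F E (V \ K)

theorem extendsAt_of_notMem {E : ℂ → ℂ} {K : Set ℂ} (hK : IsClosed K)
    (hE : DifferentiableOn ℂ E Kᶜ) {p : ℂ} (hp : p ∉ K) : ExtendsAt E K p :=
  ⟨Kᶜ, hK.isOpen_compl.mem_nhds hp, E, hE, fun _ _ => rfl⟩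

/-- Local extensions across a set with dense complement agree where they meet. -/
theorem exists_extension {E : ℂ → ℂ} {K U : Set ℂ} (hK : Dense Kᶜ)
    (h : ∀ p ∈ U, ExtendsAt E K p) :
    ∃ F : ℂ → ℂ, (∀ p ∈ U, DifferentiableAt ℂ F p) ∧ EqOn F E (U \ K) := by
  have key : ∀ p ∈ U, ∃ V ∈ 𝓝 p, ∃ F : ℂ → ℂ, DifferentiableOn ℂ F V ∧ EqOn F E (V \ K) ∧
      EqOn (fun z => limUnder (𝓝[Kᶜ] z) E) F V := by
    intro p hp
    obtain ⟨V, hV, F, hF, hFE⟩ := h p hp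
    obtain ⟨W, hWV, hW, hpW⟩ := _root_.mem_nhds_iff.1 hV
    refine ⟨W, hW.mem_nhds hpW, F, hF.mono hWV, hFE.mono (sdiff_subset_sdiff_left hWV), ?_⟩
    intro z hz
    have hne : (𝓝[Kᶜ] z).NeBot := mem_closure_iff_nhdsWithin_neBot.1 (hK z)
    refine Tendsto.limUnder_eq ?_
    have hc : Tendsto F (𝓝[Kᶜ] z) (𝓝 (F z)) :=
      ((hF.mono hWV).continuousOn.continuousAt (hW.mem_nhds hz)).tendsto.mono_left
        nhdsWithin_le_nhds
    refine hc.congr' ?_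
    filter_upwards [self_mem_nhdsWithin, nhdsWithin_le_nhds (hW.mem_nhds hz)] with x hx hxW
    exact hFE ⟨hWV hxW, hx⟩
  refine ⟨fun z => limUnder (𝓝[Kᶜ] z) E, fun p hp => ?_, fun p hp => ?_⟩
  · obtain ⟨V, hV, F, hF, -, hlim⟩ := key p hp
    exact (hF.differentiableAt hV).congr_of_eventuallyEq (hlim.eventuallyEq_of_mem hV)
  · obtain ⟨V, hV, F, -, hFE, hlim⟩ := key p hp.1
    exact (hlim (mem_of_mem_nhds hV)).trans (hFE ⟨mem_of_mem_nhds hV, hp.2⟩)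

/-- Liouville's theorem for a function which extends across a bounded exceptional set. -/
theorem eq_of_extendsAt_of_tendsto {E : ℂ → ℂ} {K : Set ℂ} (hK : Dense Kᶜ)
    (hKb : Bornology.IsBounded K) (h : ∀ p, ExtendsAt E K p) {c : ℂ}
    (hc : Tendsto E (Bornology.cobounded ℂ) (𝓝 c)) {z : ℂ} (hz : z ∉ K) : E z = c := by
  obtain ⟨F, hF, hFE⟩ := exists_extension (U := univ) hK fun p _ => h p
  have hFd : Differentiable ℂ F := fun p => hF p (mem_univ p)
  have hlim : Tendsto F (cocompact ℂ) (𝓝 c) := by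
    rw [← Metric.cobounded_eq_cocompact]
    refine hc.congr' ?_
    filter_upwards [Bornology.isBounded_def.1 hKb] with x hx
    exact (hFE ⟨mem_univ x, hx⟩).symm
  rw [← hFE ⟨mem_univ z, hz⟩]
  exact hFd.apply_eq_of_tendsto_cocompact z hlim

theorem norm_sq_sub_sq_of_mem_sphere {ζ : ℂ} {x r : ℝ} (h : ζ ∈ sphere (x : ℂ) r) :
    ‖(ζ - x) ^ 2 - (r : ℂ) ^ 2‖ = 2 * r * |ζ.im| := by
  have hr : ‖ζ - x‖ = r := by rwa [mem_sphere, dist_eq_norm] at h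
  have h1 : (r : ℂ) ^ 2 = (ζ - x) * (starRingEnd ℂ) (ζ - x) := by
    rw [mul_conj, normSq_eq_norm_sq, hr]; push_cast; rfl
  have h2 : (ζ - x) ^ 2 - (r : ℂ) ^ 2 = (ζ - x) * (2 * ζ.im * I) := by
    have h3 : (ζ - x) - (starRingEnd ℂ) (ζ - x) = 2 * ζ.im * I := by
      rw [sub_conj]; simp
    rw [h1, ← h3]; ring
  rw [h2, norm_mul, hr]
  simp
  ring

/-- A removable singularity criterion which asks nothing of `f` on the real axis: if
`ζ.im * f ζ → 0` off the real axis, then the singularity at the real point `c` is removable.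
On a circle of radius `r` about a real point `x` one has `|(ζ - x)² - r²| = 2 r |Im ζ|`, so the
maximum principle for `((ζ - x)² - r²) f ζ` turns the hypothesis into `f ζ = o(1 / (ζ - c))`. -/
theorem exists_extension_of_tendsto_im_mul {f : ℂ → ℂ} {c δ : ℝ} (hδ : 0 < δ)
    (hf : DifferentiableOn ℂ f (ball (c : ℂ) δ \ {(c : ℂ)}))
    (hlim : Tendsto (fun ζ : ℂ => (ζ.im : ℂ) * f ζ) (𝓝[{ζ | ζ.im ≠ 0}] (c : ℂ)) (𝓝 0)) :
    ∃ g : ℂ → ℂ, DifferentiableOn ℂ g (ball (c : ℂ) δ) ∧ ∀ ζ : ℂ, ζ ≠ c → g ζ = f ζ := by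
  have hmain : f =o[𝓝[≠] (c : ℂ)] fun z => (z - c)⁻¹ := by
    rw [Asymptotics.isLittleO_iff]
    intro ε hε
    obtain ⟨r₀, hr₀, hb⟩ : ∃ r₀ > 0, ∀ ζ : ℂ, dist ζ c < r₀ → |ζ.im| * ‖f ζ‖ ≤ ε / 4 := by
      have h1 := hlim (Metric.closedBall_mem_nhds (0 : ℂ) (by positivity : 0 < ε / 4))
      rw [mem_map, mem_nhdsWithin_iff] at h1
      obtain ⟨r₀, hr₀, hsub⟩ := h1
      refine ⟨r₀, hr₀, fun ζ hζ => ?_⟩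
      by_cases him : ζ.im = 0
      · rw [him]; simp; positivity
      · have := hsub ⟨hζ, him⟩
        simpa using this
    have hr1 : 0 < min r₀ δ := lt_min hr₀ hδ
    rw [eventually_nhdsWithin_iff]
    filter_upwards [ball_mem_nhds (c : ℂ) (by positivity : 0 < min r₀ δ / 2)] with z hz hzc
    have hzc' : 0 < ‖z - c‖ := norm_pos_iff.2 (sub_ne_zero.2 hzc)
    rw [mem_ball, dist_eq_norm] at hz
    rw [norm_inv, ← div_eq_mul_inv, le_div_iff₀ hzc']
    set u := |z.re - c|
    set y := |z.im|
    have hle : ‖z - c‖ ≤ u + y := by simpa using norm_le_abs_re_add_abs_im (z - c)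
    have hu : u ≤ ‖z - c‖ := by simpa using abs_re_le_norm (z - c)
    have hu0 : 0 ≤ u := abs_nonneg _
    have hfz := norm_nonneg (f z)
    have hyf : y * ‖f z‖ ≤ ε / 4 := hb z (by
      rw [dist_eq_norm]; exact hz.trans_le ((half_le_self hr1.le).trans (min_le_left _ _)))
    rcases le_or_gt u (2 * y) with hcase | hcase
    · calc ‖f z‖ * ‖z - c‖ ≤ ‖f z‖ * (3 * y) := by gcongr; linarith
        _ ≤ ε := by linarith
    · have hy0 : 0 ≤ y := abs_nonneg _
      have hupos : 0 < u := by linarith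
      set r := 3 * u / 4 with hr
      have hrpos : 0 < r := by positivity
      have hxc : dist (z.re : ℂ) c = u := by
        rw [dist_eq_norm, ← ofReal_sub, norm_real, Real.norm_eq_abs]
      have hball : ∀ ζ ∈ closedBall (z.re : ℂ) r, dist ζ c < min r₀ δ ∧ ζ ≠ c := by
        intro ζ hζ
        rw [mem_closedBall] at hζ
        constructor
        · have := dist_triangle ζ (z.re : ℂ) c
          linarith
        · rintro rfl
          rw [dist_comm] at hζ
          linarith
      have hdiff : DiffContOnCl ℂ (fun ζ => ((ζ - z.re) ^ 2 - (r : ℂ) ^ 2) * f ζ)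
          (ball (z.re : ℂ) r) := by
        refine DifferentiableOn.diffContOnCl_ball (U := closedBall (z.re : ℂ) r) ?_ subset_rfl
        refine DifferentiableOn.mul (by fun_prop) (hf.mono fun ζ hζ => ?_)
        exact ⟨mem_ball.2 ((hball ζ hζ).1.trans_le (min_le_right _ _)), (hball ζ hζ).2⟩
      have hz_mem : z ∈ closure (ball (z.re : ℂ) r) := by
        rw [closure_ball _ hrpos.ne', mem_closedBall, dist_eq_norm]
        have h1 : z - z.re = z.im * I := by
          apply Complex.ext <;> simp
        rw [h1, norm_mul, norm_I, norm_real, mul_one, Real.norm_eq_abs]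
        change y ≤ r
        linarith
      have hmax := norm_le_of_forall_mem_frontier_norm_le isBounded_ball hdiff
        (C := 2 * r * (ε / 4)) (fun ζ hζ => by
          rw [frontier_ball _ hrpos.ne'] at hζ
          rw [norm_mul, norm_sq_sub_sq_of_mem_sphere hζ, mul_assoc]
          gcongr
          exact hb ζ ((hball ζ (sphere_subset_closedBall hζ)).1.trans_le (min_le_left _ _)))
        hz_mem
      have h2 : (z - z.re) ^ 2 - (r : ℂ) ^ 2 = ((-(z.im ^ 2 + r ^ 2) : ℝ) : ℂ) := by
        have h1 : z - z.re = z.im * I := by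
          apply Complex.ext <;> simp
        rw [h1, mul_pow, I_sq]; push_cast; ring
      rw [norm_mul, h2, norm_real, norm_neg, Real.norm_of_nonneg (by positivity)] at hmax
      have h3 : r * ‖f z‖ ≤ ε / 2 := by
        have h4 : r * (r * ‖f z‖) ≤ r * (ε / 2) := by
          nlinarith [mul_nonneg (sq_nonneg z.im) hfz]
        exact le_of_mul_le_mul_left h4 hrpos
      calc ‖f z‖ * ‖z - c‖ ≤ ‖f z‖ * (2 * r) := by gcongr; linarith
        _ ≤ ε := by linarith
  have hconst : (fun _ : ℂ => f c) =o[𝓝[≠] (c : ℂ)] fun z => (z - c)⁻¹ := by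
    have : IsBoundedUnder (· ≤ ·) (𝓝[≠] (c : ℂ))
        fun z => ‖(fun _ : ℂ => f c + f c) z - (fun _ : ℂ => f c) c‖ :=
      ⟨‖f c‖, by simp⟩
    simpa using this.isLittleO_sub_self_inv
  exact ⟨_, differentiableOn_update_limUnder_of_isLittleO (ball_mem_nhds _ hδ) hf
    (hmain.sub hconst), fun ζ hζ => Function.update_of_ne hζ _ _⟩

/-- A single point of the arc at which `E` is not too large is removable. -/
theorem IsStraightening.extendsAt_of_tendsto {γ : ℝ → ℂ} {t₀ δ : ℝ}
    {φ : OpenPartialHomeomorph ℂ ℂ} (h : IsStraightening γ t₀ δ φ)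
    (hK : Dense (γ '' Icc 0 1)ᶜ) {E : ℂ → ℂ}
    (hE : ∀ p ∈ φ.target, p ≠ γ t₀ → ExtendsAt E (γ '' Icc 0 1) p)
    (ht₀ : t₀ ∈ Icc (0 : ℝ) 1)
    (hlim : Tendsto (fun ζ : ℂ => (ζ.im : ℂ) * E (φ ζ)) (𝓝[{ζ | ζ.im ≠ 0}] (t₀ : ℂ)) (𝓝 0)) :
    ExtendsAt E (γ '' Icc 0 1) (γ t₀) := by
  obtain ⟨F, hF, hFE⟩ := exists_extension (U := φ.target \ {γ t₀}) hK
    fun p hp => hE p hp.1 hp.2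
  have hne : ∀ ζ ∈ φ.source, ζ ≠ t₀ → φ ζ ∈ φ.target \ {γ t₀} := by
    intro ζ hζ hne
    refine ⟨φ.map_source hζ, fun h0 => hne ?_⟩
    exact φ.injOn hζ h.center_mem (h0.trans h.apply_center.symm)
  obtain ⟨g, hg, hgf⟩ := exists_extension_of_tendsto_im_mul (f := F ∘ φ) h.pos
    (fun ζ hζ => by
      rw [← h.source_eq] at hζ
      exact ((hF _ (hne ζ hζ.1 hζ.2)).comp ζ (h.differentiableAt hζ.1)).differentiableWithinAt)
    (hlim.congr' <| by
      filter_upwards [self_mem_nhdsWithin,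
        nhdsWithin_le_nhds (φ.open_source.mem_nhds h.center_mem)] with ζ him hζ
      have hne' : ζ ≠ t₀ := fun h0 => him (by rw [h0]; exact ofReal_im t₀)
      rw [Function.comp_apply, hFE ⟨hne ζ hζ hne', h.map_notMem hζ him⟩])
  rw [← h.source_eq] at hg
  refine ⟨φ.target, h.target_mem_nhds, g ∘ φ.symm,
    hg.comp h.diff_symm fun z hz => φ.map_target hz, fun z hz => ?_⟩
  have hzne : z ≠ γ t₀ := fun h0 => hz.2 (h0 ▸ mem_image_of_mem γ ht₀)
  have hne' : φ.symm z ≠ t₀ := by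
    intro h0
    apply hzne
    rw [← φ.right_inv hz.1, h0, h.apply_center]
  rw [Function.comp_apply, hgf _ hne', Function.comp_apply, φ.right_inv hz.1]
  exact hFE ⟨⟨hz.1, hzne⟩, hz.2⟩

theorem eq_of_eqOn_upper {f g : ℂ → ℂ} {ζ : ℂ} (him : ζ.im = 0) (hf : ContinuousAt f ζ)
    (hg : ContinuousAt g ζ) (h : ∀ᶠ ξ in 𝓝 ζ, 0 < ξ.im → f ξ = g ξ) : f ζ = g ζ := by
  have hne : (𝓝[{ξ : ℂ | 0 < ξ.im}] ζ).NeBot := by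
    rw [← mem_closure_iff_nhdsWithin_neBot, Complex.closure_setOfPred_lt_im]
    exact him.ge
  have h' : ∀ᶠ ξ in 𝓝[{ξ : ℂ | 0 < ξ.im}] ζ, f ξ = g ξ := eventually_nhdsWithin_iff.2 h
  exact tendsto_nhds_unique (hf.tendsto.mono_left nhdsWithin_le_nhds)
    ((hg.tendsto.mono_left nhdsWithin_le_nhds).congr' (h'.mono fun _ hx => hx.symm))

theorem eq_of_eqOn_lower {f g : ℂ → ℂ} {ζ : ℂ} (him : ζ.im = 0) (hf : ContinuousAt f ζ)
    (hg : ContinuousAt g ζ) (h : ∀ᶠ ξ in 𝓝 ζ, ξ.im < 0 → f ξ = g ξ) : f ζ = g ζ := by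
  have hne : (𝓝[{ξ : ℂ | ξ.im < 0}] ζ).NeBot := by
    rw [← mem_closure_iff_nhdsWithin_neBot, Complex.closure_setOfPred_im_lt]
    exact him.le
  have h' : ∀ᶠ ξ in 𝓝[{ξ : ℂ | ξ.im < 0}] ζ, f ξ = g ξ := eventually_nhdsWithin_iff.2 h
  exact tendsto_nhds_unique (hf.tendsto.mono_left nhdsWithin_le_nhds)
    ((hg.tendsto.mono_left nhdsWithin_le_nhds).congr' (h'.mono fun _ hx => hx.symm))

/-- In the chart `φ` about an interior point of the arc, `E` is given by the holomorphic function
`A` on the left-hand side of the arc and by the holomorphic function `B` on its right-hand side. -/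
structure HasSides (E : ℂ → ℂ) (γ : ℝ → ℂ) (t₀ δ : ℝ) (φ : OpenPartialHomeomorph ℂ ℂ)
    (A B : ℂ → ℂ) : Prop where
  straight : IsStraightening γ t₀ δ φ
  le_left : δ ≤ t₀
  le_right : δ ≤ 1 - t₀
  diff_left : DifferentiableOn ℂ A φ.source
  diff_right : DifferentiableOn ℂ B φ.source
  eq_left : ∀ ζ ∈ φ.source, 0 < ζ.im → E (φ ζ) = A ζ
  eq_right : ∀ ζ ∈ φ.source, ζ.im < 0 → E (φ ζ) = B ζ

namespace HasSides

variable {E : ℂ → ℂ} {γ : ℝ → ℂ} {t₀ δ : ℝ} {φ : OpenPartialHomeomorph ℂ ℂ} {A B : ℂ → ℂ}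

theorem mem_Ioo (h : HasSides E γ t₀ δ φ A B) {t : ℝ} (ht : |t - t₀| < δ) :
    t ∈ Ioo (0 : ℝ) 1 := by
  have := abs_lt.1 ht
  constructor <;> linarith [h.le_left, h.le_right]

theorem im_ne_zero (h : HasSides E γ t₀ δ φ A B) {z : ℂ} (hz : z ∈ φ.target)
    (hzΓ : z ∉ γ '' Icc 0 1) : (φ.symm z).im ≠ 0 := by
  intro him
  have hs := φ.map_target hz
  have hre : φ.symm z = ((φ.symm z).re : ℂ) := by
    apply Complex.ext <;> simp [him]
  have hs' := hs
  rw [h.straight.source_eq, hre, ofReal_mem_ball] at hs'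
  have h1 := (h.straight.mem_image_iff _ hs).2 ⟨_, Ioo_subset_Icc_self (h.mem_Ioo hs'), hre⟩
  rw [φ.right_inv hz] at h1
  exact hzΓ h1

theorem extendsAt (h : HasSides E γ t₀ δ φ A B) (hAB : EqOn A B φ.source) :
    ExtendsAt E (γ '' Icc 0 1) (γ t₀) := by
  refine ⟨φ.target, h.straight.target_mem_nhds, A ∘ φ.symm,
    h.diff_left.comp h.straight.diff_symm fun z hz => φ.map_target hz, fun z hz => ?_⟩
  have hs := φ.map_target hz.1
  rcases lt_or_gt_of_ne (h.im_ne_zero hz.1 hz.2) with him | him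
  · rw [Function.comp_apply, hAB hs, ← h.eq_right _ hs him, φ.right_inv hz.1]
  · rw [Function.comp_apply, ← h.eq_left _ hs him, φ.right_inv hz.1]

theorem eq_of_extendsAt (h : HasSides E γ t₀ δ φ A B) {t : ℝ} (ht : |t - t₀| < δ)
    (hext : ExtendsAt E (γ '' Icc 0 1) (γ t)) : A t = B t := by
  obtain ⟨V, hV, F, hF, hFE⟩ := hext
  have hs : (t : ℂ) ∈ φ.source := by rw [h.straight.source_eq]; exact ofReal_mem_ball.2 ht
  have hφt : φ t = γ t := h.straight.apply_ofReal t ht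
  have hc : ContinuousAt (F ∘ φ) (t : ℂ) := by
    refine ContinuousAt.comp ?_ (h.straight.differentiableAt hs).continuousAt
    rw [hφt]; exact (hF.differentiableAt hV).continuousAt
  have hsn := φ.open_source.mem_nhds hs
  have hV' : ∀ᶠ ζ in 𝓝 (t : ℂ), φ ζ ∈ V :=
    (h.straight.differentiableAt hs).continuousAt.eventually (by rw [hφt]; exact hV)
  have h1 : (F ∘ φ) t = A t := by
    refine eq_of_eqOn_upper (ofReal_im t) hc (h.diff_left.differentiableAt hsn).continuousAt ?_
    filter_upwards [hsn, hV'] with ζ hζ hζV him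
    rw [← h.eq_left ζ hζ him, Function.comp_apply,
      hFE ⟨hζV, h.straight.map_notMem hζ him.ne'⟩]
  have h2 : (F ∘ φ) t = B t := by
    refine eq_of_eqOn_lower (ofReal_im t) hc (h.diff_right.differentiableAt hsn).continuousAt ?_
    filter_upwards [hsn, hV'] with ζ hζ hζV him
    rw [← h.eq_right ζ hζ him, Function.comp_apply,
      hFE ⟨hζV, h.straight.map_notMem hζ him.ne⟩]
  exact h1.symm.trans h2

end HasSides

/-- If, locally along the arc, the two sides of `E` either agree or differ at each point, then `E`
extends either across the whole open arc or across no point of it. -/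
theorem extendsAt_all_or_none {E : ℂ → ℂ} {γ : ℝ → ℂ}
    (h : ∀ t₀ ∈ Ioo (0 : ℝ) 1, ∃ δ φ A B, HasSides E γ t₀ δ φ A B ∧
      (EqOn A B φ.source ∨ ∀ t : ℝ, |t - t₀| < δ → A t ≠ B t)) :
    (∀ t ∈ Ioo (0 : ℝ) 1, ExtendsAt E (γ '' Icc 0 1) (γ t)) ∨
      ∀ t ∈ Ioo (0 : ℝ) 1, ¬ ExtendsAt E (γ '' Icc 0 1) (γ t) := by
  have habs : ∀ {t₀ δ : ℝ}, 0 < δ → ∀ᶠ t in 𝓝 t₀, |t - t₀| < δ := fun hδ => by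
    filter_upwards [ball_mem_nhds _ hδ] with t ht
    rwa [mem_ball, Real.dist_eq] at ht
  have hloc : ∀ t₀ ∈ Ioo (0 : ℝ) 1,
      (∀ᶠ t in 𝓝 t₀, ExtendsAt E (γ '' Icc 0 1) (γ t)) ∨
      ∀ᶠ t in 𝓝 t₀, ¬ ExtendsAt E (γ '' Icc 0 1) (γ t) := by
    intro t₀ ht₀
    obtain ⟨δ, φ, A, B, hs, hAB | hAB⟩ := h t₀ ht₀
    · left
      obtain ⟨V, hV, F, hF, hFE⟩ := hs.extendsAt hAB
      have hγc : ContinuousAt γ t₀ :=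
        (hs.straight.hasDerivAt_ofReal (by simpa using hs.straight.pos)).continuousAt
      filter_upwards [hγc.eventually (eventually_mem_nhds_iff.2 hV)] with t ht
      exact ⟨V, ht, F, hF, hFE⟩
    · right
      filter_upwards [habs hs.straight.pos] with t ht hext
      exact hAB t ht (hs.eq_of_extendsAt ht hext)
  by_contra hcon
  push Not at hcon
  obtain ⟨⟨t₁, ht₁, hn⟩, t₂, ht₂, hp⟩ := hcon
  have hpre : IsPreconnected (Ioo (0 : ℝ) 1) := isPreconnected_Ioo
  have hopen : ∀ P : ℝ → Prop, IsOpen {t | ∀ᶠ s in 𝓝 t, P s} := fun P => by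
    rw [isOpen_iff_mem_nhds]
    exact fun t ht => eventually_eventually_nhds.2 ht
  obtain ⟨t, -, h1, h2⟩ := hpre _ _ (hopen fun t => ExtendsAt E (γ '' Icc 0 1) (γ t))
    (hopen fun t => ¬ ExtendsAt E (γ '' Icc 0 1) (γ t)) hloc
    ⟨t₂, ht₂, (hloc t₂ ht₂).resolve_right fun h0 => h0.self_of_nhds hp⟩
    ⟨t₁, ht₁, (hloc t₁ ht₁).resolve_left fun h0 => hn h0.self_of_nhds⟩
  exact h2.self_of_nhds h1.self_of_nhds

/-- Removability of the end points: a function which extends across the open arc, and which is not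
too large at the two end points, extends everywhere. -/
theorem IsAnalyticArc.extendsAt_of_Ioo {γ : ℝ → ℂ} {a b : ℂ} (hγ : IsAnalyticArc γ a b)
    {E : ℂ → ℂ} (hE : DifferentiableOn ℂ E (γ '' Icc 0 1)ᶜ)
    (hI : ∀ t ∈ Ioo (0 : ℝ) 1, ExtendsAt E (γ '' Icc 0 1) (γ t))
    (hend : ∀ t₀ : ℝ, t₀ = 0 ∨ t₀ = 1 → ∃ δ φ, IsStraightening γ t₀ δ φ ∧
      Tendsto (fun ζ : ℂ => (ζ.im : ℂ) * E (φ ζ)) (𝓝[{ζ | ζ.im ≠ 0}] (t₀ : ℂ)) (𝓝 0)) (p : ℂ) :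
    ExtendsAt E (γ '' Icc 0 1) p := by
  by_cases hp : p ∈ γ '' Icc 0 1
  swap
  · exact extendsAt_of_notMem hγ.isClosed_image hE hp
  obtain ⟨t₀, ht₀, rfl⟩ := hp
  by_cases hI₀ : t₀ ∈ Ioo (0 : ℝ) 1
  · exact hI t₀ hI₀
  have hedge : ∀ t ∈ Icc (0 : ℝ) 1, t ∉ Ioo (0 : ℝ) 1 → t = 0 ∨ t = 1 := by
    intro t ht hn
    by_contra! hcon
    exact hn ⟨lt_of_le_of_ne ht.1 hcon.1.symm, lt_of_le_of_ne ht.2 hcon.2⟩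
  obtain ⟨δ, φ, hs, hlim⟩ := hend t₀ (hedge t₀ ht₀ hI₀)
  -- shrink the chart so that the other end point is outside
  set δ' := min δ 1
  have hδ' : 0 < δ' := lt_min hs.pos one_pos
  have hs' := hs.mono hδ' (min_le_left _ _)
  refine hs'.extendsAt_of_tendsto hγ.dense_compl (fun p hpt hne => ?_) ht₀ hlim
  by_cases hp : p ∈ γ '' Icc 0 1
  swap
  · exact extendsAt_of_notMem hγ.isClosed_image hE hp
  obtain ⟨t, ht, rfl⟩ := hp
  refine hI t ?_
  by_contra hn
  have hsrc := (φ.restrOpen (ball (t₀ : ℂ) δ') isOpen_ball).map_target hpt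
  obtain ⟨s, hsI, hseq⟩ := (hs'.mem_image_iff _ hsrc).1 (by
    rw [OpenPartialHomeomorph.right_inv _ hpt]; exact mem_image_of_mem γ ht)
  rw [hs'.source_eq, hseq, ofReal_mem_ball] at hsrc
  have hst : s = t := by
    refine hγ.injOn hsI ht ?_
    rw [← hs'.apply_ofReal s hsrc, ← hseq, OpenPartialHomeomorph.right_inv _ hpt]
  rw [hst] at hsrc
  have h1 : |t - t₀| < 1 := hsrc.trans_le (min_le_right _ _)
  have hne' : t ≠ t₀ := fun h0 => hne (by rw [h0])
  rcases hedge t ht hn with rfl | rfl <;> rcases hedge t₀ ht₀ hI₀ with rfl | rfl <;>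
    simp at h1 hne'

theorem tendsto_im_mul_of_bounded {f : ℂ → ℂ} {t₀ : ℝ} {M : ℝ}
    (h : ∀ᶠ ζ in 𝓝[{ζ : ℂ | ζ.im ≠ 0}] (t₀ : ℂ), ‖f ζ‖ ≤ M) :
    Tendsto (fun ζ : ℂ => (ζ.im : ℂ) * f ζ) (𝓝[{ζ | ζ.im ≠ 0}] (t₀ : ℂ)) (𝓝 0) := by
  have h1 : Tendsto (fun ζ : ℂ => (ζ.im : ℂ)) (𝓝[{ζ | ζ.im ≠ 0}] (t₀ : ℂ)) (𝓝 0) := by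
    have : Tendsto (fun ζ : ℂ => (ζ.im : ℂ)) (𝓝 (t₀ : ℂ)) (𝓝 (((t₀ : ℂ).im : ℝ) : ℂ)) :=
      (continuous_ofReal.comp continuous_im).tendsto _
    simpa using this.mono_left nhdsWithin_le_nhds
  exact h1.zero_mul_isBoundedUnder_le ⟨M, by simpa using h⟩

theorem IsStraightening.exists_const_of_deriv_eq_zero {γ : ℝ → ℂ} {t₀ δ : ℝ}
    {φ : OpenPartialHomeomorph ℂ ℂ} (h : IsStraightening γ t₀ δ φ)
    {E : ℂ → ℂ} (hE : ∀ z ∈ (γ '' Icc 0 1)ᶜ, HasDerivAt E 0 z) :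
    ∃ c₁ c₂ : ℂ, (∀ ζ ∈ φ.source, 0 < ζ.im → E (φ ζ) = c₁) ∧
      ∀ ζ ∈ φ.source, ζ.im < 0 → E (φ ζ) = c₂ := by
  have hd : ∀ ζ ∈ φ.source, ζ.im ≠ 0 → HasDerivAt (E ∘ φ) 0 ζ := fun ζ hζ him => by
    simpa using (hE _ (h.map_notMem hζ him)).comp ζ (h.differentiableAt hζ).hasDerivAt
  have hconst : ∀ S : Set ℂ, IsOpen S → Convex ℝ S → (∀ ζ ∈ S, ζ.im ≠ 0) →
      ∃ c, ∀ ζ ∈ φ.source, ζ ∈ S → E (φ ζ) = c := by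
    intro S hSo hSc hS
    have ho : IsOpen (φ.source ∩ S) := φ.open_source.inter hSo
    have hc : IsPreconnected (φ.source ∩ S) := by
      rw [h.source_eq]
      exact ((convex_ball _ _).inter hSc).isPreconnected
    by_cases hne : (φ.source ∩ S).Nonempty
    · obtain ⟨ζ₀, hζ₀⟩ := hne
      refine ⟨E (φ ζ₀), fun ζ hζ hζS => ?_⟩
      exact ho.is_const_of_deriv_eq_zero hc (f := E ∘ φ)
        (fun ξ hξ => (hd ξ hξ.1 (hS ξ hξ.2)).differentiableAt.differentiableWithinAt)
        (fun ξ hξ => (hd ξ hξ.1 (hS ξ hξ.2)).deriv) ⟨hζ, hζS⟩ hζ₀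
    · exact ⟨0, fun ζ hζ hζS => (hne ⟨ζ, hζ, hζS⟩).elim⟩
  obtain ⟨c₁, h₁⟩ := hconst {ζ | 0 < ζ.im} (isOpen_lt continuous_const continuous_im)
    (convex_halfSpace_im_gt 0) fun ζ hζ => (ne_of_gt hζ)
  obtain ⟨c₂, h₂⟩ := hconst {ζ | ζ.im < 0} (isOpen_lt continuous_im continuous_const)
    (convex_halfSpace_im_lt 0) fun ζ hζ => (ne_of_lt hζ)
  exact ⟨c₁, c₂, h₁, h₂⟩

/-- An arc does not separate the plane: a function whose derivative vanishes off the arc is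
constant. The jump of the function is constant along the arc, and it vanishes near an end point,
around which one can pass from one side of the arc to the other. -/
theorem IsAnalyticArc.eq_of_deriv_eq_zero {γ : ℝ → ℂ} {a b : ℂ} (hγ : IsAnalyticArc γ a b)
    {E : ℂ → ℂ} (hE : ∀ z ∈ (γ '' Icc 0 1)ᶜ, HasDerivAt E 0 z) {c : ℂ}
    (hc : Tendsto E (Bornology.cobounded ℂ) (𝓝 c)) {z : ℂ} (hz : z ∉ γ '' Icc 0 1) :
    E z = c := by
  have hEd : DifferentiableOn ℂ E (γ '' Icc 0 1)ᶜ := fun z hz =>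
    (hE z hz).differentiableAt.differentiableWithinAt
  have hsides : ∀ t₀ ∈ Ioo (0 : ℝ) 1, ∃ δ φ A B, HasSides E γ t₀ δ φ A B ∧
      (EqOn A B φ.source ∨ ∀ t : ℝ, |t - t₀| < δ → A t ≠ B t) := by
    intro t₀ ht₀
    obtain ⟨δ, φ, hs, hδ, -⟩ := hγ.exists_straightening (Ioo_subset_Icc_self ht₀) univ_mem
      (lt_min ht₀.1 (sub_pos.2 ht₀.2))
    obtain ⟨c₁, c₂, h₁, h₂⟩ := hs.exists_const_of_deriv_eq_zero hE
    refine ⟨δ, φ, fun _ => c₁, fun _ => c₂, ⟨hs, hδ.trans (min_le_left _ _),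
      hδ.trans (min_le_right _ _), differentiableOn_const _, differentiableOn_const _, h₁, h₂⟩, ?_⟩
    by_cases h : c₁ = c₂
    · exact Or.inl fun _ _ => h
    · exact Or.inr fun _ _ => h
  have hI : ∀ t ∈ Ioo (0 : ℝ) 1, ExtendsAt E (γ '' Icc 0 1) (γ t) := by
    rcases extendsAt_all_or_none hsides with h | h
    · exact h
    exfalso
    obtain ⟨δ, φ, hs, hδ, -⟩ := hγ.exists_straightening (left_mem_Icc.2 zero_le_one) univ_mem
      (one_pos : (0 : ℝ) < 1)
    obtain ⟨c₁, c₂, h₁, h₂⟩ := hs.exists_const_of_deriv_eq_zero hE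
    have hpos := hs.pos
    -- the values on the two sides agree beyond the end point
    have hm : ((-(δ / 2) : ℝ) : ℂ) ∈ φ.source := by
      rw [hs.source_eq, ofReal_mem_ball, sub_zero, abs_neg, abs_of_pos (by positivity)]
      linarith
    have hout : φ ((-(δ / 2) : ℝ) : ℂ) ∉ γ '' Icc 0 1 := by
      rw [hs.mem_image_iff _ hm]
      rintro ⟨t, ht, hteq⟩
      have := ofReal_injective hteq
      linarith [ht.1]
    have hcont : ContinuousAt (E ∘ φ) ((-(δ / 2) : ℝ) : ℂ) :=
      (hE _ hout).continuousAt.comp (hs.differentiableAt hm).continuousAt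
    have hsn := φ.open_source.mem_nhds hm
    have hcc : c₁ = c₂ := by
      have e1 : (E ∘ φ) ((-(δ / 2) : ℝ) : ℂ) = c₁ :=
        eq_of_eqOn_upper (g := fun _ => c₁) (ofReal_im _) hcont continuousAt_const
          (by filter_upwards [hsn] with ζ hζ him using h₁ ζ hζ him)
      have e2 : (E ∘ φ) ((-(δ / 2) : ℝ) : ℂ) = c₂ :=
        eq_of_eqOn_lower (g := fun _ => c₂) (ofReal_im _) hcont continuousAt_const
          (by filter_upwards [hsn] with ζ hζ him using h₂ ζ hζ him)
      exact e1.symm.trans e2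
    have hmid : ((δ / 2 : ℝ) : ℂ) ∈ φ.source := by
      rw [hs.source_eq, ofReal_mem_ball, sub_zero, abs_of_pos (by positivity)]
      linarith
    refine h (δ / 2) ⟨by linarith, by linarith⟩ ?_
    have hpt : φ ((δ / 2 : ℝ) : ℂ) = γ (δ / 2) := by
      refine hs.apply_ofReal _ ?_
      rw [sub_zero, abs_of_pos (by positivity)]
      linarith
    refine ⟨φ.target, φ.open_target.mem_nhds (hpt ▸ φ.map_source hmid), fun _ => c₁,
      differentiableOn_const _, fun z hz => ?_⟩
    have hzs := φ.map_target hz.1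
    rw [← φ.right_inv hz.1]
    rcases lt_trichotomy (φ.symm z).im 0 with him | him | him
    · rw [h₂ _ hzs him, hcc]
    · have hcont' : ContinuousAt (E ∘ φ) (φ.symm z) := by
        refine ContinuousAt.comp ?_ (hs.differentiableAt hzs).continuousAt
        rw [φ.right_inv hz.1]
        exact (hE _ hz.2).continuousAt
      exact (eq_of_eqOn_upper (g := fun _ => c₁) him hcont' continuousAt_const
        (by filter_upwards [φ.open_source.mem_nhds hzs] with ζ hζ him using h₁ ζ hζ him)).symm
    · rw [h₁ _ hzs him]
  refine eq_of_extendsAt_of_tendsto hγ.dense_compl hγ.isCompact_image.isBounded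
    (hγ.extendsAt_of_Ioo hEd hI fun t₀ ht₀ => ?_) hc hz
  have ht₀' : t₀ ∈ Icc (0 : ℝ) 1 := by rcases ht₀ with rfl | rfl <;> simp
  obtain ⟨δ, φ, hs, -, -⟩ := hγ.exists_straightening ht₀' univ_mem (one_pos : (0 : ℝ) < 1)
  obtain ⟨c₁, c₂, h₁, h₂⟩ := hs.exists_const_of_deriv_eq_zero hE
  refine ⟨δ, φ, hs, tendsto_im_mul_of_bounded (M := max ‖c₁‖ ‖c₂‖) ?_⟩
  filter_upwards [self_mem_nhdsWithin,
    nhdsWithin_le_nhds (φ.open_source.mem_nhds hs.center_mem)] with ζ him hζ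
  rcases lt_or_gt_of_ne him with him | him
  · rw [h₂ ζ hζ him]; exact le_max_right _ _
  · rw [h₁ ζ hζ him]; exact le_max_left _ _

/-! ### Cauchy type integrals -/

/-- The Cauchy type integral `∫ h(t) / (p(t) - z) dt` along the curve `p` over `[a, b]`. -/
def cauchyTransform (p h : ℝ → ℂ) (a b : ℝ) (z : ℂ) : ℂ :=
  ∫ t in a..b, h t / (p t - z)

theorem intervalIntegrable_div_sub {p h : ℝ → ℂ} {a b : ℝ} (hab : a ≤ b)
    (hp : ContinuousOn p (Icc a b)) (hh : IntervalIntegrable h volume a b) {z : ℂ}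
    (hz : z ∉ p '' Icc a b) : IntervalIntegrable (fun t => h t / (p t - z)) volume a b := by
  simp_rw [div_eq_mul_inv]
  refine hh.mul_continuousOn ?_
  rw [uIcc_of_le hab]
  exact (hp.sub continuousOn_const).inv₀ fun t ht h0 => hz ⟨t, ht, sub_eq_zero.1 h0⟩

theorem cauchyTransform_differentiableAt {p h : ℝ → ℂ} {a b : ℝ} (hab : a ≤ b)
    (hp : ContinuousOn p (Icc a b)) (hh : IntervalIntegrable h volume a b) {z : ℂ}
    (hz : z ∉ p '' Icc a b) : DifferentiableAt ℂ (cauchyTransform p h a b) z := by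
  have hcl : IsClosed (p '' Icc a b) := (isCompact_Icc.image_of_continuousOn hp).isClosed
  obtain ⟨ε, hε, hball⟩ := Metric.isOpen_iff.1 hcl.isOpen_compl z hz
  have hdist : ∀ x ∈ ball z (ε / 2), ∀ t ∈ Icc a b, ε / 2 ≤ ‖p t - x‖ := by
    intro x hx t ht
    have h1 : ε ≤ dist (p t) z := by
      by_contra! hcon
      exact hball hcon ⟨t, ht, rfl⟩
    have h2 := dist_triangle (p t) x z
    rw [mem_ball] at hx
    rw [← dist_eq_norm]
    linarith
  have hne : ∀ x ∈ ball z (ε / 2), ∀ t ∈ Icc a b, p t - x ≠ 0 := fun x hx t ht h0 => by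
    have := hdist x hx t ht
    rw [h0, norm_zero] at this
    linarith
  have hnot : ∀ x ∈ ball z (ε / 2), x ∉ p '' Icc a b := by
    rintro x hx ⟨t, ht, rfl⟩
    exact hne _ hx t ht (sub_self _)
  have hsub : uIoc a b ⊆ Icc a b := by
    rw [uIoc_of_le hab]; exact Ioc_subset_Icc_self
  have hmeas : IntervalIntegrable (fun t => h t / (p t - z) ^ 2) volume a b := by
    simp_rw [div_eq_mul_inv]
    refine hh.mul_continuousOn ?_
    rw [uIcc_of_le hab]
    exact ((hp.sub continuousOn_const).pow 2).inv₀ fun t ht =>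
      pow_ne_zero 2 (hne z (mem_ball_self (by positivity)) t ht)
  refine (intervalIntegral.hasDerivAt_integral_of_dominated_loc_of_deriv_le
    (F' := fun x t => h t / (p t - x) ^ 2) (bound := fun t => ‖h t‖ * ((ε / 2) ^ 2)⁻¹)
    (ball_mem_nhds z (by positivity : 0 < ε / 2)) ?_ ?_ ?_ ?_ ?_ ?_).2.differentiableAt
  · filter_upwards [ball_mem_nhds z (by positivity : 0 < ε / 2)] with x hx
    exact (intervalIntegrable_div_sub hab hp hh (hnot x hx)).aestronglyMeasurable_restrict_uIoc
  · exact intervalIntegrable_div_sub hab hp hh hz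
  · exact hmeas.aestronglyMeasurable_restrict_uIoc
  · refine Eventually.of_forall fun t ht x hx => ?_
    rw [norm_div, norm_pow, div_eq_mul_inv]
    gcongr
    exact hdist x hx t (hsub ht)
  · exact hh.norm.mul_const _
  · refine Eventually.of_forall fun t ht x hx => ?_
    have h1 := ((hasDerivAt_id x).const_sub (p t)).inv (hne x hx t (hsub ht))
    have h2 := h1.const_mul (h t)
    have e1 : (fun y => h t / (p t - y)) = fun y => h t * (fun x => p t - id x)⁻¹ y := by
      ext y
      simp [div_eq_mul_inv]
    rw [e1]
    refine h2.congr_deriv ?_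
    simp [div_eq_mul_inv]

theorem tendsto_mul_cauchyTransform {p h : ℝ → ℂ} {a b : ℝ} (hab : a ≤ b)
    (hp : ContinuousOn p (Icc a b)) (hh : IntervalIntegrable h volume a b) :
    Tendsto (fun z => z * cauchyTransform p h a b z) (Bornology.cobounded ℂ)
      (𝓝 (-∫ t in a..b, h t)) := by
  obtain ⟨M, hM⟩ := (isCompact_Icc.image_of_continuousOn hp).isBounded.exists_norm_le
  have hsub : uIoc a b ⊆ Icc a b := by
    rw [uIoc_of_le hab]; exact Ioc_subset_Icc_self
  have hlarge : ∀ᶠ z : ℂ in Bornology.cobounded ℂ, 2 * |M| + 1 ≤ ‖z‖ :=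
    tendsto_norm_cobounded_atTop.eventually_ge_atTop _
  have hbd : ∀ z : ℂ, 2 * |M| + 1 ≤ ‖z‖ → ∀ t ∈ Icc a b, ‖z‖ / 2 ≤ ‖p t - z‖ := by
    intro z hz t ht
    have h1 := hM _ (mem_image_of_mem p ht)
    have h2 := norm_sub_norm_le z (p t)
    rw [norm_sub_rev] at h2
    linarith [le_abs_self M]
  have hrw : ∀ z, z * cauchyTransform p h a b z = ∫ t in a..b, h t * (z / (p t - z)) := by
    intro z
    rw [cauchyTransform, ← intervalIntegral.integral_const_mul]
    congr 1
    ext t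
    ring
  simp_rw [hrw]
  rw [← intervalIntegral.integral_neg]
  have : (Bornology.cobounded ℂ).IsCountablyGenerated := by
    rw [← comap_norm_atTop]; infer_instance
  refine intervalIntegral.tendsto_integral_filter_of_dominated_convergence
    (fun t => ‖h t‖ * 2) ?_ ?_ (hh.norm.mul_const _) ?_
  · filter_upwards [hlarge] with z hz
    refine (hh.mul_continuousOn ?_).aestronglyMeasurable_restrict_uIoc
    rw [uIcc_of_le hab]
    refine continuousOn_const.div (hp.sub continuousOn_const) fun t ht h0 => ?_
    have := hbd z hz t ht
    rw [h0, norm_zero] at this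
    linarith [abs_nonneg M]
  · filter_upwards [hlarge] with z hz
    refine Eventually.of_forall fun t ht => ?_
    rw [norm_mul, norm_div]
    gcongr
    have hzpos : 0 < ‖z‖ := by linarith [abs_nonneg M]
    have := hbd z hz t (hsub ht)
    rw [div_le_iff₀ (by linarith)]
    linarith
  · refine Eventually.of_forall fun t ht => ?_
    have h1 : Tendsto (fun z : ℂ => z⁻¹) (Bornology.cobounded ℂ) (𝓝 0) :=
      tendsto_inv₀_cobounded
    have h2 : Tendsto (fun z : ℂ => h t * (p t * z⁻¹ - 1)⁻¹) (Bornology.cobounded ℂ)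
        (𝓝 (h t * (p t * 0 - 1)⁻¹)) :=
      (((h1.const_mul (p t)).sub_const 1).inv₀ (by simp)).const_mul _
    have h3 : h t * (p t * 0 - 1)⁻¹ = -h t := by
      norm_num
    rw [h3] at h2
    refine h2.congr' ?_
    filter_upwards [hlarge] with z hz
    have hz0 : z ≠ 0 := by
      rintro rfl
      rw [norm_zero] at hz
      linarith [abs_nonneg M]
    congr 1
    rw [div_eq_mul_inv, ← div_eq_mul_inv (p t) z, div_sub_one hz0, inv_div, div_eq_mul_inv]

theorem tendsto_cauchyTransform {p h : ℝ → ℂ} {a b : ℝ} (hab : a ≤ b)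
    (hp : ContinuousOn p (Icc a b)) (hh : IntervalIntegrable h volume a b) :
    Tendsto (cauchyTransform p h a b) (Bornology.cobounded ℂ) (𝓝 0) := by
  have h1 : Tendsto (fun z : ℂ => z⁻¹) (Bornology.cobounded ℂ) (𝓝 0) := tendsto_inv₀_cobounded
  have h2 := h1.mul (tendsto_mul_cauchyTransform hab hp hh)
  rw [zero_mul] at h2
  refine h2.congr' ?_
  filter_upwards [Bornology.isBounded_def.1 (Bornology.isBounded_singleton (x := (0 : ℂ)))]
    with z hz
  have hz0 : z ≠ 0 := hz
  field_simp

/-- Integrals of a holomorphic function on a convex domain along two paths with the same end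
points agree. -/
theorem integral_eq_integral_of_convex {F : ℂ → ℂ} {S : Set ℂ} (hS : IsOpen S)
    (hSc : Convex ℝ S) (hF : DifferentiableOn ℂ F S) {p q p' q' : ℝ → ℂ} {a b c d : ℝ}
    (hp : ∀ t ∈ uIcc a b, HasDerivAt p (p' t) t) (hq : ∀ t ∈ uIcc c d, HasDerivAt q (q' t) t)
    (hp' : ContinuousOn p' (uIcc a b)) (hq' : ContinuousOn q' (uIcc c d))
    (hpS : ∀ t ∈ uIcc a b, p t ∈ S) (hqS : ∀ t ∈ uIcc c d, q t ∈ S)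
    (h0 : p a = q c) (h1 : p b = q d) :
    ∫ t in a..b, F (p t) * p' t = ∫ t in c..d, F (q t) * q' t := by
  obtain ⟨G, hG⟩ := hSc.exists_forall_hasDerivWithinAt hF
  have hG' : ∀ z ∈ S, HasDerivAt G (F z) z := fun z hz => (hG z hz).hasDerivAt (hS.mem_nhds hz)
  have main : ∀ {p p' : ℝ → ℂ} {a b : ℝ}, (∀ t ∈ uIcc a b, HasDerivAt p (p' t) t) →
      ContinuousOn p' (uIcc a b) → (∀ t ∈ uIcc a b, p t ∈ S) →
      ∫ t in a..b, F (p t) * p' t = G (p b) - G (p a) := by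
    intro p p' a b hp hp' hpS
    refine intervalIntegral.integral_eq_sub_of_hasDerivAt (f := G ∘ p)
      (fun t ht => (hG' _ (hpS t ht)).comp t (hp t ht)) ?_
    refine ContinuousOn.intervalIntegrable (ContinuousOn.mul ?_ hp')
    exact hF.continuousOn.comp (fun t ht => (hp t ht).continuousAt.continuousWithinAt) hpS
  rw [main hp hp' hpS, main hq hq' hqS, h0, h1]

theorem continuous_deriv_circleMap {c : ℂ} {R : ℝ} : Continuous (deriv (circleMap c R)) := by
  have : deriv (circleMap c R) = fun θ => circleMap 0 R θ * I := funext (deriv_circleMap c R)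
  rw [this]
  fun_prop

theorem circleMap_im_nonpos {c R θ : ℝ} (hR : 0 ≤ R) (hθ : θ ∈ Icc Real.pi (2 * Real.pi)) :
    (circleMap (c : ℂ) R θ).im ≤ 0 := by
  have h1 : (circleMap (c : ℂ) R θ).im = R * Real.sin θ := by
    simp [circleMap, exp_ofReal_mul_I_im]
  have h2 : Real.sin θ ≤ 0 := by
    have := Real.sin_nonneg_of_nonneg_of_le_pi (x := θ - Real.pi) (by linarith [hθ.1])
      (by linarith [hθ.2])
    rw [Real.sin_sub_pi] at this
    linarith
  rw [h1]
  exact mul_nonpos_of_nonneg_of_nonpos hR h2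

theorem circleMap_im_nonneg {c R θ : ℝ} (hR : 0 ≤ R) (hθ : θ ∈ Icc 0 Real.pi) :
    0 ≤ (circleMap (c : ℂ) R θ).im := by
  have h1 : (circleMap (c : ℂ) R θ).im = R * Real.sin θ := by
    simp [circleMap, exp_ofReal_mul_I_im]
  rw [h1]
  exact mul_nonneg hR (Real.sin_nonneg_of_nonneg_of_le_pi hθ.1 hθ.2)

namespace IsStraightening

variable {γ : ℝ → ℂ} {t₀ δ : ℝ} {φ : OpenPartialHomeomorph ℂ ℂ}

theorem differentiableOn_deriv (h : IsStraightening γ t₀ δ φ) :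
    DifferentiableOn ℂ (deriv φ) φ.source := h.diff.deriv φ.open_source

/-- The integral over the lower half of the circle of radius `R` about `t₀`, carried over to the
plane of the arc. -/
def lowerIntegral (φ : OpenPartialHomeomorph ℂ ℂ) (k : ℂ → ℂ) (t₀ R : ℝ) (z : ℂ) : ℂ :=
  cauchyTransform (fun θ => φ (circleMap t₀ R θ))
    (fun θ => k (circleMap t₀ R θ) * deriv φ (circleMap t₀ R θ) * deriv (circleMap (t₀ : ℂ) R) θ)
    Real.pi (2 * Real.pi) z

theorem circleMap_mem (h : IsStraightening γ t₀ δ φ) {R : ℝ} (hR : 0 ≤ R) (hRδ : R < δ) (θ : ℝ) :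
    circleMap (t₀ : ℂ) R θ ∈ φ.source := by
  rw [h.source_eq]
  exact closedBall_subset_ball hRδ (circleMap_mem_closedBall _ hR θ)

theorem lowerIntegral_differentiableAt (h : IsStraightening γ t₀ δ φ) {k : ℂ → ℂ}
    (hk : DifferentiableOn ℂ k φ.source) {R : ℝ} (hR : 0 < R) (hRδ : R < δ) {z : ℂ}
    (hz : z ∈ φ.target) (hzR : φ.symm z ∈ ball (t₀ : ℂ) R) :
    DifferentiableAt ℂ (lowerIntegral φ k t₀ R) z := by
  have hmem := h.circleMap_mem hR.le hRδ
  have hcirc : Continuous (circleMap (t₀ : ℂ) R) := continuous_circleMap _ _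
  refine cauchyTransform_differentiableAt (by linarith [Real.pi_pos]) ?_ ?_ ?_
  · exact (h.diff.continuousOn.comp_continuous hcirc hmem).continuousOn
  · refine Continuous.intervalIntegrable ?_ _ _
    refine ((hk.continuousOn.comp_continuous hcirc hmem).mul
      (h.differentiableOn_deriv.continuousOn.comp_continuous hcirc hmem)).mul ?_
    exact continuous_deriv_circleMap
  · rintro ⟨θ, -, rfl⟩
    simp only [φ.left_inv (hmem θ)] at hzR
    have := circleMap_mem_sphere (t₀ : ℂ) hR.le θ
    rw [mem_sphere] at this
    rw [mem_ball] at hzR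
    linarith

theorem differentiableOn_kernel (h : IsStraightening γ t₀ δ φ) {k : ℂ → ℂ}
    (hk : DifferentiableOn ℂ k φ.source) {ζ : ℂ} (hζ : ζ ∈ φ.source) :
    DifferentiableOn ℂ (fun τ => k τ * deriv φ τ / (φ τ - φ ζ)) (φ.source \ {ζ}) := by
  refine DifferentiableOn.div ((hk.mul h.differentiableOn_deriv).mono sdiff_subset)
    ((h.diff.mono sdiff_subset).sub_const _) fun τ hτ h0 => hτ.2 ?_
  exact φ.injOn hτ.1 hζ (sub_eq_zero.1 h0)

/-- For `ζ` above the real axis the diameter can be deformed to the lower half circle. -/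
theorem integral_eq_lowerIntegral_of_pos (h : IsStraightening γ t₀ δ φ) {k : ℂ → ℂ}
    (hk : DifferentiableOn ℂ k φ.source) {R : ℝ} (hR : 0 < R) (hRδ : R < δ) {ζ : ℂ}
    (hζ : ζ ∈ φ.source) (him : 0 < ζ.im) :
    ∫ t in (t₀ - R)..(t₀ + R), k t * deriv φ t / (φ t - φ ζ) =
      lowerIntegral φ k t₀ R (φ ζ) := by
  have hmem := h.circleMap_mem hR.le hRδ
  have := integral_eq_integral_of_convex (S := φ.source ∩ {τ | τ.im < ζ.im})
    (φ.open_source.inter (isOpen_lt continuous_im continuous_const))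
    (by rw [h.source_eq]; exact (convex_ball _ _).inter (convex_halfSpace_im_lt _))
    ((h.differentiableOn_kernel hk hζ).mono fun τ hτ => ⟨hτ.1, fun h0 => by
      have := hτ.2; simp only [mem_ofPred_eq, mem_singleton_iff.1 h0, lt_self_iff_false] at this⟩)
    (p := fun t => (t : ℂ)) (p' := fun _ => 1) (a := t₀ - R) (b := t₀ + R)
    (q := circleMap (t₀ : ℂ) R) (q' := fun θ => deriv (circleMap (t₀ : ℂ) R) θ)
    (c := Real.pi) (d := 2 * Real.pi)
    (fun t _ => ofRealCLM.hasDerivAt)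
    (fun θ _ => (differentiable_circleMap _ _ θ).hasDerivAt) continuousOn_const
    continuous_deriv_circleMap.continuousOn ?_ ?_ ?_ ?_
  · rw [lowerIntegral, cauchyTransform]
    simp only [mul_one] at this
    rw [this]
    congr 1
    ext θ
    ring
  · intro t ht
    rw [uIcc_of_le (by linarith)] at ht
    refine ⟨?_, by simpa using him⟩
    rw [h.source_eq, ofReal_mem_ball, abs_lt]
    constructor <;> linarith [ht.1, ht.2]
  · intro θ hθ
    rw [uIcc_of_le (by linarith [Real.pi_pos])] at hθ
    exact ⟨hmem θ, (circleMap_im_nonpos hR.le hθ).trans_lt him⟩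
  · simp [circleMap, sub_eq_add_neg]
  · simp [circleMap]

/-- For `ζ` below the real axis the deformation to the lower half circle picks up a residue. -/
theorem integral_eq_lowerIntegral_of_neg (h : IsStraightening γ t₀ δ φ) {k : ℂ → ℂ}
    (hk : DifferentiableOn ℂ k φ.source) {R : ℝ} (hR : 0 < R) (hRδ : R < δ) {ζ : ℂ}
    (hζ : ζ ∈ ball (t₀ : ℂ) R) (him : ζ.im < 0) :
    ∫ t in (t₀ - R)..(t₀ + R), k t * deriv φ t / (φ t - φ ζ) =
      lowerIntegral φ k t₀ R (φ ζ) - 2 * Real.pi * I * k ζ := by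
  have hmem := h.circleMap_mem hR.le hRδ
  have hζs : ζ ∈ φ.source := by
    rw [h.source_eq]; exact ball_subset_ball hRδ.le hζ
  have hζc : ∀ θ, circleMap (t₀ : ℂ) R θ ≠ ζ := fun θ h0 => by
    have := circleMap_mem_sphere (t₀ : ℂ) hR.le θ
    rw [h0, mem_sphere] at this
    rw [mem_ball] at hζ
    linarith
  set F : ℂ → ℂ := fun τ => k τ * deriv φ τ / (φ τ - φ ζ) with hF
  have hup := integral_eq_integral_of_convex (F := F) (S := φ.source ∩ {τ | ζ.im < τ.im})
    (φ.open_source.inter (isOpen_lt continuous_const continuous_im))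
    (by rw [h.source_eq]; exact (convex_ball _ _).inter (convex_halfSpace_im_gt _))
    ((h.differentiableOn_kernel hk hζs).mono fun τ hτ => ⟨hτ.1, fun h0 => by
      have := hτ.2; simp only [mem_ofPred_eq, mem_singleton_iff.1 h0, lt_self_iff_false] at this⟩)
    (p := fun t => (t : ℂ)) (p' := fun _ => 1) (a := t₀ + R) (b := t₀ - R)
    (q := circleMap (t₀ : ℂ) R) (q' := fun θ => deriv (circleMap (t₀ : ℂ) R) θ)
    (c := 0) (d := Real.pi)
    (fun t _ => ofRealCLM.hasDerivAt)
    (fun θ _ => (differentiable_circleMap _ _ θ).hasDerivAt) continuousOn_const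
    continuous_deriv_circleMap.continuousOn
    (fun t ht => by
      rw [uIcc_of_ge (by linarith)] at ht
      refine ⟨?_, by simpa using him⟩
      rw [h.source_eq, ofReal_mem_ball, abs_lt]
      constructor <;> linarith [ht.1, ht.2])
    (fun θ hθ => by
      rw [uIcc_of_le Real.pi_pos.le] at hθ
      exact ⟨hmem θ, him.trans_le (circleMap_im_nonneg hR.le hθ)⟩)
    (by simp [circleMap]) (by simp [circleMap, sub_eq_add_neg])
  have hcont : Continuous fun θ => F (circleMap (t₀ : ℂ) R θ) * deriv (circleMap (t₀ : ℂ) R) θ := by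
    refine ((h.differentiableOn_kernel hk hζs).continuousOn.comp_continuous
      (continuous_circleMap _ _) fun θ => ⟨hmem θ, hζc θ⟩).mul ?_
    exact continuous_deriv_circleMap
  have hsum := intervalIntegral.integral_add_adjacent_intervals
    (hcont.intervalIntegrable (μ := volume) 0 Real.pi)
    (hcont.intervalIntegrable (μ := volume) Real.pi (2 * Real.pi))
  -- Cauchy's formula on the full circle
  have hslope_ne : ∀ τ ∈ φ.source, dslope φ ζ τ ≠ 0 := by
    intro τ hτ
    by_cases h0 : τ = ζ
    · rw [h0, dslope_same]; exact h.deriv_ne_zero hζs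
    · rw [dslope_of_ne _ h0, slope_def_field]
      exact div_ne_zero (sub_ne_zero.2 fun h1 => h0 (φ.injOn hτ hζs h1)) (sub_ne_zero.2 h0)
  have hJ : DifferentiableOn ℂ (fun τ => k τ * deriv φ τ / dslope φ ζ τ) φ.source :=
    (hk.mul h.differentiableOn_deriv).div
      ((differentiableOn_dslope (φ.open_source.mem_nhds hζs)).2 h.diff) hslope_ne
  have hcauchy := (hJ.diffContOnCl_ball (c := (t₀ : ℂ)) (R := R)
    (by rw [h.source_eq]; exact closedBall_subset_ball hRδ)).circleIntegral_sub_inv_smul hζ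
  have hfull : ∫ θ in (0 : ℝ)..(2 * Real.pi),
      F (circleMap (t₀ : ℂ) R θ) * deriv (circleMap (t₀ : ℂ) R) θ = 2 * Real.pi * I * k ζ := by
    have e1 : k ζ * deriv φ ζ / dslope φ ζ ζ = k ζ := by
      rw [dslope_same, mul_div_assoc, div_self (h.deriv_ne_zero hζs), mul_one]
    rw [e1] at hcauchy
    rw [smul_eq_mul] at hcauchy
    rw [← hcauchy, circleIntegral]
    congr 1
    ext θ
    have h1 : circleMap (t₀ : ℂ) R θ - ζ ≠ 0 := sub_ne_zero.2 (hζc θ)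
    have h2 : φ (circleMap (t₀ : ℂ) R θ) - φ ζ ≠ 0 :=
      sub_ne_zero.2 fun h0 => hζc θ (φ.injOn (hmem θ) hζs h0)
    rw [dslope_of_ne _ (hζc θ), slope_def_field]
    simp only [hF, smul_eq_mul]
    field_simp
  have hlow : lowerIntegral φ k t₀ R (φ ζ) = ∫ θ in Real.pi..(2 * Real.pi),
      F (circleMap (t₀ : ℂ) R θ) * deriv (circleMap (t₀ : ℂ) R) θ := by
    rw [lowerIntegral, cauchyTransform]
    congr 1
    ext θ
    simp only [hF]
    ring
  simp only [mul_one] at hup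
  rw [hlow, intervalIntegral.integral_symm]
  change -∫ t in (t₀ + R)..(t₀ - R), F t = _
  rw [hup, ← hfull, ← hsum]
  ring

end IsStraightening

/-! ### Recovering a function from its jump across the arc -/

theorem intervalIntegrable_of_continuousOn_Ioo {f : ℝ → ℂ} {M : ℝ}
    (hf : ContinuousOn f (Ioo 0 1)) (hM : ∀ t ∈ Ioo (0 : ℝ) 1, ‖f t‖ ≤ M) :
    IntervalIntegrable f volume 0 1 := by
  rw [intervalIntegrable_iff_integrableOn_Ioo_of_le zero_le_one]
  exact Integrable.of_bound (hf.aestronglyMeasurable measurableSet_Ioo) M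
    ((ae_restrict_iff' measurableSet_Ioo).2 (Eventually.of_forall hM))

/-- Near an interior point of the arc, subtracting the Cauchy type integral of the jump removes the
discontinuity of `E`. -/
theorem HasSides.extendsAt_sub_cauchyTransform {E : ℂ → ℂ} {γ : ℝ → ℂ} {a b : ℂ}
    (hγ : IsAnalyticArc γ a b) {t₀ δ : ℝ} {φ : OpenPartialHomeomorph ℂ ℂ} {A B : ℂ → ℂ}
    (hs : HasSides E γ t₀ δ φ A B) {κ : ℝ → ℂ}
    (hint : IntervalIntegrable (fun t => κ t * deriv γ t) volume 0 1)
    (hκ : ∀ t : ℝ, |t - t₀| < δ → κ t = A t - B t) :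
    ExtendsAt (fun z => E z - (2 * Real.pi * I)⁻¹ *
      cauchyTransform γ (fun t => κ t * deriv γ t) 0 1 z) (γ '' Icc 0 1) (γ t₀) := by
  have hst := hs.straight
  set h : ℝ → ℂ := fun t => κ t * deriv γ t with hh
  set R := δ / 2 with hRdef
  have hδ := hst.pos
  have hR : 0 < R := by positivity
  have hRδ : R < δ := by rw [hRdef]; linarith
  have h0R : 0 ≤ t₀ - R := by linarith [hs.le_left]
  have hR1 : t₀ + R ≤ 1 := by linarith [hs.le_right]
  have hRR : t₀ - R ≤ t₀ + R := by linarith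
  set k : ℂ → ℂ := fun ζ => A ζ - B ζ with hk
  have hkd : DifferentiableOn ℂ k φ.source := hs.diff_left.sub hs.diff_right
  set V : Set ℂ := φ.target ∩ φ.symm ⁻¹' ball (t₀ : ℂ) R with hV
  have hVo : IsOpen V := φ.symm.isOpen_inter_preimage isOpen_ball
  have hVmem : V ∈ 𝓝 (γ t₀) := by
    refine hVo.mem_nhds ⟨mem_of_mem_nhds hst.target_mem_nhds, ?_⟩
    rw [mem_preimage, ← hst.apply_center, φ.left_inv hst.center_mem]
    exact mem_ball_self hR
  have hsub1 : Icc 0 (t₀ - R) ⊆ Icc (0 : ℝ) 1 := Icc_subset_Icc_right (by linarith)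
  have hsub2 : Icc (t₀ + R) 1 ⊆ Icc (0 : ℝ) 1 := Icc_subset_Icc_left (by linarith)
  have hfar : ∀ z ∈ V, ∀ t ∈ Icc (0 : ℝ) 1, γ t = z → |t - t₀| < R := by
    rintro z hz t ht rfl
    have hsrc := φ.map_target hz.1
    obtain ⟨s, hsI, hseq⟩ := (hst.mem_image_iff _ hsrc).1
      (by rw [φ.right_inv hz.1]; exact mem_image_of_mem γ ht)
    have hsR : |s - t₀| < R := by
      rw [← ofReal_mem_ball, ← hseq]; exact hz.2
    have : s = t := by
      refine hγ.injOn hsI ht ?_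
      rw [← hst.apply_ofReal s (hsR.trans hRδ), ← hseq, φ.right_inv hz.1]
    rwa [← this]
  have hn1 : ∀ z ∈ V, z ∉ γ '' Icc 0 (t₀ - R) := by
    rintro z hz ⟨t, ht, hteq⟩
    have := abs_lt.1 (hfar z hz t (hsub1 ht) hteq)
    linarith [ht.2, this.1]
  have hn2 : ∀ z ∈ V, z ∉ γ '' Icc (t₀ + R) 1 := by
    rintro z hz ⟨t, ht, hteq⟩
    have := abs_lt.1 (hfar z hz t (hsub2 ht) hteq)
    linarith [ht.1, this.2]
  have hint1 : IntervalIntegrable h volume 0 (t₀ - R) := hint.mono_set (by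
    rw [uIcc_of_le h0R, uIcc_of_le zero_le_one]; exact hsub1)
  have hint2 : IntervalIntegrable h volume (t₀ + R) 1 := hint.mono_set (by
    rw [uIcc_of_le hR1, uIcc_of_le zero_le_one]; exact hsub2)
  refine ⟨V, hVmem, fun z => A (φ.symm z) - (2 * Real.pi * I)⁻¹ *
    (cauchyTransform γ h 0 (t₀ - R) z + IsStraightening.lowerIntegral φ k t₀ R z +
      cauchyTransform γ h (t₀ + R) 1 z), fun z hz => ?_, fun z hz => ?_⟩
  · have hsrc := φ.map_target hz.1
    refine DifferentiableAt.differentiableWithinAt ?_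
    refine DifferentiableAt.sub ?_ (DifferentiableAt.const_mul
      (DifferentiableAt.add (DifferentiableAt.add ?_ ?_) ?_) _)
    · exact (hs.diff_left.differentiableAt (φ.open_source.mem_nhds hsrc)).comp z
        (hst.diff_symm.differentiableAt (φ.open_target.mem_nhds hz.1))
    · exact cauchyTransform_differentiableAt h0R (hγ.continuousOn.mono hsub1) hint1 (hn1 z hz)
    · exact hst.lowerIntegral_differentiableAt hkd hR hRδ hz.1 hz.2
    · exact cauchyTransform_differentiableAt hR1 (hγ.continuousOn.mono hsub2) hint2 (hn2 z hz)
  · obtain ⟨hzV, hzΓ⟩ := hz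
    have hsrc := φ.map_target hzV.1
    have him := hs.im_ne_zero hzV.1 hzΓ
    have hInt : IntervalIntegrable (fun t => h t / (γ t - z)) volume 0 1 :=
      intervalIntegrable_div_sub zero_le_one hγ.continuousOn hint hzΓ
    have hI : ∀ {c d : ℝ}, 0 ≤ c → c ≤ d → d ≤ 1 →
        IntervalIntegrable (fun t => h t / (γ t - z)) volume c d := fun hc hcd hd =>
      hInt.mono_set (by
        rw [uIcc_of_le hcd, uIcc_of_le zero_le_one]; exact Icc_subset_Icc hc hd)
    have hsplit : cauchyTransform γ h 0 1 z = cauchyTransform γ h 0 (t₀ - R) z +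
        cauchyTransform γ h (t₀ - R) (t₀ + R) z + cauchyTransform γ h (t₀ + R) 1 z := by
      unfold cauchyTransform
      rw [intervalIntegral.integral_add_adjacent_intervals (hI le_rfl h0R (by linarith))
        (hI h0R hRR hR1), intervalIntegral.integral_add_adjacent_intervals
        (hI le_rfl (by linarith) hR1) (hI (by linarith) hR1 le_rfl)]
    have hmid : cauchyTransform γ h (t₀ - R) (t₀ + R) z =
        ∫ t in (t₀ - R)..(t₀ + R), k t * deriv φ t / (φ t - φ (φ.symm z)) := by
      unfold cauchyTransform
      refine intervalIntegral.integral_congr fun t ht => ?_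
      rw [uIcc_of_le hRR] at ht
      have htδ : |t - t₀| < δ := by
        rw [abs_lt]; constructor <;> linarith [ht.1, ht.2]
      simp only [hh, hk]
      rw [φ.right_inv hzV.1, hst.apply_ofReal t htδ, ← hst.deriv_ofReal htδ, hκ t htδ]
    have hpi : (2 * Real.pi * I : ℂ) ≠ 0 := two_pi_I_ne_zero
    simp only []
    rw [hsplit, hmid]
    rcases lt_or_gt_of_ne him with him | him
    · rw [hst.integral_eq_lowerIntegral_of_neg hkd hR hRδ hzV.2 him, φ.right_inv hzV.1]
      have hE := hs.eq_right _ hsrc him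
      rw [φ.right_inv hzV.1] at hE
      rw [hE]
      simp only [hk]
      field_simp
      ring
    · rw [hst.integral_eq_lowerIntegral_of_pos hkd hR hRδ hsrc him, φ.right_inv hzV.1]
      have hE := hs.eq_left _ hsrc him
      rw [φ.right_inv hzV.1] at hE
      rw [hE]

/-- The Cauchy type integral is small, compared to the inverse distance to the arc, at every point
of the arc. -/
theorem IsStraightening.tendsto_im_mul_cauchyTransform {γ : ℝ → ℂ} {a b : ℂ}
    (hγ : IsAnalyticArc γ a b) {t₀ δ : ℝ} (ht₀ : t₀ ∈ Icc (0 : ℝ) 1)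
    {φ : OpenPartialHomeomorph ℂ ℂ}
    (hst : IsStraightening γ t₀ δ φ) {h : ℝ → ℂ} (hint : IntervalIntegrable h volume 0 1) :
    Tendsto (fun ζ : ℂ => (ζ.im : ℂ) * cauchyTransform γ h 0 1 (φ ζ))
      (𝓝[{ζ | ζ.im ≠ 0}] (t₀ : ℂ)) (𝓝 0) := by
  have hφc : ContinuousAt φ (t₀ : ℂ) := (hst.differentiableAt hst.center_mem).continuousAt
  have hsub : uIoc (0 : ℝ) 1 ⊆ Icc 0 1 := by
    rw [uIoc_of_le zero_le_one]; exact Ioc_subset_Icc_self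
  -- `φ.symm` is Lipschitz near the point, so `|ζ.im|` is at most a multiple of the distance
  -- of `φ ζ` to the arc
  obtain ⟨C, hC0, hC⟩ : ∃ C : ℝ, 0 ≤ C ∧ ∀ᶠ ζ in 𝓝[{ζ : ℂ | ζ.im ≠ 0}] (t₀ : ℂ),
      ∀ t ∈ Icc (0 : ℝ) 1,
      |ζ.im| ≤ C * ‖γ t - φ ζ‖ := by
    have hcd : ContDiffAt ℂ 1 φ.symm (γ t₀) :=
      (hst.diff_symm.contDiffOn φ.open_target).contDiffAt hst.target_mem_nhds
    obtain ⟨K, N, hN, hK⟩ := hcd.exists_lipschitzOnWith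
    obtain ⟨ρ, hρ, hρN⟩ := Metric.mem_nhds_iff.1 (inter_mem hN hst.target_mem_nhds)
    refine ⟨max (K : ℝ) (δ / (ρ / 2)), le_max_of_le_left K.coe_nonneg, ?_⟩
    have hφρ : ∀ᶠ ζ in 𝓝 (t₀ : ℂ), φ ζ ∈ ball (γ t₀) (ρ / 2) :=
      hφc.eventually (by rw [hst.apply_center]; exact ball_mem_nhds _ (by positivity))
    filter_upwards [nhdsWithin_le_nhds hφρ,
      nhdsWithin_le_nhds (φ.open_source.mem_nhds hst.center_mem)] with ζ hζρ hζ t ht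
    by_cases hball : γ t ∈ ball (γ t₀) ρ
    · have htar := (hρN hball).2
      obtain ⟨s, -, hs⟩ := (hst.mem_image_iff _ (φ.map_target htar)).1
        (by rw [φ.right_inv htar]; exact mem_image_of_mem γ ht)
      have h1 := hK.dist_le_mul _ (hρN hball).1 _
        (hρN (ball_subset_ball (by linarith) hζρ)).1
      rw [φ.left_inv hζ, hs, dist_eq_norm, dist_eq_norm] at h1
      have h2 : |ζ.im| ≤ ‖(s : ℂ) - ζ‖ := by
        have := abs_im_le_norm ((s : ℂ) - ζ)
        simpa using this
      exact (h2.trans h1).trans (by gcongr; exact le_max_left _ _)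
    · have h1 : ρ / 2 ≤ ‖γ t - φ ζ‖ := by
        rw [mem_ball, not_lt] at hball
        have := dist_triangle (γ t) (φ ζ) (γ t₀)
        rw [mem_ball] at hζρ
        rw [← dist_eq_norm]
        linarith
      have h2 : |ζ.im| ≤ δ := by
        rw [hst.source_eq, mem_ball, dist_eq_norm] at hζ
        have := abs_im_le_norm (ζ - t₀)
        simp only [sub_im, ofReal_im, sub_zero] at this
        exact this.trans hζ.le
      have hδ := hst.pos
      calc |ζ.im| ≤ δ := h2
        _ = δ / (ρ / 2) * (ρ / 2) := by field_simp
        _ ≤ max (K : ℝ) (δ / (ρ / 2)) * ‖γ t - φ ζ‖ := by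
          gcongr
          exact le_max_right _ _
  have hrw : ∀ ζ : ℂ, (ζ.im : ℂ) * cauchyTransform γ h 0 1 (φ ζ) =
      ∫ t in (0 : ℝ)..1, (ζ.im : ℂ) * (h t / (γ t - φ ζ)) := fun ζ => by
    rw [cauchyTransform, intervalIntegral.integral_const_mul]
  simp_rw [hrw]
  have h0 : (0 : ℂ) = ∫ _t in (0 : ℝ)..1, (0 : ℂ) := by simp
  rw [h0]
  refine intervalIntegral.tendsto_integral_filter_of_dominated_convergence
    (fun t => C * ‖h t‖) ?_ ?_ (hint.norm.const_mul _) ?_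
  · filter_upwards [self_mem_nhdsWithin,
      nhdsWithin_le_nhds (φ.open_source.mem_nhds hst.center_mem)] with ζ him hζ
    exact ((intervalIntegrable_div_sub zero_le_one hγ.continuousOn hint
      (hst.map_notMem hζ him)).const_mul _).aestronglyMeasurable_restrict_uIoc
  · filter_upwards [hC] with ζ hζ
    refine Eventually.of_forall fun t ht => ?_
    rw [norm_mul, norm_real, Real.norm_eq_abs, norm_div]
    rcases eq_or_ne ‖γ t - φ ζ‖ 0 with hz | hz
    · rw [hz, div_zero, mul_zero]; positivity
    · rw [mul_div_assoc', div_le_iff₀ (lt_of_le_of_ne (norm_nonneg _) hz.symm)]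
      calc |ζ.im| * ‖h t‖ ≤ C * ‖γ t - φ ζ‖ * ‖h t‖ := by gcongr; exact hζ t (hsub ht)
        _ = C * ‖h t‖ * ‖γ t - φ ζ‖ := by ring
  · have hae : ∀ᵐ t : ℝ, t ≠ t₀ := by
      simp [ae_iff]
    filter_upwards [hae] with t hne ht
    have hne' : γ t - φ t₀ ≠ 0 := by
      rw [hst.apply_center]
      exact sub_ne_zero.2 fun h1 => hne (hγ.injOn (hsub ht) ht₀ h1)
    have h1 : ContinuousAt (fun ζ : ℂ => (ζ.im : ℂ) * (h t / (γ t - φ ζ))) (t₀ : ℂ) :=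
      (continuous_ofReal.comp continuous_im).continuousAt.mul
        (continuousAt_const.div (continuousAt_const.sub hφc) hne')
    have h2 := h1.tendsto.mono_left (nhdsWithin_le_nhds (s := {ζ : ℂ | ζ.im ≠ 0}))
    simpa using h2

/-- **Sokhotski–Plemelj formula** for an arc: a function which is holomorphic off the arc, bounded
near its end points, and which has a limit at infinity, is recovered from its jump `κ`. The
difference of the two sides extends across the arc, so that it is constant by Liouville's
theorem. -/
theorem IsAnalyticArc.eq_add_cauchyTransform {γ : ℝ → ℂ} {a b : ℂ} (hγ : IsAnalyticArc γ a b)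
    {E : ℂ → ℂ} (hE : DifferentiableOn ℂ E (γ '' Icc 0 1)ᶜ) {c : ℂ}
    (hc : Tendsto E (Bornology.cobounded ℂ) (𝓝 c)) {M : ℝ}
    (hbd : ∀ t ∈ Icc (0 : ℝ) 1, ∀ᶠ z in 𝓝[(γ '' Icc 0 1)ᶜ] (γ t), ‖E z‖ ≤ M)
    {κ : ℝ → ℂ} (hint : IntervalIntegrable (fun t => κ t * deriv γ t) volume 0 1)
    (hsides : ∀ t₀ ∈ Ioo (0 : ℝ) 1, ∃ δ φ A B, HasSides E γ t₀ δ φ A B ∧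
      ∀ t : ℝ, |t - t₀| < δ → κ t = A t - B t) {z : ℂ} (hz : z ∉ γ '' Icc 0 1) :
    E z = c + (2 * Real.pi * I)⁻¹ *
      cauchyTransform γ (fun t => κ t * deriv γ t) 0 1 z := by
  set H : ℂ → ℂ := cauchyTransform γ (fun t => κ t * deriv γ t) 0 1 with hH
  have hHd : DifferentiableOn ℂ H (γ '' Icc 0 1)ᶜ := fun z hz =>
    (cauchyTransform_differentiableAt zero_le_one hγ.continuousOn hint hz).differentiableWithinAt
  have hlim : Tendsto (fun z => E z - (2 * Real.pi * I)⁻¹ * H z) (Bornology.cobounded ℂ)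
      (𝓝 c) := by
    simpa using hc.sub
      ((tendsto_cauchyTransform zero_le_one hγ.continuousOn hint).const_mul (2 * Real.pi * I)⁻¹)
  refine sub_eq_iff_eq_add.1 (eq_of_extendsAt_of_tendsto hγ.dense_compl
    hγ.isCompact_image.isBounded (fun p => ?_) hlim hz)
  refine hγ.extendsAt_of_Ioo (hE.sub (hHd.const_mul _)) (fun t ht => ?_) (fun t₀ ht₀ => ?_) p
  · obtain ⟨δ, φ, A, B, hs, hκ⟩ := hsides t ht
    exact hs.extendsAt_sub_cauchyTransform hγ hint hκ
  · have ht₀' : t₀ ∈ Icc (0 : ℝ) 1 := by rcases ht₀ with rfl | rfl <;> simp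
    obtain ⟨δ, φ, hst, -, -⟩ := hγ.exists_straightening ht₀' univ_mem (one_pos : (0 : ℝ) < 1)
    refine ⟨δ, φ, hst, ?_⟩
    have hφc : ContinuousAt φ (t₀ : ℂ) := (hst.differentiableAt hst.center_mem).continuousAt
    have h1 : Tendsto (fun ζ : ℂ => (ζ.im : ℂ) * E (φ ζ)) (𝓝[{ζ | ζ.im ≠ 0}] (t₀ : ℂ))
        (𝓝 0) := by
      refine tendsto_im_mul_of_bounded (M := M) ?_
      have h2 := eventually_nhdsWithin_iff.1 (hbd t₀ ht₀')
      rw [← hst.apply_center] at h2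
      filter_upwards [nhdsWithin_le_nhds (hφc.eventually h2), self_mem_nhdsWithin,
        nhdsWithin_le_nhds (φ.open_source.mem_nhds hst.center_mem)] with ζ hb him hζ
      exact hb (hst.map_notMem hζ him)
    have h2 := (hst.tendsto_im_mul_cauchyTransform hγ ht₀' hint).const_mul (2 * Real.pi * I)⁻¹
    rw [mul_zero] at h2
    have h3 := h1.sub h2
    rw [sub_zero] at h3
    refine h3.congr fun ζ => ?_
    simp only [Pi.sub_apply, hH]
    ring

/-! ### Logarithmic potentials of complex measures on an arc -/

section LogPotential

variable {γ ρ : ℝ → ℂ} {a b : ℂ}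

theorem exists_isLogPotential (hγ : ContinuousOn γ (Icc 0 1)) {z : ℂ} (hz : z ∉ γ '' Icc 0 1) :
    ∃ g, IsLogPotential γ ρ z g := by
  have hcont : Continuous fun t : ℝ => z - γ (projIcc 0 1 zero_le_one t) :=
    continuous_const.sub (hγ.comp_continuous (continuous_subtype_val.comp continuous_projIcc)
      fun t => (projIcc 0 1 zero_le_one t).2)
  have hcontr : ContractibleSpace (univ : Set ℝ) :=
    (convex_univ (𝕜 := ℝ)).contractibleSpace univ_nonempty
  have hsc : IsSimplyConnected (univ : Set ℝ) :=
    (inferInstance : SimplyConnectedSpace (univ : Set ℝ))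
  obtain ⟨l, hl, hexp⟩ := exists_continuousOn_eqOn_exp_comp (X := ℝ) (U := univ)
    hsc isOpen_univ hcont.continuousOn (by
      rintro ⟨t, -, ht⟩
      exact hz ⟨_, (projIcc 0 1 zero_le_one t).2, (sub_eq_zero.1 ht).symm⟩)
  refine ⟨_, l, hl.mono (subset_univ _), fun t ht => ?_, rfl⟩
  have := hexp (mem_univ t)
  simpa [projIcc_of_mem zero_le_one ht] using this

/-- When the measure has total mass one, different branches of the logarithm change the potential
by an integer multiple of `2πi`. -/
theorem IsLogPotential.exp_eq (hm : ∫ t in (0 : ℝ)..1, ρ t * deriv γ t = 1)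
    (hint : IntervalIntegrable (fun t => ρ t * deriv γ t) volume 0 1) {z g g' : ℂ}
    (h : IsLogPotential γ ρ z g) (h' : IsLogPotential γ ρ z g') : exp g = exp g' := by
  obtain ⟨l, hl, hle, rfl⟩ := h
  obtain ⟨l', hl', hle', rfl⟩ := h'
  have hdisc : DiscreteTopology (AddSubgroup.zmultiples (2 * Real.pi * I)) :=
    NormedSpace.discreteTopology_zmultiples _
  have hmaps : MapsTo (fun t => l t - l' t) (Icc (0 : ℝ) 1)
      (AddSubgroup.zmultiples (2 * Real.pi * I) : Set ℂ) := by
    intro t ht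
    obtain ⟨n, hn⟩ := exp_eq_exp_iff_exists_int.1 ((hle t ht).trans (hle' t ht).symm)
    exact ⟨n, by simp [hn]⟩
  have hconst : ∀ t ∈ Icc (0 : ℝ) 1, l t - l' t = l 0 - l' 0 := fun t ht =>
    isPreconnected_Icc.constant_of_mapsTo (hT := ⟨hdisc⟩) (hl.sub hl') hmaps ht
      (left_mem_Icc.2 zero_le_one)
  have hI : ∀ {l : ℝ → ℂ}, ContinuousOn l (Icc 0 1) →
      IntervalIntegrable (fun t => l t * (ρ t * deriv γ t)) volume 0 1 := fun hl => by
    refine hint.continuousOn_mul ?_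
    rwa [uIcc_of_le zero_le_one]
  have hdiff : (∫ t in (0 : ℝ)..1, l t * (ρ t * deriv γ t)) -
      ∫ t in (0 : ℝ)..1, l' t * (ρ t * deriv γ t) = l 0 - l' 0 := by
    rw [← intervalIntegral.integral_sub (hI hl) (hI hl')]
    calc _ = ∫ t in (0 : ℝ)..1, (l 0 - l' 0) * (ρ t * deriv γ t) := by
          refine intervalIntegral.integral_congr fun t ht => ?_
          rw [uIcc_of_le zero_le_one] at ht
          simp only [← hconst t ht]
          ring
      _ = _ := by rw [intervalIntegral.integral_const_mul, hm, mul_one]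
  have h0 : (0 : ℝ) ∈ Icc (0 : ℝ) 1 := left_mem_Icc.2 zero_le_one
  obtain ⟨n, hn⟩ := hmaps h0
  refine exp_eq_exp_iff_exists_int.2 ⟨n, ?_⟩
  have hn' : (n : ℂ) * (2 * Real.pi * I) = l 0 - l' 0 := by
    simpa using hn
  rw [hn', ← hdiff]
  ring

/-- The logarithmic derivative of `exp g`, for `g` the logarithmic potential of the measure
`ρ(s) ds`, is the integral `∫ ρ(s) ds / (z - s)`. -/
theorem IsAnalyticArc.hasDerivAt_exp_potential (hγ : IsAnalyticArc γ a b)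
    (hm : ∫ t in (0 : ℝ)..1, ρ t * deriv γ t = 1)
    (hint : IntervalIntegrable (fun t => ρ t * deriv γ t) volume 0 1) {X : ℂ → ℂ}
    (hX : ∀ z ∉ γ '' Icc 0 1, ∃ g, IsLogPotential γ ρ z g ∧ X z = exp g) {z₀ : ℂ}
    (hz₀ : z₀ ∉ γ '' Icc 0 1) :
    HasDerivAt X (X z₀ * -cauchyTransform γ (fun t => ρ t * deriv γ t) 0 1 z₀) z₀ := by
  set ν : ℝ → ℂ := fun t => ρ t * deriv γ t with hν
  obtain ⟨g, ⟨l, hl, hle, hg⟩, hXg⟩ := hX z₀ hz₀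
  obtain ⟨ε, hε, hball⟩ := Metric.isOpen_iff.1 hγ.isClosed_image.isOpen_compl z₀ hz₀
  have hdist : ∀ t ∈ Icc (0 : ℝ) 1, ε ≤ ‖z₀ - γ t‖ := by
    intro t ht
    by_contra! hcon
    refine hball ?_ ⟨t, ht, rfl⟩
    rwa [mem_ball, dist_comm, dist_eq_norm]
  have hne : ∀ t ∈ Icc (0 : ℝ) 1, z₀ - γ t ≠ 0 := fun t ht h0 => by
    have := hdist t ht
    rw [h0, norm_zero] at this
    linarith
  have hslit : ∀ z ∈ ball z₀ ε, ∀ t ∈ Icc (0 : ℝ) 1,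
      1 + (z - z₀) / (z₀ - γ t) ∈ slitPlane := by
    intro z hz t ht
    refine mem_slitPlane_of_norm_lt_one ?_
    rw [norm_div, div_lt_one (hε.trans_le (hdist t ht))]
    rw [mem_ball, dist_eq_norm] at hz
    exact hz.trans_le (hdist t ht)
  have hsub : uIoc (0 : ℝ) 1 ⊆ Icc 0 1 := by
    rw [uIoc_of_le zero_le_one]; exact Ioc_subset_Icc_self
  set J : ℂ → ℂ := fun z => ∫ t in (0 : ℝ)..1, log (1 + (z - z₀) / (z₀ - γ t)) * ν t with hJ
  have hlogc : ∀ z ∈ ball z₀ ε,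
      ContinuousOn (fun t => log (1 + (z - z₀) / (z₀ - γ t))) (Icc 0 1) := fun z hz =>
    ContinuousOn.clog (continuousOn_const.add (continuousOn_const.div
      (continuousOn_const.sub hγ.continuousOn) hne)) (hslit z hz)
  have hlogI : ∀ z ∈ ball z₀ ε, IntervalIntegrable
      (fun t => log (1 + (z - z₀) / (z₀ - γ t)) * ν t) volume 0 1 := fun z hz => by
    refine hint.continuousOn_mul ?_
    rw [uIcc_of_le zero_le_one]
    exact hlogc z hz
  have hXJ : ∀ z ∈ ball z₀ ε, X z = exp (g + J z) := by
    intro z hz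
    obtain ⟨g', hg', hXg'⟩ := hX z (hball hz)
    rw [hXg']
    refine hg'.exp_eq hm hint ⟨fun t => l t + log (1 + (z - z₀) / (z₀ - γ t)),
      hl.add (hlogc z hz), fun t ht => ?_, ?_⟩
    · rw [exp_add, hle t ht, exp_log (slitPlane_ne_zero (hslit z hz t ht))]
      field_simp [hne t ht]
      ring
    · rw [hg, hJ, ← intervalIntegral.integral_add ?_ (hlogI z hz)]
      · congr 1
        ext t
        simp only [hν]
        ring
      · refine hint.continuousOn_mul ?_
        rwa [uIcc_of_le zero_le_one]
  have hJ0 : J z₀ = 0 := by simp [hJ]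
  have hbound : ∀ z ∈ ball z₀ (ε / 2), ∀ t ∈ Icc (0 : ℝ) 1, ε / 2 ≤ ‖z - γ t‖ := by
    intro z hz t ht
    have h1 := hdist t ht
    have h2 := norm_sub_le_norm_sub_add_norm_sub z₀ z (γ t)
    rw [mem_ball, dist_comm, dist_eq_norm] at hz
    linarith
  have hhalf : ball z₀ (ε / 2) ⊆ ball z₀ ε := ball_subset_ball (by linarith)
  have hJd : HasDerivAt J (∫ t in (0 : ℝ)..1, (z₀ - γ t)⁻¹ * ν t) z₀ := by
    refine (intervalIntegral.hasDerivAt_integral_of_dominated_loc_of_deriv_le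
      (F' := fun z t => (z - γ t)⁻¹ * ν t) (bound := fun t => (ε / 2)⁻¹ * ‖ν t‖)
      (ball_mem_nhds z₀ (by positivity : 0 < ε / 2)) ?_ ?_ ?_ ?_ ?_ ?_).2
    · filter_upwards [ball_mem_nhds z₀ hε] with z hz
      exact (hlogI z hz).aestronglyMeasurable_restrict_uIoc
    · exact hlogI z₀ (mem_ball_self hε)
    · refine IntervalIntegrable.aestronglyMeasurable_restrict_uIoc ?_
      refine hint.continuousOn_mul ?_
      rw [uIcc_of_le zero_le_one]
      exact (continuousOn_const.sub hγ.continuousOn).inv₀ hne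
    · refine Eventually.of_forall fun t ht z hz => ?_
      rw [norm_mul, norm_inv]
      gcongr
      exact hbound z hz t (hsub ht)
    · exact hint.norm.const_mul _
    · refine Eventually.of_forall fun t ht z hz => ?_
      have htI := hsub ht
      have h1 : HasDerivAt (fun z => 1 + (z - z₀) / (z₀ - γ t)) (1 / (z₀ - γ t)) z :=
        (((hasDerivAt_id z).sub_const z₀).div_const _).const_add 1
      have h2 := (h1.clog (hslit z (hhalf hz) t htI)).mul_const (ν t)
      refine h2.congr_deriv ?_
      have hz0 : z - γ t ≠ 0 := fun h0 => by
        have := hbound z hz t htI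
        rw [h0, norm_zero] at this
        linarith
      have h3 : 1 + (z - z₀) / (z₀ - γ t) = (z - γ t) / (z₀ - γ t) := by
        field_simp [hne t htI]
        ring
      rw [h3]
      have := hne t htI
      field_simp
  have hd : HasDerivAt (fun z => exp (g + J z))
      (exp (g + J z₀) * ∫ t in (0 : ℝ)..1, (z₀ - γ t)⁻¹ * ν t) z₀ :=
    (hJd.const_add g).cexp
  have hev : X =ᶠ[𝓝 z₀] fun z => exp (g + J z) := by
    filter_upwards [ball_mem_nhds z₀ hε] with z hz using hXJ z hz
  refine (hd.congr_of_eventuallyEq hev).congr_deriv ?_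
  rw [hJ0, add_zero, hXg, cauchyTransform, ← intervalIntegral.integral_neg]
  congr 2
  ext t
  rw [← neg_sub (γ t) z₀, inv_neg, div_eq_mul_inv]
  ring

theorem IsAnalyticArc.tendsto_exp_potential_div (hγ : IsAnalyticArc γ a b)
    (hm : ∫ t in (0 : ℝ)..1, ρ t * deriv γ t = 1)
    (hint : IntervalIntegrable (fun t => ρ t * deriv γ t) volume 0 1) {X : ℂ → ℂ}
    (hX : ∀ z ∉ γ '' Icc 0 1, ∃ g, IsLogPotential γ ρ z g ∧ X z = exp g) :
    Tendsto (fun z => X z / z) (Bornology.cobounded ℂ) (𝓝 1) := by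
  set ν : ℝ → ℂ := fun t => ρ t * deriv γ t with hν
  obtain ⟨M, hM⟩ := hγ.isCompact_image.isBounded.exists_norm_le
  have hsub : Ioc (0 : ℝ) 1 ⊆ Icc 0 1 := Ioc_subset_Icc_self
  have hlarge : ∀ᶠ z : ℂ in Bornology.cobounded ℂ, 2 * |M| + 1 ≤ ‖z‖ :=
    tendsto_norm_cobounded_atTop.eventually_ge_atTop _
  set J : ℂ → ℂ := fun z => ∫ t in (0 : ℝ)..1, log (1 + -γ t / z) * ν t with hJ
  have hhalf : ∀ z : ℂ, 2 * |M| + 1 ≤ ‖z‖ → ∀ t ∈ Icc (0 : ℝ) 1, ‖-γ t / z‖ ≤ 1 / 2 := by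
    intro z hz t ht
    have h1 := hM _ (mem_image_of_mem γ ht)
    rw [norm_div, norm_neg, div_le_iff₀ (by linarith [abs_nonneg M])]
    linarith [le_abs_self M]
  have hXJ : ∀ z : ℂ, 2 * |M| + 1 ≤ ‖z‖ → X z = z * exp (J z) := by
    intro z hz
    have hz0 : z ≠ 0 := by
      rintro rfl
      rw [norm_zero] at hz
      linarith [abs_nonneg M]
    have hzΓ : z ∉ γ '' Icc 0 1 := fun h0 => by
      have := hM z h0
      linarith [le_abs_self M, abs_nonneg M]
    have hslit : ∀ t ∈ Icc (0 : ℝ) 1, 1 + -γ t / z ∈ slitPlane := fun t ht =>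
      mem_slitPlane_of_norm_lt_one ((hhalf z hz t ht).trans_lt (by norm_num))
    have hlogc : ContinuousOn (fun t => log (1 + -γ t / z)) (Icc 0 1) :=
      ContinuousOn.clog (continuousOn_const.add (hγ.continuousOn.neg.div_const z)) hslit
    obtain ⟨g, hg, hXg⟩ := hX z hzΓ
    rw [hXg, ← exp_log hz0, ← exp_add]
    rw [exp_log hz0]
    refine hg.exp_eq hm hint ⟨fun t => log z + log (1 + -γ t / z),
      continuousOn_const.add hlogc, fun t ht => ?_, ?_⟩
    · rw [exp_add, exp_log hz0, exp_log (slitPlane_ne_zero (hslit t ht))]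
      field_simp
      ring
    · have h1 : log z = ∫ t in (0 : ℝ)..1, log z * ν t := by
        rw [intervalIntegral.integral_const_mul, hm, mul_one]
      rw [hJ]
      nth_rw 1 [h1]
      rw [← intervalIntegral.integral_add (hint.const_mul _) ?_]
      · congr 1
        ext t
        simp only [hν]
        ring
      · refine hint.continuousOn_mul ?_
        rwa [uIcc_of_le zero_le_one]
  have hJlim : Tendsto J (Bornology.cobounded ℂ) (𝓝 0) := by
    have hinv : Tendsto (fun z : ℂ => ‖z⁻¹‖) (Bornology.cobounded ℂ) (𝓝 0) := by
      simpa using (tendsto_inv₀_cobounded (α := ℂ)).norm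
    have hC := hinv.mul_const (3 / 2 * |M| * ∫ t in (0 : ℝ)..1, ‖ν t‖)
    rw [zero_mul] at hC
    refine squeeze_zero_norm' ?_ hC
    filter_upwards [hlarge] with z hz
    have := intervalIntegral.norm_integral_le_of_norm_le (μ := volume)
      (f := fun t => log (1 + -γ t / z) * ν t)
      (g := fun t => ‖z⁻¹‖ * (3 / 2 * |M|) * ‖ν t‖) zero_le_one
      (Eventually.of_forall fun t ht => ?_) (hint.norm.const_mul _)
    · rw [intervalIntegral.integral_const_mul] at this
      rw [← mul_assoc]
      exact this
    · rw [norm_mul]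
      gcongr
      refine (norm_log_one_add_half_le_self (hhalf z hz t (hsub ht))).trans ?_
      rw [norm_div, norm_neg, norm_inv, div_eq_mul_inv]
      have h1 := (hM _ (mem_image_of_mem γ (hsub ht))).trans (le_abs_self M)
      calc 3 / 2 * (‖γ t‖ * ‖z‖⁻¹) ≤ 3 / 2 * (|M| * ‖z‖⁻¹) := by gcongr
        _ = ‖z‖⁻¹ * (3 / 2 * |M|) := by ring
  have hfin := (continuous_exp.tendsto 0).comp hJlim
  rw [exp_zero] at hfin
  refine hfin.congr' ?_
  filter_upwards [hlarge] with z hz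
  have hz0 : z ≠ 0 := by
    rintro rfl
    rw [norm_zero] at hz
    linarith [abs_nonneg M]
  rw [hXJ z hz, Function.comp_apply, mul_div_cancel_left₀ _ hz0]

/-- `exp g` is determined by its logarithmic derivative and its behaviour at infinity. -/
theorem IsAnalyticArc.exp_potential_eq (hγ : IsAnalyticArc γ a b)
    (hm : ∫ t in (0 : ℝ)..1, ρ t * deriv γ t = 1)
    (hint : IntervalIntegrable (fun t => ρ t * deriv γ t) volume 0 1) {Y : ℂ → ℂ}
    (hY : ∀ z ∉ γ '' Icc 0 1,
      HasDerivAt Y (Y z * -cauchyTransform γ (fun t => ρ t * deriv γ t) 0 1 z) z)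
    (hY0 : ∀ z ∉ γ '' Icc 0 1, Y z ≠ 0)
    (hYlim : Tendsto (fun z => Y z / z) (Bornology.cobounded ℂ) (𝓝 1))
    {z g : ℂ} (hz : z ∉ γ '' Icc 0 1) (hg : IsLogPotential γ ρ z g) : exp g = Y z := by
  have hex : ∀ z, z ∉ γ '' Icc 0 1 → ∃ g, IsLogPotential γ ρ z g := fun z hz =>
    exists_isLogPotential hγ.continuousOn hz
  choose! G hG using hex
  have hX : ∀ z ∉ γ '' Icc 0 1, ∃ g, IsLogPotential γ ρ z g ∧ exp (G z) = exp g := fun z hz =>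
    ⟨G z, hG z hz, rfl⟩
  have hd : ∀ z ∈ (γ '' Icc 0 1)ᶜ, HasDerivAt (fun z => exp (G z) / Y z) 0 z := fun z hz => by
    refine ((hγ.hasDerivAt_exp_potential hm hint hX hz).div (hY z hz) (hY0 z hz)).congr_deriv ?_
    rw [div_eq_zero_iff]
    left
    ring
  have hlim : Tendsto (fun z => exp (G z) / Y z) (Bornology.cobounded ℂ) (𝓝 1) := by
    have h1 := (hγ.tendsto_exp_potential_div hm hint hX).div hYlim one_ne_zero
    rw [div_one] at h1
    refine h1.congr' ?_
    filter_upwards [Bornology.isBounded_def.1 (Bornology.isBounded_singleton (x := (0 : ℂ)))]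
      with z hz
    have hz0 : z ≠ 0 := hz
    exact div_div_div_cancel_right₀ hz0 _ _
  have h1 := hγ.eq_of_deriv_eq_zero hd hlim hz
  rw [hg.exp_eq hm hint (hG z hz)]
  exact (div_eq_one_iff_eq (hY0 z hz)).1 h1

end LogPotential

/-! ### Boundary values from the left -/

theorem IsStraightening.eventually_im_pos {γ : ℝ → ℂ} {t₀ δ : ℝ}
    {φ : OpenPartialHomeomorph ℂ ℂ} (h : IsStraightening γ t₀ δ φ) {t : ℝ} (ht : |t - t₀| < δ) :
    ∀ᶠ ε : ℝ in 𝓝[>] 0, γ t + (ε : ℂ) * I * deriv γ t ∈ φ.target ∧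
      0 < (φ.symm (γ t + (ε : ℂ) * I * deriv γ t)).im := by
  have hm : (t : ℂ) ∈ φ.source := by rw [h.source_eq]; exact ofReal_mem_ball.2 ht
  have hφt : φ t = γ t := h.apply_ofReal t ht
  have htar : γ t ∈ φ.target := hφt ▸ φ.map_source hm
  have hsymm : φ.symm (γ t) = t := by rw [← hφt, φ.left_inv hm]
  have hcurve : HasDerivAt (fun ε : ℝ => γ t + (ε : ℂ) * I * deriv γ t) (I * deriv γ t) 0 := by
    have h1 : HasDerivAt (fun ε : ℝ => (ε : ℂ)) 1 0 := ofRealCLM.hasDerivAt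
    simpa using ((h1.mul_const I).mul_const (deriv γ t)).const_add (γ t)
  have hcurve0 : γ t + ((0 : ℝ) : ℂ) * I * deriv γ t = γ t := by simp
  have hd : HasDerivAt φ.symm (deriv φ t)⁻¹ (γ t + ((0 : ℝ) : ℂ) * I * deriv γ t) := by
    rw [hcurve0]
    refine φ.hasDerivAt_symm htar (h.deriv_ne_zero hm) ?_
    rw [hsymm]
    exact (h.differentiableAt hm).hasDerivAt
  have hζ : HasDerivAt (fun ε : ℝ => φ.symm (γ t + (ε : ℂ) * I * deriv γ t)) I 0 := by
    refine (hd.comp (0 : ℝ) hcurve).congr_deriv ?_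
    rw [h.deriv_ofReal ht, mul_comm, mul_assoc, mul_inv_cancel₀ (h.deriv_ne_zero hm), mul_one]
  have him : HasDerivAt (fun ε : ℝ => (φ.symm (γ t + (ε : ℂ) * I * deriv γ t)).im) 1 0 := by
    have h1 := imCLM.hasFDerivAt.comp_hasDerivAt (0 : ℝ) hζ
    rw [imCLM_apply, I_im] at h1
    exact h1
  have hslope := him.tendsto_slope
  have hpos : ∀ᶠ ε : ℝ in 𝓝[>] 0,
      0 < slope (fun ε : ℝ => (φ.symm (γ t + (ε : ℂ) * I * deriv γ t)).im) 0 ε :=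
    (hslope.mono_left (nhdsWithin_mono _ fun ε hε => ne_of_gt hε)).eventually
      (lt_mem_nhds one_pos)
  have hcont : ∀ᶠ ε : ℝ in 𝓝[>] 0, γ t + (ε : ℂ) * I * deriv γ t ∈ φ.target := by
    refine nhdsWithin_le_nhds (hcurve.continuousAt.eventually ?_)
    simp only [hcurve0]
    exact φ.open_target.mem_nhds htar
  filter_upwards [hpos, hcont, self_mem_nhdsWithin] with ε hε htε hε0
  refine ⟨htε, ?_⟩
  rw [slope_def_field] at hε
  simp only [ofReal_zero, zero_mul, add_zero, hsymm, ofReal_im, sub_zero] at hε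
  rwa [div_pos_iff_of_pos_right hε0] at hε

theorem IsStraightening.tendsto_curve {γ : ℝ → ℂ} {t₀ δ : ℝ}
    {φ : OpenPartialHomeomorph ℂ ℂ} (h : IsStraightening γ t₀ δ φ) {t : ℝ} (ht : |t - t₀| < δ) :
    Tendsto (fun ε : ℝ => γ t + (ε : ℂ) * I * deriv γ t) (𝓝[>] 0)
      (𝓝[(γ '' Icc 0 1)ᶜ] (γ t)) := by
  refine tendsto_nhdsWithin_iff.2 ⟨?_, ?_⟩
  · have h1 : Continuous fun ε : ℝ => γ t + (ε : ℂ) * I * deriv γ t := by fun_prop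
    have h2 := (h1.tendsto 0).mono_left (nhdsWithin_le_nhds (s := Ioi 0))
    simpa using h2
  · filter_upwards [h.eventually_im_pos ht] with ε hε
    have := h.map_notMem (φ.map_target hε.1) hε.2.ne'
    rwa [φ.right_inv hε.1] at this

/-- The boundary value from the left is the limit from the upper half plane in a chart. -/
theorem IsStraightening.tendsto_plusValue {γ : ℝ → ℂ} {t₀ δ : ℝ}
    {φ : OpenPartialHomeomorph ℂ ℂ} (h : IsStraightening γ t₀ δ φ) {t : ℝ} (ht : |t - t₀| < δ)
    {f F : ℂ → ℂ} (hF : ContinuousAt F t) (hf : ∀ ζ ∈ φ.source, 0 < ζ.im → f (φ ζ) = F ζ) :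
    Tendsto (fun ε : ℝ => f (γ t + (ε : ℂ) * I * deriv γ t)) (𝓝[>] 0) (𝓝 (F t)) := by
  have hm : (t : ℂ) ∈ φ.source := by rw [h.source_eq]; exact ofReal_mem_ball.2 ht
  have hφt : φ t = γ t := h.apply_ofReal t ht
  have htar : γ t ∈ φ.target := hφt ▸ φ.map_source hm
  have hsymm : φ.symm (γ t) = t := by rw [← hφt, φ.left_inv hm]
  have h1 : ContinuousAt (fun z => F (φ.symm z)) (γ t) :=
    ContinuousAt.comp (by rwa [hsymm]) (φ.symm.continuousAt htar)
  have h2 := h1.tendsto.comp ((h.tendsto_curve ht).mono_right nhdsWithin_le_nhds)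
  rw [hsymm] at h2
  refine h2.congr' ?_
  filter_upwards [h.eventually_im_pos ht] with ε hε
  rw [Function.comp_apply, ← hf _ (φ.map_target hε.1) hε.2, φ.right_inv hε.1]

/-! ### One cut of the three-sheeted surface -/

/-- The part of a sheet structure that concerns one of its two cuts, `γ`: the function `Ψ` has this
cut only, `Φ` has only the other cut `K`, and `Q` lives on the sheet with both cuts.
The number `c = ±1` is the value of `Ψ` at infinity. -/
structure SingleCut (γ : ℝ → ℂ) (K : Set ℂ) (Ψ Q Φ : ℂ → ℂ) (c : ℂ) : Prop where
  arc : ∃ a b, IsAnalyticArc γ a b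
  closed : IsClosed K
  dense : Dense Kᶜ
  disjoint : ∀ z ∈ γ '' Icc 0 1, z ∉ K
  zero_notMem : (0 : ℂ) ∉ γ '' Icc 0 1
  branch : ∀ t ∈ Ioo (0 : ℝ) 1, γ t ^ 4 + γ t ^ 2 + 1 / 3 ≠ 0
  holoΨ : DifferentiableOn ℂ Ψ (γ '' Icc 0 1)ᶜ
  holoQ : DifferentiableOn ℂ Q (γ '' Icc 0 1 ∪ K ∪ {0})ᶜ
  holoΦ : DifferentiableOn ℂ Φ Kᶜ
  cubic : ∀ z ∈ (γ '' Icc 0 1 ∪ K ∪ {0})ᶜ, ∀ w : ℂ,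
    z * w ^ 3 - w ^ 2 - z * w + 1 / 3 = z * (w - Ψ z) * (w - Q z) * (w - Φ z)
  sq_eq : c ^ 2 = 1
  infty : Tendsto Ψ (Bornology.cobounded ℂ) (𝓝 c)

/-- A cubic `z w³ - w² - z w + 1/3` with leading coefficient bounded below has bounded roots. -/
theorem norm_root_le {z w : ℂ} {m : ℝ} (hm : 0 < m) (hz : m ≤ ‖z‖)
    (h : z * w ^ 3 - w ^ 2 - z * w + 1 / 3 = 0) : ‖w‖ ≤ 1 + 2 / m := by
  have h2m : 0 < 2 / m := by positivity
  by_contra! hcon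
  have hw : 1 < ‖w‖ := by linarith
  have h1 : z * (w * (w ^ 2 - 1)) = w ^ 2 - 1 / 3 := by linear_combination h
  have h2 : ‖z‖ * (‖w‖ * ‖w ^ 2 - 1‖) = ‖w ^ 2 - 1 / 3‖ := by
    rw [← norm_mul, ← norm_mul, h1]
  have h3 : ‖w‖ ^ 2 - 1 ≤ ‖w ^ 2 - 1‖ := by
    have := norm_sub_norm_le (w ^ 2) 1
    simpa using this
  have h4 : ‖w ^ 2 - 1 / 3‖ ≤ ‖w‖ ^ 2 + 1 / 3 := by
    have := norm_sub_le (w ^ 2) (1 / 3)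
    simpa using this
  have h5 : m * (‖w‖ * (‖w‖ ^ 2 - 1)) ≤ ‖w‖ ^ 2 + 1 / 3 := by
    refine le_trans ?_ (h2.le.trans h4)
    have : 0 ≤ ‖w‖ ^ 2 - 1 := by nlinarith
    gcongr
  have h6 : 2 < m * (‖w‖ - 1) := by
    have : 2 / m < ‖w‖ - 1 := by linarith
    rw [div_lt_iff₀ hm] at this
    linarith
  have h7 : 2 * (‖w‖ * (‖w‖ + 1)) ≤ ‖w‖ ^ 2 + 1 / 3 := by
    refine le_trans ?_ h5
    have : 0 ≤ ‖w‖ * (‖w‖ + 1) := by positivity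
    nlinarith
  nlinarith

/-- The finite poles `0`, `±1` of `z(w)` are not roots of the cubic for any finite `z`. -/
theorem cube_sub_ne_zero {z w : ℂ} (h : z * w ^ 3 - w ^ 2 - z * w + 1 / 3 = 0) :
    w ^ 3 - w ≠ 0 := by
  intro h0
  have h1 : w ^ 2 = 1 / 3 := by linear_combination z * h0 - h
  have h2 : w = 0 := by linear_combination (3 / 2 * w) * h1 - 3 / 2 * h0
  rw [h2] at h1
  norm_num at h1

/-- The discriminant of `w³ - p w² - w - q`, when these are the coefficients of the monic cubic
proportional to `z w³ - w² - z w + 1/3`. -/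
theorem pow_four_mul_disc {z p q : ℂ} (hp : z * p = 1) (hq : z * q = -1 / 3) :
    z ^ 4 * (p ^ 2 * (-1) ^ 2 - 4 * (-1) ^ 3 - 4 * p ^ 3 * q + 18 * p * (-1) * q - 27 * q ^ 2) =
      4 * (z ^ 4 + z ^ 2 + 1 / 3) := by
  calc _ = z ^ 2 * (z * p) ^ 2 + 4 * z ^ 4 - 4 * (z * p) ^ 3 * (z * q)
        - 18 * z ^ 2 * (z * p) * (z * q) - 27 * z ^ 2 * (z * q) ^ 2 := by ring
    _ = _ := by rw [hp, hq]; ring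

theorem eqOn_zero_of_dense {f : ℂ → ℂ} {U D : Set ℂ} (hU : IsOpen U) (hD : Dense D)
    (hf : ContinuousOn f U) (h : ∀ z ∈ U ∩ D, f z = 0) : ∀ z ∈ U, f z = 0 :=
  EqOn.of_subset_closure (g := fun _ => 0) h hf continuousOn_const inter_subset_left
    (hD.open_subset_closure_inter hU)

namespace SingleCut

variable {γ : ℝ → ℂ} {K : Set ℂ} {Ψ Q Φ : ℂ → ℂ} {c : ℂ}

theorem isClosed_arc (S : SingleCut γ K Ψ Q Φ c) : IsClosed (γ '' Icc 0 1) := by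
  obtain ⟨a, b, h⟩ := S.arc
  exact h.isClosed_image

theorem isBounded_arc (S : SingleCut γ K Ψ Q Φ c) : Bornology.IsBounded (γ '' Icc 0 1) := by
  obtain ⟨a, b, h⟩ := S.arc
  exact h.isCompact_image.isBounded

theorem dense_arc_compl (S : SingleCut γ K Ψ Q Φ c) : Dense (γ '' Icc 0 1)ᶜ := by
  obtain ⟨a, b, h⟩ := S.arc
  exact h.dense_compl

theorem dense_compl_union (S : SingleCut γ K Ψ Q Φ c) :
    Dense (γ '' Icc 0 1 ∪ K ∪ {0})ᶜ := by
  rw [compl_union, compl_union]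
  exact (S.dense_arc_compl.inter_of_isOpen_left S.dense
    S.isClosed_arc.isOpen_compl).inter_of_isOpen_right
    (dense_compl_singleton 0) isOpen_compl_singleton

theorem isOpen_near (S : SingleCut γ K Ψ Q Φ c) : IsOpen (K ∪ {0})ᶜ :=
  (S.closed.union isClosed_singleton).isOpen_compl

theorem arc_subset_near (S : SingleCut γ K Ψ Q Φ c) {z : ℂ} (hz : z ∈ γ '' Icc 0 1) :
    z ∈ (K ∪ {0})ᶜ := by
  rintro (h | h)
  · exact S.disjoint z hz h
  · rw [mem_singleton_iff] at h
    exact S.zero_notMem (h ▸ hz)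

theorem sum_roots (S : SingleCut γ K Ψ Q Φ c) {z : ℂ} (hz : z ∈ (γ '' Icc 0 1 ∪ K ∪ {0})ᶜ) :
    z * (Ψ z + Q z + Φ z) = 1 := by
  have h0 := S.cubic z hz 0
  have h1 := S.cubic z hz 1
  have h2 := S.cubic z hz (-1)
  linear_combination h1 / 2 + h2 / 2 - h0

theorem sum_pairs (S : SingleCut γ K Ψ Q Φ c) {z : ℂ} (hz : z ∈ (γ '' Icc 0 1 ∪ K ∪ {0})ᶜ) :
    Ψ z * Q z + Q z * Φ z + Φ z * Ψ z = -1 := by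
  have hz0 : z ≠ 0 := fun h => hz (Or.inr h)
  have h1 := S.cubic z hz 1
  have h2 := S.cubic z hz (-1)
  refine mul_left_cancel₀ hz0 ?_
  linear_combination h2 / 2 - h1 / 2

theorem root_left (S : SingleCut γ K Ψ Q Φ c) {z : ℂ} (hz : z ∉ γ '' Icc 0 1) :
    z * Ψ z ^ 3 - Ψ z ^ 2 - z * Ψ z + 1 / 3 = 0 := by
  have hc := S.holoΨ.continuousOn
  refine eqOn_zero_of_dense (f := fun z => z * Ψ z ^ 3 - Ψ z ^ 2 - z * Ψ z + 1 / 3)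
    S.isClosed_arc.isOpen_compl S.dense_compl_union (by fun_prop) (fun x hx => ?_) z hz
  rw [S.cubic x hx.2]
  ring

theorem root_other (S : SingleCut γ K Ψ Q Φ c) {z : ℂ} (hz : z ∉ K) :
    z * Φ z ^ 3 - Φ z ^ 2 - z * Φ z + 1 / 3 = 0 := by
  have hc := S.holoΦ.continuousOn
  refine eqOn_zero_of_dense (f := fun z => z * Φ z ^ 3 - Φ z ^ 2 - z * Φ z + 1 / 3)
    S.closed.isOpen_compl S.dense_compl_union (by fun_prop) (fun x hx => ?_) z hz
  rw [S.cubic x hx.2]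
  ring

/-- The roots stay bounded near the cut, since the cut avoids `0`, where the cubic degenerates. -/
theorem exists_bound (S : SingleCut γ K Ψ Q Φ c) : ∃ M : ℝ, ∀ t ∈ Icc (0 : ℝ) 1,
    ∀ᶠ z in 𝓝[(γ '' Icc 0 1)ᶜ] (γ t), ‖Ψ z‖ ≤ M ∧ ‖Q z‖ ≤ M := by
  obtain ⟨m, hm, hball⟩ := Metric.isOpen_iff.1 S.isClosed_arc.isOpen_compl 0 S.zero_notMem
  refine ⟨1 + 2 / (m / 2), fun t ht => ?_⟩
  have hmem : γ t ∈ γ '' Icc 0 1 := mem_image_of_mem γ ht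
  have hnorm : m / 2 < ‖γ t‖ := by
    by_contra! hcon
    refine hball ?_ hmem
    rw [mem_ball_zero_iff]
    linarith
  filter_upwards [self_mem_nhdsWithin,
    nhdsWithin_le_nhds (S.isOpen_near.mem_nhds (S.arc_subset_near hmem)),
    nhdsWithin_le_nhds (continuous_norm.continuousAt.eventually (lt_mem_nhds hnorm))]
    with z hz hzU hzm
  have hz' : z ∈ (γ '' Icc 0 1 ∪ K ∪ {0})ᶜ := by
    rintro ((h | h) | h)
    · exact hz h
    · exact hzU (Or.inl h)
    · exact hzU (Or.inr h)
  refine ⟨norm_root_le (by positivity) hzm.le (S.root_left hz),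
    norm_root_le (by positivity) hzm.le ?_⟩
  rw [S.cubic z hz']
  ring

/-- Near the cut, `Ψ` and `Q` are the roots of a quadratic polynomial with holomorphic coefficients;
off the branch points its discriminant does not vanish and has a holomorphic square root `2d`. -/
theorem exists_local_roots (S : SingleCut γ K Ψ Q Φ c) {t₀ : ℝ} (ht₀ : t₀ ∈ Ioo (0 : ℝ) 1) :
    ∃ V ∈ 𝓝 (γ t₀), ∃ A d : ℂ → ℂ, IsOpen V ∧ DifferentiableOn ℂ A V ∧ DifferentiableOn ℂ d V ∧
      (∀ z ∈ V, d z ≠ 0) ∧ ∀ z ∈ V \ γ '' Icc 0 1, z ∈ (γ '' Icc 0 1 ∪ K ∪ {0})ᶜ ∧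
        Ψ z + Q z = 2 * A z ∧ (Ψ z - A z) ^ 2 = d z ^ 2 := by
  have hmem : γ t₀ ∈ γ '' Icc 0 1 := mem_image_of_mem γ (Ioo_subset_Icc_self ht₀)
  set U : Set ℂ := (K ∪ {0})ᶜ with hU
  have hUK : U ⊆ Kᶜ := compl_subset_compl.2 subset_union_left
  have hU0 : ∀ z ∈ U, z ≠ 0 := fun z hz h0 => hz (Or.inr h0)
  set σ : ℂ → ℂ := fun z => z⁻¹ - Φ z with hσ
  set D : ℂ → ℂ := fun z => σ z ^ 2 + 4 + 4 * Φ z * σ z with hD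
  -- `σ = Ψ + Q` and `D = (Ψ - Q)²`, expressed by `Φ`, which is holomorphic near the cut
  have hΦ := S.holoΦ.mono hUK
  have hσd : DifferentiableOn ℂ σ U :=
    (differentiableOn_id.inv hU0).sub hΦ
  have hDd : DifferentiableOn ℂ D U :=
    ((hσd.pow 2).add_const 4).add ((hΦ.const_mul 4).mul hσd)
  have hzσ : ∀ z ∈ U, z * σ z = 1 - z * Φ z := fun z hz => by
    simp only [hσ]
    rw [mul_sub, mul_inv_cancel₀ (hU0 z hz)]
  have hdisc : ∀ z ∈ U, z ^ 4 * (D z * (Φ z ^ 2 - σ z * Φ z + (-1 - Φ z * σ z)) ^ 2) =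
      4 * (z ^ 4 + z ^ 2 + 1 / 3) := by
    intro z hz
    have e1 : z * (σ z + Φ z) = 1 := by linear_combination hzσ z hz
    have e3 : z * ((-1 - Φ z * σ z) * Φ z) = -1 / 3 := by
      linear_combination S.root_other (hUK hz) - Φ z ^ 2 * hzσ z hz
    have hring : D z * (Φ z ^ 2 - σ z * Φ z + (-1 - Φ z * σ z)) ^ 2 =
        (σ z + Φ z) ^ 2 + 4 - 4 * (σ z + Φ z) ^ 3 * ((-1 - Φ z * σ z) * Φ z)
          - 18 * (σ z + Φ z) * ((-1 - Φ z * σ z) * Φ z)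
          - 27 * ((-1 - Φ z * σ z) * Φ z) ^ 2 := by
      simp only [hD]
      ring
    rw [hring, ← pow_four_mul_disc e1 e3]
    ring
  have hD0 : D (γ t₀) ≠ 0 := by
    intro h0
    have := hdisc _ (S.arc_subset_near hmem)
    rw [h0, zero_mul, mul_zero] at this
    refine S.branch t₀ ht₀ ?_
    linear_combination -this / 4
  obtain ⟨s, hs⟩ := IsAlgClosed.exists_pow_nat_eq (D (γ t₀)) two_pos
  replace hs := hs.symm
  have hs0 : s ≠ 0 := by
    rintro rfl
    exact hD0 (by rw [hs]; simp)
  set V : Set ℂ := U ∩ (fun z => D z / D (γ t₀)) ⁻¹' slitPlane with hV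
  have hVo : IsOpen V :=
    (hDd.continuousOn.div_const _).isOpen_inter_preimage S.isOpen_near isOpen_slitPlane
  refine ⟨V, hVo.mem_nhds ⟨S.arc_subset_near hmem, ?_⟩, fun z => σ z / 2,
    fun z => s / 2 * exp (log (D z / D (γ t₀)) / 2), hVo,
    (hσd.mono inter_subset_left).div_const 2, ?_, fun z _ => ?_, fun z hz => ?_⟩
  · rw [mem_preimage, div_self hD0]
    exact one_mem_slitPlane
  · exact ((((hDd.mono inter_subset_left).div_const _).clog fun z hz => hz.2).div_const
      2).cexp.const_mul _
  · exact mul_ne_zero (div_ne_zero hs0 two_ne_zero) (exp_ne_zero _)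
  · have hz' : z ∈ (γ '' Icc 0 1 ∪ K ∪ {0})ᶜ := by
      rintro ((h | h) | h)
      · exact hz.2 h
      · exact hz.1.1 (Or.inl h)
      · exact hz.1.1 (Or.inr h)
    have h1 := S.sum_roots hz'
    have h2 := S.sum_pairs hz'
    have h3 : Ψ z + Q z = σ z := by
      refine mul_left_cancel₀ (hU0 z hz.1.1) ?_
      rw [hzσ z hz.1.1]
      linear_combination h1
    refine ⟨hz', by rw [h3]; ring, ?_⟩
    have h4 : (s / 2 * exp (log (D z / D (γ t₀)) / 2)) ^ 2 = D z / 4 := by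
      rw [mul_pow, ← exp_nat_mul]
      have : ((2 : ℕ) : ℂ) * (log (D z / D (γ t₀)) / 2) = log (D z / D (γ t₀)) := by
        push_cast; ring
      rw [this, exp_log (slitPlane_ne_zero hz.1.2), div_pow, ← hs]
      field_simp
      ring
    rw [h4]
    simp only [hD]
    rw [← h3]
    linear_combination -h2

/-- On each side of the cut `Ψ` is one of the two local roots `A ± d`; the sign of `d` is normalized
so that `Ψ = A + d` on the left-hand side, and `s` is the sign on the right-hand side. -/
theorem exists_sides (S : SingleCut γ K Ψ Q Φ c) {t₀ : ℝ} (ht₀ : t₀ ∈ Ioo (0 : ℝ) 1) :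
    ∃ δ φ, ∃ A d : ℂ → ℂ, ∃ s : ℂ, (s = 1 ∨ s = -1) ∧
      DifferentiableOn ℂ A φ.source ∧ DifferentiableOn ℂ d φ.source ∧
      HasSides Ψ γ t₀ δ φ (fun ζ => A ζ + d ζ) (fun ζ => A ζ + s * d ζ) ∧
      (∀ ζ ∈ φ.source, d ζ ≠ 0) ∧
      ∀ ζ ∈ φ.source, 0 < ζ.im → Q (φ ζ) = A ζ - d ζ := by
  obtain ⟨a, b, hγ⟩ := S.arc
  obtain ⟨V, hV, A, d, hVo, hA, hd, hd0, hroots⟩ := S.exists_local_roots ht₀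
  obtain ⟨δ, φ, hst, hδ, hφV⟩ := hγ.exists_straightening (Ioo_subset_Icc_self ht₀) hV
    (lt_min ht₀.1 (sub_pos.2 ht₀.2))
  have hmV : ∀ ζ ∈ φ.source, φ ζ ∈ V := fun ζ hζ => hφV (φ.map_source hζ)
  have hsign : ∀ T : Set ℂ, Convex ℝ T → (∀ ζ ∈ T, ζ.im ≠ 0) →
      ∃ s : ℂ, (s = 1 ∨ s = -1) ∧ ∀ ζ ∈ φ.source, ζ ∈ T → Ψ (φ ζ) = A (φ ζ) + s * d (φ ζ) := by
    intro T hT him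
    have hpre : IsPreconnected (φ.source ∩ T) := by
      rw [hst.source_eq]
      exact ((convex_ball _ _).inter hT).isPreconnected
    have hφc : ContinuousOn φ (φ.source ∩ T) := hst.diff.continuousOn.mono inter_subset_left
    have hf : ContinuousOn (fun ζ => Ψ (φ ζ) - A (φ ζ)) (φ.source ∩ T) :=
      (S.holoΨ.continuousOn.comp hφc fun ζ hζ => hst.map_notMem hζ.1 (him ζ hζ.2)).sub
        (hA.continuousOn.comp hφc fun ζ hζ => hmV ζ hζ.1)
    have hg : ContinuousOn (fun ζ => d (φ ζ)) (φ.source ∩ T) :=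
      hd.continuousOn.comp hφc fun ζ hζ => hmV ζ hζ.1
    rcases hpre.eq_or_eq_neg_of_sq_eq hf hg
      (fun ζ hζ => (hroots _ ⟨hmV ζ hζ.1, hst.map_notMem hζ.1 (him ζ hζ.2)⟩).2.2)
      (fun {ζ} hζ => hd0 _ (hmV ζ hζ.1)) with h | h
    · refine ⟨1, Or.inl rfl, fun ζ hζ hζT => ?_⟩
      have := h ⟨hζ, hζT⟩
      simp only at this
      linear_combination this
    · refine ⟨-1, Or.inr rfl, fun ζ hζ hζT => ?_⟩
      have := h ⟨hζ, hζT⟩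
      simp only [Pi.neg_apply] at this
      linear_combination this
  obtain ⟨s₁, hs₁, hup⟩ := hsign {ζ | 0 < ζ.im} (convex_halfSpace_im_gt 0) fun ζ hζ => ne_of_gt hζ
  obtain ⟨s₂, hs₂, hlow⟩ := hsign {ζ | ζ.im < 0} (convex_halfSpace_im_lt 0) fun ζ hζ => ne_of_lt hζ
  have hss : s₁ * s₁ = 1 := by rcases hs₁ with rfl | rfl <;> norm_num
  have hs₁0 : s₁ ≠ 0 := by rcases hs₁ with rfl | rfl <;> norm_num
  have hA' : DifferentiableOn ℂ (fun ζ => A (φ ζ)) φ.source := hA.comp hst.diff hmV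
  have hd' : DifferentiableOn ℂ (fun ζ => s₁ * d (φ ζ)) φ.source :=
    (hd.comp hst.diff hmV).const_mul s₁
  refine ⟨δ, φ, fun ζ => A (φ ζ), fun ζ => s₁ * d (φ ζ), s₁ * s₂, ?_, hA', hd',
    ⟨hst, hδ.trans (min_le_left _ _), hδ.trans (min_le_right _ _), hA'.add hd',
      hA'.add (hd'.const_mul _), fun ζ hζ him => hup ζ hζ him, fun ζ hζ him => ?_⟩, ?_, ?_⟩
  · rcases hs₁ with rfl | rfl <;> rcases hs₂ with rfl | rfl <;> norm_num
  · rw [hlow ζ hζ him]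
    linear_combination (-s₂ * d (φ ζ)) * hss
  · exact fun ζ hζ => mul_ne_zero hs₁0 (hd0 _ (hmV ζ hζ))
  · intro ζ hζ him
    have h1 := (hroots _ ⟨hmV ζ hζ, hst.map_notMem hζ him.ne'⟩).2.1
    have h2 := hup ζ hζ him
    linear_combination h1 - h2

/-- On crossing the cut, `Ψ` is continued by `Q`. Otherwise `Ψ` would extend across the whole cut
and be constant by Liouville's theorem, but `c = ±1` is not a root of the cubic. -/
theorem exists_sides_neg (S : SingleCut γ K Ψ Q Φ c) {t₀ : ℝ} (ht₀ : t₀ ∈ Ioo (0 : ℝ) 1) :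
    ∃ δ φ, ∃ A d : ℂ → ℂ,
      DifferentiableOn ℂ A φ.source ∧ DifferentiableOn ℂ d φ.source ∧
      HasSides Ψ γ t₀ δ φ (fun ζ => A ζ + d ζ) (fun ζ => A ζ - d ζ) ∧
      ∀ ζ ∈ φ.source, 0 < ζ.im → Q (φ ζ) = A ζ - d ζ := by
  obtain ⟨a, b, hγ⟩ := S.arc
  have hdich := extendsAt_all_or_none (E := Ψ) (γ := γ) fun t ht => by
    obtain ⟨δ, φ, A, d, s, hs, -, -, hsides, hd0, -⟩ := S.exists_sides ht
    refine ⟨δ, φ, _, _, hsides, ?_⟩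
    rcases hs with rfl | rfl
    · exact Or.inl fun ζ _ => by simp
    · refine Or.inr fun u hu heq => ?_
      have hm : (u : ℂ) ∈ φ.source := by
        rw [hsides.straight.source_eq]; exact ofReal_mem_ball.2 hu
      refine hd0 u hm ?_
      linear_combination heq / 2
  have hnone : ∀ t ∈ Ioo (0 : ℝ) 1, ¬ ExtendsAt Ψ (γ '' Icc 0 1) (γ t) := by
    refine hdich.resolve_left fun hall => ?_
    obtain ⟨M, hM⟩ := S.exists_bound
    have hext := hγ.extendsAt_of_Ioo S.holoΨ hall fun t ht => by
      have ht' : t ∈ Icc (0 : ℝ) 1 := by rcases ht with rfl | rfl <;> simp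
      obtain ⟨δ, φ, hst, -, -⟩ := hγ.exists_straightening ht' univ_mem (one_pos : (0 : ℝ) < 1)
      refine ⟨δ, φ, hst, tendsto_im_mul_of_bounded (M := M) ?_⟩
      have hφc : ContinuousAt φ (t : ℂ) := (hst.differentiableAt hst.center_mem).continuousAt
      have h2 := eventually_nhdsWithin_iff.1 (hM t ht')
      rw [← hst.apply_center] at h2
      filter_upwards [nhdsWithin_le_nhds (hφc.eventually h2), self_mem_nhdsWithin,
        nhdsWithin_le_nhds (φ.open_source.mem_nhds hst.center_mem)] with ζ hb him hζ
      exact (hb (hst.map_notMem hζ him)).1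
    have hconst := eq_of_extendsAt_of_tendsto S.dense_arc_compl S.isBounded_arc hext S.infty
      S.zero_notMem
    have hroot := S.root_left S.zero_notMem
    rw [hconst] at hroot
    have : (2 / 3 : ℂ) = 0 := by linear_combination -hroot - S.sq_eq
    norm_num at this
  obtain ⟨δ, φ, A, d, s, hs, hA, hd, hsides, -, hQ⟩ := S.exists_sides ht₀
  rcases hs with rfl | rfl
  · exact (hnone t₀ ht₀ (hsides.extendsAt fun ζ _ => by simp)).elim
  · refine ⟨δ, φ, A, d, hA, hd, ?_, hQ⟩
    have e : (fun ζ => A ζ + -1 * d ζ) = fun ζ => A ζ - d ζ := by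
      ext ζ; ring
    rwa [e] at hsides

/-- The jump of `Ψ` across the cut is `Ψ₊ - Q₊`. -/
theorem exists_sides_plusValue (S : SingleCut γ K Ψ Q Φ c) {t₀ : ℝ} (ht₀ : t₀ ∈ Ioo (0 : ℝ) 1) :
    ∃ δ φ, ∃ A B : ℂ → ℂ, HasSides Ψ γ t₀ δ φ A B ∧
      ∀ t : ℝ, |t - t₀| < δ → plusValue (fun z => Q z - Ψ z) γ t = B t - A t := by
  obtain ⟨δ, φ, A, d, hA, hd, hsides, hQ⟩ := S.exists_sides_neg ht₀
  have hst := hsides.straight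
  have hcont : ∀ {f : ℂ → ℂ}, DifferentiableOn ℂ f φ.source → ∀ t : ℝ, |t - t₀| < δ →
      ContinuousAt f t := fun hf t ht => by
    refine (hf.differentiableAt (φ.open_source.mem_nhds ?_)).continuousAt
    rw [hst.source_eq]; exact ofReal_mem_ball.2 ht
  refine ⟨δ, φ, _, _, hsides, fun t ht => ?_⟩
  exact (hst.tendsto_plusValue ht (F := fun ζ => A ζ - d ζ - (A ζ + d ζ))
    (f := fun z => Q z - Ψ z) (hcont ((hA.sub hd).sub (hA.add hd)) t ht) fun ζ hζ him => by
      rw [hQ ζ hζ him, hsides.eq_left ζ hζ him]).limUnder_eq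

theorem exists_norm_plusValue_le (S : SingleCut γ K Ψ Q Φ c) : ∃ M : ℝ, ∀ t ∈ Ioo (0 : ℝ) 1,
    ‖plusValue (fun z => Q z - Ψ z) γ t‖ ≤ 2 * M ∧ ‖plusValue Ψ γ t‖ ≤ M := by
  obtain ⟨M, hM⟩ := S.exists_bound
  refine ⟨M, fun t ht => ?_⟩
  obtain ⟨δ, φ, A, d, hA, hd, hsides, hQ⟩ := S.exists_sides_neg ht
  have hst := hsides.straight
  have ht' : |t - t| < δ := by simpa using hst.pos
  have hcont : ∀ {f : ℂ → ℂ}, DifferentiableOn ℂ f φ.source → ContinuousAt f t := fun hf =>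
    (hf.differentiableAt (φ.open_source.mem_nhds hst.center_mem)).continuousAt
  have hev := (hst.tendsto_curve ht').eventually (hM t (Ioo_subset_Icc_self ht))
  have h1 := hst.tendsto_plusValue ht' (F := fun ζ => A ζ - d ζ - (A ζ + d ζ))
      (f := fun z => Q z - Ψ z)
      (hcont ((hA.sub hd).sub (hA.add hd))) fun ζ hζ him => by
        rw [hQ ζ hζ him, hsides.eq_left ζ hζ him]
  have h2 := hst.tendsto_plusValue ht' (F := fun ζ => A ζ + d ζ) (f := Ψ)
      (hcont (hA.add hd)) hsides.eq_left
  constructor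
  · rw [plusValue, h1.limUnder_eq]
    refine le_of_tendsto h1.norm ?_
    filter_upwards [hev] with ε hε
    exact (norm_sub_le _ _).trans (by linarith [hε.1, hε.2])
  · rw [plusValue, h2.limUnder_eq]
    refine le_of_tendsto h2.norm ?_
    filter_upwards [hev] with ε hε using hε.1

theorem intervalIntegrable_jump (S : SingleCut γ K Ψ Q Φ c) :
    IntervalIntegrable (fun t => plusValue (fun z => Q z - Ψ z) γ t * deriv γ t) volume 0 1 := by
  obtain ⟨a, b, hγ⟩ := S.arc
  obtain ⟨M, hM⟩ := S.exists_norm_plusValue_le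
  refine IntervalIntegrable.mul_continuousOn ?_ (by
    rw [uIcc_of_le zero_le_one]; exact hγ.continuousOn_deriv)
  refine intervalIntegrable_of_continuousOn_Ioo (fun t₀ ht₀ => ?_) fun t ht => (hM t ht).1
  obtain ⟨δ, φ, A, B, hsides, hval⟩ := S.exists_sides_plusValue ht₀
  have hst := hsides.straight
  have hc : ContinuousAt (fun ζ => B ζ - A ζ) (t₀ : ℂ) :=
    ((hsides.diff_right.sub hsides.diff_left).differentiableAt
      (φ.open_source.mem_nhds hst.center_mem)).continuousAt
  have hc' : ContinuousAt (fun t : ℝ => B t - A t) t₀ :=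
    ContinuousAt.comp (f := fun t : ℝ => (t : ℂ)) hc continuous_ofReal.continuousAt
  refine (hc'.congr ?_).continuousWithinAt
  filter_upwards [ball_mem_nhds t₀ hst.pos] with t ht
  rw [mem_ball, Real.dist_eq] at ht
  exact (hval t ht).symm

theorem density_eq : (fun t => arcDensity Q Ψ γ t * deriv γ t) = fun t =>
    3 / (2 * Real.pi * I) * (plusValue (fun z => Q z - Ψ z) γ t * deriv γ t) := by
  ext t
  rw [arcDensity, mul_assoc]

theorem intervalIntegrable_density (S : SingleCut γ K Ψ Q Φ c) :
    IntervalIntegrable (fun t => arcDensity Q Ψ γ t * deriv γ t) volume 0 1 := by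
  rw [density_eq]
  exact S.intervalIntegrable_jump.const_mul _

/-- The Cauchy transform of the measure on the cut is `3 (Ψ - c)`. -/
theorem cauchyTransform_density (S : SingleCut γ K Ψ Q Φ c) {z : ℂ} (hz : z ∉ γ '' Icc 0 1) :
    -cauchyTransform γ (fun t => arcDensity Q Ψ γ t * deriv γ t) 0 1 z = 3 * (Ψ z - c) := by
  obtain ⟨a, b, hγ⟩ := S.arc
  obtain ⟨M, hM⟩ := S.exists_bound
  have hint : IntervalIntegrable
      (fun t => -plusValue (fun z => Q z - Ψ z) γ t * deriv γ t) volume 0 1 := by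
    simpa using S.intervalIntegrable_jump.const_mul (-1)
  have h := hγ.eq_add_cauchyTransform S.holoΨ S.infty (M := M)
    (κ := fun t => -plusValue (fun z => Q z - Ψ z) γ t)
    (fun t ht => (hM t ht).mono fun z hz => hz.1) hint
    (fun t₀ ht₀ => by
      obtain ⟨δ, φ, A, B, hsides, hval⟩ := S.exists_sides_plusValue ht₀
      exact ⟨δ, φ, A, B, hsides, fun t ht => by rw [hval t ht]; ring⟩) hz
  have hrel : cauchyTransform γ (fun t => arcDensity Q Ψ γ t * deriv γ t) 0 1 z =
      -(3 / (2 * Real.pi * I)) * cauchyTransform γ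
        (fun t => -plusValue (fun z => Q z - Ψ z) γ t * deriv γ t) 0 1 z := by
    rw [density_eq, cauchyTransform, cauchyTransform, ← intervalIntegral.integral_const_mul]
    congr 1
    ext t
    ring
  rw [hrel, h]
  have hpi : (2 * Real.pi * I : ℂ) ≠ 0 := two_pi_I_ne_zero
  field_simp
  ring

theorem ne_zero (S : SingleCut γ K Ψ Q Φ c) {z : ℂ} (hz : z ∉ γ '' Icc 0 1) :
    Ψ z ^ 3 - Ψ z ≠ 0 :=
  cube_sub_ne_zero (S.root_left hz)

theorem tendsto_mul_sub (S : SingleCut γ K Ψ Q Φ c) :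
    Tendsto (fun z => 3 * (Ψ z - c) * z) (Bornology.cobounded ℂ) (𝓝 1) := by
  have hc0 : c ≠ 0 := by
    rintro rfl
    simpa using S.sq_eq
  have hden : c * (c + c) ≠ 0 := mul_ne_zero hc0 (by simpa using hc0)
  have hlim : Tendsto (fun z => (3 * Ψ z ^ 2 - 1) / (Ψ z * (Ψ z + c))) (Bornology.cobounded ℂ)
      (𝓝 ((3 * c ^ 2 - 1) / (c * (c + c)))) :=
    (((S.infty.pow 2).const_mul 3).sub_const 1).div (S.infty.mul (S.infty.add_const c)) hden
  have hval : (3 * c ^ 2 - 1) / (c * (c + c)) = 1 := by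
    rw [div_eq_one_iff_eq hden]
    linear_combination S.sq_eq
  rw [hval] at hlim
  refine hlim.congr' ?_
  filter_upwards [Bornology.isBounded_def.1 S.isBounded_arc,
    (S.infty.mul (S.infty.add_const c)).eventually_ne hden] with z hz hne
  rw [div_eq_iff hne]
  linear_combination (-3 : ℂ) * S.root_left hz + 3 * z * Ψ z * S.sq_eq

theorem mass (S : SingleCut γ K Ψ Q Φ c) :
    ∫ t in (0 : ℝ)..1, arcDensity Q Ψ γ t * deriv γ t = 1 := by
  obtain ⟨a, b, hγ⟩ := S.arc
  have h1 := (tendsto_mul_cauchyTransform zero_le_one hγ.continuousOn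
    S.intervalIntegrable_density).neg
  rw [neg_neg] at h1
  refine tendsto_nhds_unique h1 (S.tendsto_mul_sub.congr' ?_)
  filter_upwards [Bornology.isBounded_def.1 S.isBounded_arc] with z hz
  rw [← S.cauchyTransform_density hz]
  ring

/-- The exponential of the logarithmic potential in closed form. With `w = Ψ(z)`, the integral of
`3 (w - c) dz` is `3 (w - c) z - ∫ 3 z dw`, and `3 z` is the logarithmic derivative of
`w³ - w`. -/
theorem exp_potential (S : SingleCut γ K Ψ Q Φ c) {z g : ℂ} (hz : z ∉ γ '' Icc 0 1)
    (hg : IsLogPotential γ (arcDensity Q Ψ γ) z g) :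
    exp g = 2 / 3 / (Ψ z ^ 3 - Ψ z) * exp (3 * (Ψ z - c) * z - 1) := by
  obtain ⟨a, b, hγ⟩ := S.arc
  refine hγ.exp_potential_eq (Y := fun z => 2 / 3 / (Ψ z ^ 3 - Ψ z) * exp (3 * (Ψ z - c) * z - 1))
    S.mass S.intervalIntegrable_density (fun z hz => ?_) (fun z hz => ?_) ?_ hz hg
  · rw [S.cauchyTransform_density hz]
    have hd : HasDerivAt Ψ (deriv Ψ z) z :=
      (S.holoΨ.differentiableAt (S.isClosed_arc.isOpen_compl.mem_nhds hz)).hasDerivAt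
    have hp0 := S.ne_zero hz
    have h1 := (((hd.pow 3).sub hd).inv hp0).const_mul (2 / 3 : ℂ)
    have h2 := ((((hd.sub_const c).const_mul 3).mul (hasDerivAt_id z)).sub_const 1).cexp
    have h3 := h1.mul h2
    refine (h3.congr_of_eventuallyEq (Eventually.of_forall fun x => ?_)).congr_deriv ?_
    · simp [div_eq_mul_inv]
    · have hr : z * (Ψ z ^ 3 - Ψ z) = Ψ z ^ 2 - 1 / 3 := by linear_combination S.root_left hz
      have hq : (Ψ z ^ 3 - Ψ z)⁻¹ * (Ψ z ^ 3 - Ψ z) = 1 := inv_mul_cancel₀ hp0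
      simp only [Pi.sub_apply, Pi.pow_apply, Pi.mul_apply, Pi.inv_apply, id, div_eq_mul_inv,
        ← inv_pow]
      generalize exp (3 * (Ψ z - c) * z - 1) = E at *
      generalize (Ψ z ^ 3 - Ψ z)⁻¹ = q at *
      push_cast
      linear_combination (2 * E * deriv Ψ z * q ^ 2) * hr - (2 * E * z * deriv Ψ z * q) * hq
  · exact mul_ne_zero (div_ne_zero (by norm_num) (S.ne_zero hz)) (exp_ne_zero _)
  · have hden : c ^ 2 - 1 / 3 ≠ 0 := by
      rw [S.sq_eq]; norm_num
    have hlim : Tendsto (fun z => 2 / 3 / (Ψ z ^ 2 - 1 / 3) * exp (3 * (Ψ z - c) * z - 1))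
        (Bornology.cobounded ℂ) (𝓝 (2 / 3 / (c ^ 2 - 1 / 3) * exp (1 - 1))) :=
      (tendsto_const_nhds.div ((S.infty.pow 2).sub_const (1 / 3)) hden).mul
        ((continuous_exp.tendsto _).comp (S.tendsto_mul_sub.sub_const 1))
    have hval : 2 / 3 / (c ^ 2 - 1 / 3) * exp (1 - 1) = 1 := by
      rw [S.sq_eq, sub_self, exp_zero]
      norm_num
    rw [hval] at hlim
    refine hlim.congr' ?_
    filter_upwards [Bornology.isBounded_def.1 S.isBounded_arc,
      Bornology.isBounded_def.1 (Bornology.isBounded_singleton (x := (0 : ℂ)))] with z hz hz0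
    have hz0' : z ≠ 0 := hz0
    have hr : Ψ z ^ 2 - 1 / 3 = z * (Ψ z ^ 3 - Ψ z) := by linear_combination -S.root_left hz
    have hp0 := S.ne_zero hz
    rw [hr, mul_comm z, ← div_div]
    ring

end SingleCut

/-! ### The branch points -/

theorem branchPt_add_twelve (k : ℕ) : branchPt (k + 12) = -branchPt k := by
  have h : exp (2 * Real.pi * I / 24) ^ 12 = -1 := by
    rw [← exp_nat_mul, ← exp_pi_mul_I]
    congr 1
    push_cast
    ring
  rw [branchPt, branchPt, pow_add, h]
  ring

/-- The given branch points are the zeros of the discriminant of the cubic (see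
`pow_four_mul_disc`). -/
theorem quartic_eq (z : ℂ) :
    z ^ 4 + z ^ 2 + 1 / 3 = (z - z1) * (z - z2) * (z - z3) * (z - z4) := by
  set ω := exp (2 * Real.pi * I / 24) with hω
  set r : ℝ := (3 : ℝ) ^ (-(1 / 4) : ℝ) with hr
  have h12 : ω ^ 12 = -1 := by
    rw [hω, ← exp_nat_mul, ← exp_pi_mul_I]
    congr 1
    push_cast
    ring
  have hω2 : ω ^ 2 = (Real.sqrt 3 : ℂ) / 2 + I / 2 := by
    have h1 : ω ^ 2 = exp (((Real.pi / 6 : ℝ) : ℂ) * I) := by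
      rw [hω, ← exp_nat_mul]
      congr 1
      push_cast
      ring
    rw [h1, exp_mul_I, ← ofReal_cos, ← ofReal_sin, Real.cos_pi_div_six, Real.sin_pi_div_six]
    push_cast
    ring
  have h3 : (Real.sqrt 3 : ℂ) ^ 2 = 3 := by
    rw [← ofReal_pow, Real.sq_sqrt (by norm_num)]
    norm_num
  have hω10 : ω ^ 10 = -((Real.sqrt 3 : ℂ) / 2 - I / 2) := by
    have hs : ((Real.sqrt 3 : ℂ) / 2 + I / 2) * ((Real.sqrt 3 : ℂ) / 2 - I / 2) = 1 := by
      linear_combination h3 / 4 - I_sq / 4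
    calc ω ^ 10 = ω ^ 10 * (ω ^ 2 * ((Real.sqrt 3 : ℂ) / 2 - I / 2)) := by
          rw [hω2, hs, mul_one]
      _ = ω ^ 12 * ((Real.sqrt 3 : ℂ) / 2 - I / 2) := by ring
      _ = _ := by rw [h12]; ring
  have hr2 : (r : ℂ) ^ 2 * (Real.sqrt 3 : ℂ) = 1 := by
    rw [← ofReal_pow, ← ofReal_mul, hr, Real.sqrt_eq_rpow, ← Real.rpow_natCast, ← Real.rpow_mul
      (by norm_num), ← Real.rpow_add (by norm_num)]
    norm_num
  have hr4 : (r : ℂ) ^ 4 = 1 / 3 := by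
    have : (r : ℂ) ^ 4 * 3 = 1 := by
      calc (r : ℂ) ^ 4 * 3 = ((r : ℂ) ^ 2 * (Real.sqrt 3 : ℂ)) ^ 2 := by rw [← h3]; ring
        _ = 1 := by rw [hr2, one_pow]
    linear_combination this / 3
  have e1 : z3 = -z1 := branchPt_add_twelve 7
  have e2 : z2 = -z4 := branchPt_add_twelve 5
  have e3 : z1 ^ 2 = -(r : ℂ) ^ 2 * ω ^ 2 := by
    calc z1 ^ 2 = ((r : ℂ) * ω ^ 7) ^ 2 := rfl
      _ = (r : ℂ) ^ 2 * ω ^ 12 * ω ^ 2 := by ring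
      _ = _ := by rw [h12]; ring
  have e4 : z4 ^ 2 = (r : ℂ) ^ 2 * ω ^ 10 := by
    calc z4 ^ 2 = ((r : ℂ) * ω ^ 5) ^ 2 := rfl
      _ = _ := by ring
  have e5 : z1 ^ 2 + z4 ^ 2 = -1 := by
    rw [e3, e4, hω2, hω10]
    linear_combination -hr2
  have e6 : z1 ^ 2 * z4 ^ 2 = 1 / 3 := by
    calc z1 ^ 2 * z4 ^ 2 = -((r : ℂ) ^ 4 * ω ^ 12) := by rw [e3, e4]; ring
      _ = _ := by rw [h12, hr4]; ring
  rw [e1, e2]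
  linear_combination -e6 + z ^ 2 * e5

/-! ### The square root at infinity -/

/-- The exterior of a disc is the image of a half plane under `exp`. -/
theorem isPreconnected_lt_norm {R : ℝ} (hR : 0 < R) : IsPreconnected {w : ℂ | R < ‖w‖} := by
  have h : {w : ℂ | R < ‖w‖} = exp '' {u : ℂ | Real.log R < u.re} := by
    ext w
    constructor
    · intro hw
      have hw' : R < ‖w‖ := hw
      have hw0 : w ≠ 0 := norm_pos_iff.1 (hR.trans hw')
      refine ⟨log w, ?_, exp_log hw0⟩
      change Real.log R < (log w).re
      rw [log_re]
      exact Real.log_lt_log hR hw'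
    · rintro ⟨u, hu, rfl⟩
      change R < ‖exp u‖
      rw [norm_exp]
      exact (Real.log_lt_iff_lt_exp hR).1 hu
  rw [h]
  exact (convex_halfSpace_re_gt _).isPreconnected.image _ continuous_exp.continuousOn

/-- Outside a disc, a continuous branch of `√(3w⁴ + 1) / w²` is, up to a constant sign, the
principal square root of `3 + w⁻⁴`. -/
theorem exists_tendsto_sqrt_div_sq {r : ℂ → ℂ} {B : Set ℂ} (hB : Bornology.IsBounded B)
    (hr : ContinuousOn r Bᶜ) (hsq : ∀ w ∈ Bᶜ, r w ^ 2 = 3 * w ^ 4 + 1) :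
    ∃ L : ℂ, L ≠ 0 ∧ Tendsto (fun w => r w / w ^ 2) (Bornology.cobounded ℂ) (𝓝 L) := by
  obtain ⟨R₀, hR₀⟩ := hB.exists_norm_le
  set R := max R₀ 1 with hR
  have hRpos : 0 < R := one_pos.trans_le (le_max_right _ _)
  set T : Set ℂ := {w | R < ‖w‖} with hT
  have hTB : T ⊆ Bᶜ := fun w hw hwB =>
    absurd ((hR₀ w hwB).trans (le_max_left R₀ 1)) (not_le.2 hw)
  have hT0 : ∀ w ∈ T, w ≠ 0 := fun w hw => norm_pos_iff.1 (hRpos.trans hw)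
  have hslit : ∀ w ∈ T, 3 + (w ^ 4)⁻¹ ∈ slitPlane := by
    intro w hw
    left
    have hw1 : 1 < ‖w‖ := (le_max_right R₀ 1).trans_lt hw
    have h1 : ‖(w ^ 4)⁻¹‖ ≤ 1 := by
      rw [norm_inv, norm_pow]
      exact inv_le_one_of_one_le₀ (one_le_pow₀ hw1.le)
    have h2 := (abs_le.1 ((abs_re_le_norm _).trans h1)).1
    have h3 : (3 + (w ^ 4)⁻¹).re = 3 + ((w ^ 4)⁻¹).re := by simp
    rw [h3]
    linarith
  have hinv : ContinuousOn (fun w : ℂ => 3 + (w ^ 4)⁻¹) T :=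
    continuousOn_const.add ((continuousOn_id.pow 4).inv₀ fun w hw => pow_ne_zero 4 (hT0 w hw))
  have hg : ContinuousOn (fun w : ℂ => exp (log (3 + (w ^ 4)⁻¹) / 2)) T :=
    ((hinv.clog hslit).div_const 2).cexp
  have hf : ContinuousOn (fun w => r w / w ^ 2) T :=
    (hr.mono hTB).div (continuousOn_id.pow 2) fun w hw => pow_ne_zero 2 (hT0 w hw)
  have hlim : Tendsto (fun w : ℂ => exp (log (3 + (w ^ 4)⁻¹) / 2)) (Bornology.cobounded ℂ)
      (𝓝 (exp (log (3 + 0 ^ 4) / 2))) := by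
    have h1 : Tendsto (fun w : ℂ => (3 : ℂ) + (w ^ 4)⁻¹) (Bornology.cobounded ℂ)
        (𝓝 (3 + 0 ^ 4)) := by
      simp_rw [← inv_pow]
      exact (tendsto_inv₀_cobounded.pow 4).const_add 3
    refine (continuous_exp.tendsto _).comp ((h1.clog ?_).div_const 2)
    left
    norm_num
  have hTmem : T ∈ Bornology.cobounded ℂ :=
    tendsto_norm_cobounded_atTop.eventually (eventually_gt_atTop R)
  have hfg : ∀ w ∈ T, (r w / w ^ 2) ^ 2 = exp (log (3 + (w ^ 4)⁻¹) / 2) ^ 2 := by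
    intro w hw
    have := hT0 w hw
    have h2 : ((2 : ℕ) : ℂ) * (log (3 + (w ^ 4)⁻¹) / 2) = log (3 + (w ^ 4)⁻¹) := by
      push_cast; ring
    rw [← exp_nat_mul, h2, exp_log (slitPlane_ne_zero (hslit w hw)), div_pow, hsq w (hTB hw)]
    field_simp
  rcases (isPreconnected_lt_norm hRpos).eq_or_eq_neg_of_sq_eq hf hg hfg
    (fun _ => exp_ne_zero _) with h | h
  · exact ⟨_, exp_ne_zero _, hlim.congr' ((EqOn.eventuallyEq_of_mem h hTmem).symm)⟩
  · exact ⟨_, neg_ne_zero.2 (exp_ne_zero _),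
      hlim.neg.congr' ((EqOn.eventuallyEq_of_mem h hTmem).symm)⟩

namespace SheetStructure

variable (S : SheetStructure)

/-! ### The two cuts of a sheet structure -/

theorem re_neg {z : ℂ} (hz : z ∈ S.ΓP) : z.re < 0 := by
  obtain ⟨t, ht, rfl⟩ := hz
  exact S.leftP t ht

theorem re_pos {z : ℂ} (hz : z ∈ S.ΓR) : 0 < z.re := by
  obtain ⟨t, ht, rfl⟩ := hz
  exact S.rightR t ht

theorem z1_mem : z1 ∈ S.ΓP := ⟨0, left_mem_Icc.2 zero_le_one, S.arcP.source⟩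

theorem z2_mem : z2 ∈ S.ΓP := ⟨1, right_mem_Icc.2 zero_le_one, S.arcP.target⟩

theorem z3_mem : z3 ∈ S.ΓR := ⟨0, left_mem_Icc.2 zero_le_one, S.arcR.source⟩

theorem z4_mem : z4 ∈ S.ΓR := ⟨1, right_mem_Icc.2 zero_le_one, S.arcR.target⟩

theorem quartic_ne_zero {z : ℂ} (hz : z ∈ (S.ΓP ∪ S.ΓR)ᶜ) : z ^ 4 + z ^ 2 + 1 / 3 ≠ 0 := by
  have hne : ∀ x ∈ S.ΓP ∪ S.ΓR, z - x ≠ 0 := fun x hx h0 => hz (sub_eq_zero.1 h0 ▸ hx)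
  rw [quartic_eq]
  exact mul_ne_zero (mul_ne_zero (mul_ne_zero (hne _ (Or.inl S.z1_mem)) (hne _ (Or.inl S.z2_mem)))
    (hne _ (Or.inr S.z3_mem))) (hne _ (Or.inr S.z4_mem))

theorem cutP : SingleCut S.γP S.ΓR S.ψP S.ψQ S.ψR (-1) where
  arc := ⟨_, _, S.arcP⟩
  closed := S.arcR.isClosed_image
  dense := S.arcR.dense_compl
  disjoint z hz hz' := (S.re_neg hz).not_gt (S.re_pos hz')
  zero_notMem h := by simpa using S.re_neg h
  branch t ht h0 := by
    have hre := S.leftP t (Ioo_subset_Icc_self ht)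
    rw [quartic_eq, ← S.arcP.source, ← S.arcP.target] at h0
    rcases mul_eq_zero.1 h0 with h0 | h0
    · rcases mul_eq_zero.1 h0 with h0 | h0
      · rcases mul_eq_zero.1 h0 with h0 | h0
        · exact ht.1.ne' (S.arcP.injOn (Ioo_subset_Icc_self ht) (left_mem_Icc.2 zero_le_one)
            (sub_eq_zero.1 h0))
        · exact ht.2.ne (S.arcP.injOn (Ioo_subset_Icc_self ht) (right_mem_Icc.2 zero_le_one)
            (sub_eq_zero.1 h0))
      · exact hre.not_gt (sub_eq_zero.1 h0 ▸ S.re_pos S.z3_mem)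
    · exact hre.not_gt (sub_eq_zero.1 h0 ▸ S.re_pos S.z4_mem)
  holoΨ := S.holoP
  holoQ := S.holoQ
  holoΦ := S.holoR
  cubic := S.cubic
  sq_eq := by norm_num
  infty := S.inftyP

theorem cutR : SingleCut S.γR S.ΓP S.ψR S.ψQ S.ψP 1 where
  arc := ⟨_, _, S.arcR⟩
  closed := S.arcP.isClosed_image
  dense := S.arcP.dense_compl
  disjoint z hz hz' := (S.re_neg hz').not_gt (S.re_pos hz)
  zero_notMem h := by simpa using S.re_pos h
  branch t ht h0 := by
    have hre := S.rightR t (Ioo_subset_Icc_self ht)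
    rw [quartic_eq, ← S.arcR.source, ← S.arcR.target] at h0
    rcases mul_eq_zero.1 h0 with h0 | h0
    · rcases mul_eq_zero.1 h0 with h0 | h0
      · rcases mul_eq_zero.1 h0 with h0 | h0
        · exact hre.not_gt (sub_eq_zero.1 h0 ▸ S.re_neg S.z1_mem)
        · exact hre.not_gt (sub_eq_zero.1 h0 ▸ S.re_neg S.z2_mem)
      · exact ht.1.ne' (S.arcR.injOn (Ioo_subset_Icc_self ht) (left_mem_Icc.2 zero_le_one)
          (sub_eq_zero.1 h0))
    · exact ht.2.ne (S.arcR.injOn (Ioo_subset_Icc_self ht) (right_mem_Icc.2 zero_le_one)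
        (sub_eq_zero.1 h0))
  holoΨ := S.holoR
  holoQ := by rw [union_comm (S.γR '' _)]; exact S.holoQ
  holoΦ := S.holoP
  cubic z hz w := by
    rw [union_comm (S.γR '' _)] at hz
    rw [S.cubic z hz w]
    ring
  sq_eq := by norm_num
  infty := S.inftyR

/-! ### Disjointness of the images of the sheets -/

/-- The discriminant of the cubic in terms of `ψ_P` and `ψ_R`, which are finite at `z = 0`. -/
theorem disc_eq {z : ℂ} (hz : z ∈ (S.ΓP ∪ S.ΓR)ᶜ) :
    (2 * z * S.ψP z + z * S.ψR z - 1) ^ 2 * (2 * z * S.ψR z + z * S.ψP z - 1) ^ 2 *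
      (S.ψP z - S.ψR z) ^ 2 = 4 * (z ^ 4 + z ^ 2 + 1 / 3) := by
  have hopen : IsOpen (S.ΓP ∪ S.ΓR)ᶜ :=
    (S.arcP.isClosed_image.union S.arcR.isClosed_image).isOpen_compl
  have hP : ContinuousOn S.ψP (S.ΓP ∪ S.ΓR)ᶜ :=
    S.holoP.continuousOn.mono (compl_subset_compl.2 subset_union_left)
  have hR : ContinuousOn S.ψR (S.ΓP ∪ S.ΓR)ᶜ :=
    S.holoR.continuousOn.mono (compl_subset_compl.2 subset_union_right)
  refine sub_eq_zero.1 (eqOn_zero_of_dense (f := fun z =>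
    (2 * z * S.ψP z + z * S.ψR z - 1) ^ 2 * (2 * z * S.ψR z + z * S.ψP z - 1) ^ 2 *
      (S.ψP z - S.ψR z) ^ 2 - 4 * (z ^ 4 + z ^ 2 + 1 / 3))
    hopen S.cutP.dense_compl_union (by fun_prop) (fun x hx => ?_) z hz)
  have h1 := S.cutP.sum_roots hx.2
  have h2 := S.cutP.sum_pairs hx.2
  have h3 : x * (S.ψP x * S.ψQ x * S.ψR x) = -1 / 3 := by
    linear_combination S.cutP.cubic x hx.2 0
  have e1 : 2 * x * S.ψP x + x * S.ψR x - 1 = x * (S.ψP x - S.ψQ x) := by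
    linear_combination h1
  have e2 : 2 * x * S.ψR x + x * S.ψP x - 1 = x * (S.ψR x - S.ψQ x) := by
    linear_combination h1
  rw [e1, e2, sub_eq_zero, ← pow_four_mul_disc h1 h3, ← h2]
  ring

theorem ψP_ne_ψR {z : ℂ} (hz : z ∈ (S.ΓP ∪ S.ΓR)ᶜ) : S.ψP z ≠ S.ψR z := by
  intro h
  have := S.disc_eq hz
  rw [sub_eq_zero.2 h] at this
  refine S.quartic_ne_zero hz ?_
  linear_combination -this / 4

theorem mem_compl {z : ℂ} (hz : z ∈ (S.ΓP ∪ S.ΓR)ᶜ) (hz0 : z ≠ 0) :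
    z ∈ (S.ΓP ∪ S.ΓR ∪ {0})ᶜ := by
  rintro (h | h)
  · exact hz h
  · exact hz0 h

theorem ψP_ne_ψQ {z : ℂ} (hz : z ∈ (S.ΓP ∪ S.ΓR)ᶜ) (hz0 : z ≠ 0) : S.ψP z ≠ S.ψQ z := by
  intro h
  have h1 := S.cutP.sum_roots (S.mem_compl hz hz0)
  have e1 : 2 * z * S.ψP z + z * S.ψR z - 1 = 0 := by
    rw [← h] at h1
    linear_combination h1
  have := S.disc_eq hz
  rw [e1] at this
  refine S.quartic_ne_zero hz ?_
  linear_combination -this / 4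

theorem ψR_ne_ψQ {z : ℂ} (hz : z ∈ (S.ΓP ∪ S.ΓR)ᶜ) (hz0 : z ≠ 0) : S.ψR z ≠ S.ψQ z := by
  intro h
  have h1 := S.cutP.sum_roots (S.mem_compl hz hz0)
  have e1 : 2 * z * S.ψR z + z * S.ψP z - 1 = 0 := by
    rw [← h] at h1
    linear_combination h1
  have := S.disc_eq hz
  rw [e1] at this
  refine S.quartic_ne_zero hz ?_
  linear_combination -this / 4

theorem root_ψQ {z : ℂ} (hz : z ∈ (S.ΓP ∪ S.ΓR ∪ {0})ᶜ) :
    z * S.ψQ z ^ 3 - S.ψQ z ^ 2 - z * S.ψQ z + 1 / 3 = 0 := by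
  rw [S.cubic z hz]
  ring

/-- A value `w` of the inverse function determines the point `z = z(w)`. -/
theorem eq_of_roots {z x w : ℂ} (hw : w ^ 3 - w ≠ 0)
    (h1 : z * w ^ 3 - w ^ 2 - z * w + 1 / 3 = 0) (h2 : x * w ^ 3 - w ^ 2 - x * w + 1 / 3 = 0) :
    z = x := by
  refine mul_right_cancel₀ hw ?_
  linear_combination h1 - h2

theorem G_ψP {z : ℂ} (hz : z ∈ (S.ΓP ∪ S.ΓR)ᶜ) :
    S.G (S.ψP z) = 1 / S.ψP z *
      exp ((S.ψP z + 1) * (2 * S.ψP z - 1) / (S.ψP z * (S.ψP z - 1))) := by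
  have hmem : S.ψP z ∈ S.imageP := Or.inr ⟨z, fun h => hz (Or.inl h), rfl⟩
  rw [G, if_pos hmem]

theorem G_ψQ {z : ℂ} (hz : z ∈ (S.ΓP ∪ S.ΓR)ᶜ) (hz0 : z ≠ 0) :
    S.G (S.ψQ z) = (S.ψQ z ^ 2 - 1) / (S.ψQ z ^ 2 - 1 / 3) *
      exp (2 * S.ψQ z ^ 2 / (S.ψQ z ^ 2 - 1)) := by
  have hz' := S.mem_compl hz hz0
  have hroot := S.root_ψQ hz'
  have hne := cube_sub_ne_zero hroot
  have hnotP : S.ψQ z ∉ S.imageP := by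
    rintro (h | ⟨x, hx, h⟩)
    · exact hne (by rw [h]; norm_num)
    · have hx' := S.cutP.root_left hx
      rw [h] at hx'
      rw [← eq_of_roots hne hroot hx'] at h
      exact S.ψP_ne_ψQ hz hz0 h
  have hmem : S.ψQ z ∈ S.imageQ := Or.inr ⟨z, hz', rfl⟩
  rw [G, if_neg hnotP, if_pos hmem]

theorem G_ψR {z : ℂ} (hz : z ∈ (S.ΓP ∪ S.ΓR)ᶜ) :
    S.G (S.ψR z) = 1 / S.ψR z *
      exp ((S.ψR z - 1) * (2 * S.ψR z + 1) / (S.ψR z * (S.ψR z + 1))) := by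
  have hzR : z ∉ S.ΓR := fun h => hz (Or.inr h)
  have hroot := S.cutR.root_left hzR
  have hne := cube_sub_ne_zero hroot
  have hnotP : S.ψR z ∉ S.imageP := by
    rintro (h | ⟨x, hx, h⟩)
    · exact hne (by rw [h]; norm_num)
    · have hx' := S.cutP.root_left hx
      rw [h] at hx'
      rw [← eq_of_roots hne hroot hx'] at h
      exact S.ψP_ne_ψR hz h
  have hnotQ : S.ψR z ∉ S.imageQ := by
    rintro (h | ⟨x, hx, h⟩)
    · exact hne (by rw [h]; norm_num)
    · have hx' := S.root_ψQ hx
      rw [h] at hx'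
      rw [← eq_of_roots hne hroot hx'] at h hx
      exact S.ψR_ne_ψQ hz (fun h0 => hx (Or.inr h0)) h.symm
  have hmem : S.ψR z ∈ S.imageR := Or.inr ⟨z, hzR, rfl⟩
  rw [G, if_neg hnotP, if_neg hnotQ, if_pos hmem]

/-! ### The entries of the second row -/

theorem F_one (r : ℂ → ℂ) (w : ℂ) : S.F r 1 w = (w ^ 2 - 1) * S.G w / (3 * r w) := rfl

theorem F_one_ψP (r : ℂ → ℂ) {z g : ℂ} (hz : z ∈ (S.ΓP ∪ S.ΓR)ᶜ) (hg : S.IsGP z g) :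
    S.F r 1 (S.ψP z) = (S.ψP z ^ 2 - 1) ^ 2 * exp g / (2 * r (S.ψP z)) := by
  have hzP : z ∉ S.ΓP := fun h => hz (Or.inl h)
  have hroot := S.cutP.root_left hzP
  have hne := cube_sub_ne_zero hroot
  rw [F_one, S.G_ψP hz, S.cutP.exp_potential hzP hg]
  generalize S.ψP z = w at *
  have h0 : w ≠ 0 := by rintro rfl; norm_num at hne
  have h1 : w - 1 ≠ 0 := fun h => hne (by rw [sub_eq_zero.1 h]; norm_num)
  have h2 : w + 1 ≠ 0 := fun h => hne (by rw [eq_neg_of_add_eq_zero_left h]; norm_num)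
  have hexp : (w + 1) * (2 * w - 1) / (w * (w - 1)) = 3 * (w - -1) * z - 1 := by
    rw [div_eq_iff (mul_ne_zero h0 h1)]
    linear_combination -3 * hroot
  rw [hexp]
  have hfac : w ^ 3 - w = w * (w ^ 2 - 1) := by ring
  have h3 : w ^ 2 - 1 ≠ 0 := fun h => hne (by rw [hfac, h, mul_zero])
  rw [hfac]
  generalize exp (3 * (w - -1) * z - 1) = E
  -- `r w` is a denominator on both sides, so that a zero of it does no harm
  rcases eq_or_ne (r w) 0 with hr | hr
  · simp [hr]
  · field_simp

theorem F_one_ψR (r : ℂ → ℂ) {z g : ℂ} (hz : z ∈ (S.ΓP ∪ S.ΓR)ᶜ) (hg : S.IsGR z g) :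
    S.F r 1 (S.ψR z) = (S.ψR z ^ 2 - 1) ^ 2 * exp g / (2 * r (S.ψR z)) := by
  have hzR : z ∉ S.ΓR := fun h => hz (Or.inr h)
  have hroot := S.cutR.root_left hzR
  have hne := cube_sub_ne_zero hroot
  rw [F_one, S.G_ψR hz, S.cutR.exp_potential hzR hg]
  generalize S.ψR z = w at *
  have h0 : w ≠ 0 := by rintro rfl; norm_num at hne
  have h2 : w + 1 ≠ 0 := fun h => hne (by rw [eq_neg_of_add_eq_zero_left h]; norm_num)
  have hexp : (w - 1) * (2 * w + 1) / (w * (w + 1)) = 3 * (w - 1) * z - 1 := by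
    rw [div_eq_iff (mul_ne_zero h0 h2)]
    linear_combination -3 * hroot
  rw [hexp]
  have hfac : w ^ 3 - w = w * (w ^ 2 - 1) := by ring
  have h3 : w ^ 2 - 1 ≠ 0 := fun h => hne (by rw [hfac, h, mul_zero])
  rw [hfac]
  generalize exp (3 * (w - 1) * z - 1) = E
  -- `r w` is a denominator on both sides, so that a zero of it does no harm
  rcases eq_or_ne (r w) 0 with hr | hr
  · simp [hr]
  · field_simp

/-- The potential of `μ_A` in closed form, by the relations between roots and coefficients of the
cubic. -/
theorem exp_neg_gA {z g : ℂ} (hz : z ∈ (S.ΓP ∪ S.ΓR)ᶜ) (hz0 : z ≠ 0) (hg : S.IsGA z g) :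
    z ^ 2 * exp (-g) * (3 * (S.ψQ z ^ 2 - 1 / 3)) =
      -exp (2 * S.ψQ z ^ 2 / (S.ψQ z ^ 2 - 1)) := by
  obtain ⟨a, b, ha, hb, rfl⟩ := hg
  have hz' := S.mem_compl hz hz0
  have hzP : z ∉ S.ΓP := fun h => hz (Or.inl h)
  have hzR : z ∉ S.ΓR := fun h => hz (Or.inr h)
  have hPne := S.cutP.ne_zero hzP
  have hRne := S.cutR.ne_zero hzR
  have hroot := S.root_ψQ hz'
  have hQne := cube_sub_ne_zero hroot
  have hsum := S.cutP.sum_roots hz'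
  have c0 := S.cubic z hz' 0
  have c1 := S.cubic z hz' 1
  have c2 := S.cubic z hz' (-1)
  have ea := S.cutP.exp_potential hzP ha
  have eb := S.cutR.exp_potential hzR hb
  generalize S.ψP z = p at *
  generalize S.ψR z = q at *
  generalize S.ψQ z = w at *
  have hfac : w ^ 3 - w = w * (w ^ 2 - 1) := by ring
  have hw : w ^ 2 - 1 ≠ 0 := fun h => hQne (by rw [hfac, h, mul_zero])
  have hexp : 2 * w ^ 2 / (w ^ 2 - 1) = -(3 * (p - -1) * z - 1) + -(3 * (q - 1) * z - 1) := by
    rw [div_eq_iff hw]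
    linear_combination (3 * (w ^ 2 - 1)) * hsum - 3 * hroot
  have hprod : z ^ 3 * ((p ^ 3 - p) * (q ^ 3 - q) * (w ^ 3 - w)) = -4 / 27 := by
    have d0 : z * (p * w * q) = -1 / 3 := by linear_combination c0
    have d1 : z * ((p - 1) * (w - 1) * (q - 1)) = 2 / 3 := by linear_combination c1
    have d2 : z * ((p + 1) * (w + 1) * (q + 1)) = 2 / 3 := by linear_combination c2
    calc _ = (z * (p * w * q)) * (z * ((p - 1) * (w - 1) * (q - 1))) *
          (z * ((p + 1) * (w + 1) * (q + 1))) := by ring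
      _ = _ := by rw [d0, d1, d2]; norm_num
  have hz3 : w ^ 2 - 1 / 3 = z * (w ^ 3 - w) := by linear_combination -hroot
  rw [hexp, neg_add, exp_add, exp_neg, exp_neg, exp_add, exp_neg, exp_neg, ea, eb, hz3]
  have hEp := exp_ne_zero (3 * (p - -1) * z - 1)
  have hEq := exp_ne_zero (3 * (q - 1) * z - 1)
  generalize exp (3 * (p - -1) * z - 1) = E at *
  generalize exp (3 * (q - 1) * z - 1) = E' at *
  rw [mul_inv, mul_inv, inv_div, inv_div]
  linear_combination (27 / 4 * E⁻¹ * E'⁻¹) * hprod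

theorem F_one_ψQ (r : ℂ → ℂ) {z g : ℂ} (hz : z ∈ (S.ΓP ∪ S.ΓR)ᶜ) (hz0 : z ≠ 0)
    (hg : S.IsGA z g) :
    S.F r 1 (S.ψQ z) = -(z ^ 2 * (S.ψQ z ^ 2 - 1) ^ 2 * exp (-g) / r (S.ψQ z)) := by
  have hroot := S.root_ψQ (S.mem_compl hz hz0)
  have hne := cube_sub_ne_zero hroot
  have h := S.exp_neg_gA hz hz0 hg
  rw [F_one, S.G_ψQ hz hz0]
  generalize S.ψQ z = w at *
  have hz3 : w ^ 2 - 1 / 3 = z * (w ^ 3 - w) := by linear_combination -hroot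
  have hw : w ^ 2 - 1 / 3 ≠ 0 := by rw [hz3]; exact mul_ne_zero hz0 hne
  have h' : exp (2 * w ^ 2 / (w ^ 2 - 1)) = -(z ^ 2 * exp (-g) * (3 * (w ^ 2 - 1 / 3))) := by
    rw [h, neg_neg]
  rw [h']
  generalize w ^ 2 - 1 / 3 = v at *
  -- `r w` is a denominator on both sides, so that a zero of it does no harm
  rcases eq_or_ne (r w) 0 with hr | hr
  · simp [hr]
  · field_simp

/-! ### The pole of `ψ_Q` -/

theorem compl_mem_nhds_zero : (S.ΓP ∪ S.ΓR)ᶜ ∈ 𝓝 (0 : ℂ) := by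
  refine (S.arcP.isClosed_image.union S.arcR.isClosed_image).isOpen_compl.mem_nhds ?_
  rintro (h | h)
  · exact S.cutP.zero_notMem h
  · exact S.cutR.zero_notMem h

theorem tendsto_ψQ_zero : Tendsto S.ψQ (𝓝[≠] 0) (Bornology.cobounded ℂ) := by
  have hP : ContinuousAt S.ψP 0 := (S.holoP.differentiableAt
    (S.arcP.isClosed_image.isOpen_compl.mem_nhds S.cutP.zero_notMem)).continuousAt
  have hR : ContinuousAt S.ψR 0 := (S.holoR.differentiableAt
    (S.arcR.isClosed_image.isOpen_compl.mem_nhds S.cutR.zero_notMem)).continuousAt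
  have hc : ContinuousAt (fun z => 1 - z * (S.ψP z + S.ψR z)) 0 :=
    continuousAt_const.sub (continuousAt_id.mul (hP.add hR))
  have h1 : Tendsto (fun z => 1 - z * (S.ψP z + S.ψR z)) (𝓝[≠] 0) (𝓝 1) := by
    have := hc.tendsto.mono_left (nhdsWithin_le_nhds (s := {(0 : ℂ)}ᶜ))
    simpa using this
  have h2 : Tendsto (fun z : ℂ => ‖z⁻¹‖) (𝓝[≠] 0) atTop :=
    tendsto_norm_cobounded_atTop.comp tendsto_inv₀_nhdsNE_zero
  have h3 := h1.norm.pos_mul_atTop (by simp) h2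
  rw [← tendsto_norm_atTop_iff_cobounded]
  refine h3.congr' ?_
  filter_upwards [self_mem_nhdsWithin, nhdsWithin_le_nhds S.compl_mem_nhds_zero] with z hz0 hz
  have hz0' : z ≠ 0 := hz0
  have hsum := S.cutP.sum_roots (S.mem_compl hz hz0')
  rw [← norm_mul]
  congr 1
  rw [← div_eq_mul_inv, div_eq_iff hz0']
  linear_combination -hsum

theorem isBounded_cuts : Bornology.IsBounded
    (plusValue S.ψP S.γP '' Icc 0 1 ∪ plusValue S.ψR S.γR '' Icc 0 1) := by
  have key : ∀ {γ : ℝ → ℂ} {K : Set ℂ} {Ψ Q Φ : ℂ → ℂ} {c : ℂ}, SingleCut γ K Ψ Q Φ c →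
      Bornology.IsBounded (plusValue Ψ γ '' Icc 0 1) := by
    intro γ K Ψ Q Φ c h
    obtain ⟨M, hM⟩ := h.exists_norm_plusValue_le
    have h1 : Bornology.IsBounded (plusValue Ψ γ '' Ioo 0 1) := by
      refine isBounded_iff_forall_norm_le.2 ⟨M, ?_⟩
      rintro _ ⟨t, ht, rfl⟩
      exact (hM t ht).2
    rw [← Ioo_union_both zero_le_one, image_union]
    exact h1.union ((toFinite _).image _).isBounded
  exact (key S.cutP).union (key S.cutR)

/-- The entry `F̃₂(ψ_Q(z))` has a limit as `z → 0`, so that its value at the pole is not a junk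
value of `limUnder`. -/
theorem exists_tendsto_F_one_ψQ {r : ℂ → ℂ} (hr : S.IsSqrtBranch r) :
    ∃ L : ℂ, Tendsto (fun z => S.F r 1 (S.ψQ z)) (𝓝[≠] 0) (𝓝 L) := by
  obtain ⟨L, hL, hlim⟩ := exists_tendsto_sqrt_div_sq S.isBounded_cuts hr.holo.continuousOn hr.sq
  have hinv : Tendsto (fun w : ℂ => (w ^ 2)⁻¹) (Bornology.cobounded ℂ) (𝓝 0) := by
    have := (tendsto_inv₀_cobounded (α := ℂ)).pow 2
    simpa using this
  have h1 : Tendsto (fun w : ℂ => (1 - (w ^ 2)⁻¹) * ((1 - (w ^ 2)⁻¹) / (1 - (w ^ 2)⁻¹ / 3) *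
      exp (2 / (1 - (w ^ 2)⁻¹))) / (3 * (r w / w ^ 2))) (Bornology.cobounded ℂ)
      (𝓝 ((1 - 0) * ((1 - 0) / (1 - 0 / 3) * exp (2 / (1 - 0))) / (3 * L))) :=
    (((hinv.const_sub 1).mul (((hinv.const_sub 1).div ((hinv.div_const 3).const_sub 1)
      (by norm_num)).mul ((continuous_exp.tendsto _).comp
        (tendsto_const_nhds.div (hinv.const_sub 1) (by norm_num))))).div
      (hlim.const_mul 3) (by simpa using hL))
  refine ⟨_, (h1.comp S.tendsto_ψQ_zero).congr' ?_⟩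
  filter_upwards [self_mem_nhdsWithin, nhdsWithin_le_nhds S.compl_mem_nhds_zero] with z hz0 hz
  have hz0' : z ≠ 0 := hz0
  have hroot := S.root_ψQ (S.mem_compl hz hz0')
  have hne := cube_sub_ne_zero hroot
  rw [Function.comp_apply, F_one, S.G_ψQ hz hz0']
  generalize S.ψQ z = w at *
  have h0 : w ≠ 0 := by rintro rfl; norm_num at hne
  have e1 : 1 - (w ^ 2)⁻¹ = (w ^ 2 - 1) / w ^ 2 := by field_simp
  have e2 : 1 - (w ^ 2)⁻¹ / 3 = (w ^ 2 - 1 / 3) / w ^ 2 := by field_simp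
  have e3 : 2 / ((w ^ 2 - 1) / w ^ 2) = 2 * w ^ 2 / (w ^ 2 - 1) := by rw [div_div_eq_mul_div]
  rw [e1, e2, e3, div_div_div_cancel_right₀ (pow_ne_zero 2 h0)]
  generalize (w ^ 2 - 1) / (w ^ 2 - 1 / 3) * exp (2 * w ^ 2 / (w ^ 2 - 1)) = E
  -- `r w` is a denominator on both sides, so that a zero of it does no harm
  rcases eq_or_ne (r w) 0 with hr | hr
  · simp [hr]
  · field_simp

theorem FQ_of_ne (r : ℂ → ℂ) (i : Fin 3) {z : ℂ} (hz : z ≠ 0) :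
    S.FQ r i z = S.F r i (S.ψQ z) := if_neg hz

end SheetStructure

end HermitePade

end

open HermitePade in
theorem corollary4p2 (S : SheetStructure) (r : ℂ → ℂ) (hr : S.IsSqrtBranch r) :
    -- the potentials are defined at every point off the cuts
    (∀ z ∈ (S.ΓP ∪ S.ΓR)ᶜ, (∃ g, S.IsGP z g) ∧ (∃ g, S.IsGA z g) ∧ (∃ g, S.IsGR z g)) ∧
    -- the formulas hold for every choice of values of the potentials
    (∀ gP gA gR : ℂ → ℂ,
      (∀ z ∈ (S.ΓP ∪ S.ΓR)ᶜ, S.IsGP z (gP z)) →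
      (∀ z ∈ (S.ΓP ∪ S.ΓR)ᶜ, S.IsGA z (gA z)) →
      (∀ z ∈ (S.ΓP ∪ S.ΓR)ᶜ, S.IsGR z (gR z)) →
      (∀ z ∈ (S.ΓP ∪ S.ΓR)ᶜ,
        S.Ntilde r z 1 0 =
          (S.ψP z ^ 2 - 1) ^ 2 * Complex.exp (gP z) / (2 * r (S.ψP z))) ∧
      (∀ z ∈ (S.ΓP ∪ S.ΓR)ᶜ, z ≠ 0 →
        S.Ntilde r z 1 1 =
          -(z ^ 2 * (S.ψQ z ^ 2 - 1) ^ 2 * Complex.exp (-gA z) / r (S.ψQ z))) ∧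
      -- at `z = 0`, where `ψ_Q` has its pole, the right-hand side is read as a limit
      Tendsto
        (fun z => -(z ^ 2 * (S.ψQ z ^ 2 - 1) ^ 2 * Complex.exp (-gA z) / r (S.ψQ z)))
        (𝓝[≠] 0) (𝓝 (S.Ntilde r 0 1 1)) ∧
      (∀ z ∈ (S.ΓP ∪ S.ΓR)ᶜ,
        S.Ntilde r z 1 2 =
          (S.ψR z ^ 2 - 1) ^ 2 * Complex.exp (gR z) / (2 * r (S.ψR z)))) := by
  refine ⟨fun z hz => ?_, fun gP gA gR hP hA hR => ⟨fun z hz => ?_, fun z hz hz0 => ?_, ?_,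
    fun z hz => ?_⟩⟩
  · obtain ⟨a, ha⟩ : ∃ g, S.IsGP z g :=
      exists_isLogPotential S.arcP.continuousOn fun h => hz (Or.inl h)
    obtain ⟨b, hb⟩ : ∃ g, S.IsGR z g :=
      exists_isLogPotential S.arcR.continuousOn fun h => hz (Or.inr h)
    exact ⟨⟨a, ha⟩, ⟨a + b, a, b, ha, hb, rfl⟩, ⟨b, hb⟩⟩
  · exact S.F_one_ψP r hz (hP z hz)
  · exact (S.FQ_of_ne r 1 hz0).trans (S.F_one_ψQ r hz hz0 (hA z hz))
  · obtain ⟨L, hL⟩ := S.exists_tendsto_F_one_ψQ hr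
    have hN : S.Ntilde r 0 1 1 = L := by
      change S.FQ r 1 0 = L
      rw [SheetStructure.FQ, if_pos rfl, hL.limUnder_eq]
    rw [hN]
    refine hL.congr' ?_
    filter_upwards [self_mem_nhdsWithin, nhdsWithin_le_nhds S.compl_mem_nhds_zero] with z hz0 hz
    exact S.F_one_ψQ r hz hz0 (hA z hz)
  · exact S.F_one_ψR r hz (hR z hz)
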